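/- Let $N\ge 0$ and let $V=\mathbb{R}^N$ carry the standard inner product $(\cdot,\cdot)$. For $0\neq v\in V$ let $R_v(x)=x-2\frac{(x,v)}{(v,v)}v$. Let $\mathcal{R}\subset V\setminus\{0\}$ be a finite (possibly empty) root system, i.e. a finite set such that $R_v(\mathcal{R})\subseteq\mathcal{R}$ for all $v\in\mathcal{R}$ and such that any two collinear $v,w\in\mathcal{R}$ satisfy $w=\pm v$. Let $W(\mathcal{R})\subset O(N,\mathbb{R})$ be the (finite) group generated by the $R_v$, $v\in\mathcal{R}$. Let $\nu=(\nu_v)_{v\in\mathcal{R}}$ be complex constants such that $\nu_v=\nu_w$ whenever $R_v$ and $R_w$ are conjugate in $W(\mathcal{R})$. Let $H_{W(\mathcal{R})}(\nu)$ be the associative unital complex algebra generated by the group algebra $\mathbb{C}[W(\mathcal{R})]$ and elements $a_{\alpha i}$ ($\alpha=0,1$, $i=1,\dots,N$) subject to the following relations, where $x_\alpha=\sum_i x^i a_{\alpha i}$ for $x\in V$: for all $g\in W(\mathcal{R})$, $x,y\in V$ and $\alpha,\beta\in\{0,1\}$, $$g\,x_\alpha=(gx)_\alpha\,g,\qquad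 [x_\alpha,y_\beta]=\varepsilon_{\alpha\beta}\Big((x,y)+\sum_{v\in\mathcal{R}}\nu_v\frac{(x,v)(y,v)}{(v,v)}R_v\Big),$$ with $\varepsilon$ antisymmetric and $\varepsilon_{01}=1$. It is a superalgebra with parity $\pi(a_{\alpha i})=1$, $\pi(g)=0$. A trace on it is a linear function $t$ with $t(fg)=t(gf)$ for all $f,g$; a supertrace is a linear function $s$ with $s(fg)=(-1)^{\pi(f)\pi(g)}s(gf)$ for all homogeneous $f,g$. Let $T_{\mathcal{R}}$ (respectively $ST_{\mathcal{R}}$) be the number of conjugacy classes of $W(\mathcal{R})$ whose elements do not have the eigenvalue $1$ (respectively $-1$) on $V$. Then the complex vector space of traces on $H_{W(\mathcal{R})}(\nu)$ is finite-dimensional of dimension exactly $T_{\mathcal{R}}$, and the complex vector space of supertraces is finite-dimensional of dimension exactly $ST_{\mathcal{R}}$. -/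

import Mathlib

namespace Calogero

open scoped InnerProductSpace

/-- The Euclidean space `V = ℝ^N`. -/
abbrev V (N : ℕ) : Type := EuclideanSpace ℝ (Fin N)

/-- The orthogonal reflection in the hyperplane orthogonal to `v`. -/
noncomputable def refl {N : ℕ} (v : V N) : V N ≃ₗᵢ[ℝ] V N :=
  (Submodule.span ℝ {v})ᗮ.reflection

/-- The explicit formula for the reflection. -/
theorem refl_apply {N : ℕ} (v x : V N) :
    refl v x = x - (2 * (⟪x, v⟫_ℝ / ⟪v, v⟫_ℝ)) • v := by
  rw [refl, Submodule.reflection_orthogonal_apply, Submodule.reflection_singleton_apply,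
    real_inner_self_eq_norm_sq, real_inner_comm, mul_smul, two_smul, two_smul]
  simp

/-- Finite root systems in `ℝ^N` (not necessarily crystallographic or spanning;
the empty set is allowed). Roots are nonzero, since reflections are attached to them. -/
structure IsRootSystem {N : ℕ} (R : Finset (V N)) : Prop where
  zero_notMem : (0 : V N) ∉ R
  refl_mem : ∀ v ∈ R, ∀ w ∈ R, refl v w ∈ R
  collinear : ∀ v ∈ R, ∀ w ∈ R, (∃ c : ℝ, w = c • v) → w = v ∨ w = -v

/-- The group generated by the reflections in the elements of `R`. -/
noncomputable def W {N : ℕ} (R : Finset (V N)) : Subgroup (V N ≃ₗᵢ[ℝ] V N) :=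
  Subgroup.closure {s | ∃ v ∈ R, s = refl v}

/-- The reflection in a root, as an element of the reflection group. -/
noncomputable def reflW {N : ℕ} {R : Finset (V N)} (v : R) : W R :=
  ⟨refl (v : V N), Subgroup.subset_closure ⟨v, v.2, rfl⟩⟩

/-- The parameters depend only on the conjugacy class of the reflection. -/
def IsInvariantParam {N : ℕ} {R : Finset (V N)} (ν : R → ℂ) : Prop :=
  ∀ v w : R, IsConj (reflW v) (reflW w) → ν v = ν w

/-- Generators of the algebra: the letters `a_{α i}` and the group elements. -/
inductive Gen {N : ℕ} (R : Finset (V N)) : Type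
  | a (α : Fin 2) (i : Fin N) : Gen R
  | g (w : W R) : Gen R

/-- The free complex algebra on the generators. -/
abbrev Free {N : ℕ} (R : Finset (V N)) : Type := FreeAlgebra ℂ (Gen R)

/-- The group element `w` in the free algebra. -/
noncomputable def Free.grp {N : ℕ} {R : Finset (V N)} (w : W R) : Free R :=
  FreeAlgebra.ι ℂ (Gen.g w)

/-- The copy `x_α = ∑ i, x^i a_{α i}` of the vector `x` in the free algebra. -/
noncomputable def Free.vec {N : ℕ} {R : Finset (V N)} (α : Fin 2) (x : V N) : Free R :=
  ∑ i : Fin N, ((x i : ℝ) : ℂ) • FreeAlgebra.ι ℂ (Gen.a α i)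

/-- The antisymmetric tensor with `ε_{01} = 1`. -/
def eps : Matrix (Fin 2) (Fin 2) ℂ := !![0, 1; -1, 0]

/-- The defining relations: those of the complex group algebra, the exchange relations
`w x_α = (w x)_α w` and the commutation relations of `x_α` and `y_β`. -/
inductive Rel {N : ℕ} {R : Finset (V N)} (ν : R → ℂ) : Free R → Free R → Prop
  | grp_one : Rel ν (Free.grp 1) 1
  | grp_mul (w₁ w₂ : W R) : Rel ν (Free.grp w₁ * Free.grp w₂) (Free.grp (w₁ * w₂))
  | grp_vec (w : W R) (α : Fin 2) (x : V N) :
      Rel ν (Free.grp w * Free.vec α x)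
        (Free.vec α ((w : V N ≃ₗᵢ[ℝ] V N) x) * Free.grp w)
  | comm (α β : Fin 2) (x y : V N) :
      Rel ν (Free.vec α x * Free.vec β y - Free.vec β y * Free.vec α x)
        (eps α β • (algebraMap ℂ (Free R) ((⟪x, y⟫_ℝ : ℝ) : ℂ) +
          ∑ v : R, (ν v * ((⟪x, (v : V N)⟫_ℝ * ⟪y, (v : V N)⟫_ℝ /
            ⟪(v : V N), (v : V N)⟫_ℝ : ℝ) : ℂ)) • Free.grp (reflW v)))

/-- The algebra `H_{W(R)}(ν)` of observables of the rational Calogero model. -/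
abbrev H {N : ℕ} {R : Finset (V N)} (ν : R → ℂ) : Type := RingQuot (Rel ν)

/-- The image of a generator in `H_{W(R)}(ν)`. -/
noncomputable def gen {N : ℕ} {R : Finset (V N)} (ν : R → ℂ) (t : Gen R) : H ν :=
  RingQuot.mkAlgHom ℂ (Rel ν) (FreeAlgebra.ι ℂ t)

/-- The parity of a generator: `1` for the letters `a_{α i}`, `0` for group elements. -/
def genParity {N : ℕ} {R : Finset (V N)} : Gen R → ZMod 2
  | Gen.a _ _ => 1
  | Gen.g _ => 0

/-- The homogeneous component of parity `p`, spanned by the words in the generators whose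
parities add up to `p`. All defining relations are homogeneous for this parity. -/
noncomputable def parityPart {N : ℕ} {R : Finset (V N)} (ν : R → ℂ) (p : ZMod 2) :
    Submodule ℂ (H ν) :=
  Submodule.span ℂ {f | ∃ l : List (Gen R),
    (l.map genParity).sum = p ∧ f = (l.map (gen ν)).prod}

/-- The complex vector space of traces on `H_{W(R)}(ν)`. -/
noncomputable def traces {N : ℕ} {R : Finset (V N)} (ν : R → ℂ) :
    Submodule ℂ (Module.Dual ℂ (H ν)) where
  carrier := {t | ∀ f g : H ν, t (f * g) = t (g * f)}
  add_mem' := by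
    intro s t hs ht f g
    simp only [LinearMap.add_apply, hs f g, ht f g]
  zero_mem' := by
    intro f g
    simp only [LinearMap.zero_apply]
  smul_mem' := by
    intro c s hs f g
    simp only [LinearMap.smul_apply, hs f g]

/-- The complex vector space of supertraces on `H_{W(R)}(ν)`. -/
noncomputable def supertraces {N : ℕ} {R : Finset (V N)} (ν : R → ℂ) :
    Submodule ℂ (Module.Dual ℂ (H ν)) where
  carrier := {s | ∀ p q : ZMod 2, ∀ f ∈ parityPart ν p, ∀ g ∈ parityPart ν q,
    s (f * g) = (-1 : ℂ) ^ (p.val * q.val) * s (g * f)}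
  add_mem' := by
    intro s t hs ht p q f hf g hg
    simp only [LinearMap.add_apply, hs p q f hf g hg, ht p q f hf g hg, mul_add]
  zero_mem' := by
    intro p q f _ g _
    simp only [LinearMap.zero_apply, mul_zero]
  smul_mem' := by
    intro c s hs p q f hf g hg
    simp only [LinearMap.smul_apply, hs p q f hf g hg, smul_eq_mul]
    ring

/-- The number of conjugacy classes of the reflection group whose elements, acting on `ℝ^N`,
do not have the eigenvalue `c`. -/
noncomputable def numClassesWithoutEigenvalue {N : ℕ} (R : Finset (V N)) (c : ℝ) : ℕ :=
  Nat.card {C : ConjClasses (W R) // ∀ w ∈ C.carrier,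
    ¬ Module.End.HasEigenvalue
      ((w : V N ≃ₗᵢ[ℝ] V N).toLinearEquiv : V N →ₗ[ℝ] V N) c}

end Calogero

namespace Calogero
open scoped InnerProductSpace

/-! ### Reflection groups: action on the roots and finiteness. -/

section Group

variable {N : ℕ} {R : Finset (V N)}

/-! Both statements are cases κ = 1 and κ = -1 of one fact about twisted traces: functionals t with
t(h x_γ) = κ t(x_γ h) and t(h g) = t(g h) for g in the group. Traces and supertraces are such
functionals (`traces_eq`, `supertraces_eq`). The fact is that a twisted trace can be prescribed, in
exactly one way, by its values on the conjugacy classes of elements without eigenvalue κ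
(`classValues_bijective`).

A PBW theorem (`pbw`), proved by letting the algebra act through Dunkl-type operators, identifies it
with polynomials in the a_{αi} times group elements, on one space for all ν. There F ↦ F x_γ - κ x_γ
F becomes `commOp`, the sum of its value `weylOp` at ν = 0 and of `reflOp`, which is linear in ν. On
the summand of g, the leading part of `weylOp` is multiplication by a linear form for x orthogonal
to the κ-eigenspace of g, and for x in the eigenspace it is a derivative. A homotopy of Koszul type
off the eigenspace and of de Rham type on it produces a Laplacian `lapl`.

Put E(g) = dim of the κ-eigenspace of g. For the weight deg f + E(g), the Laplacian is triangular
with diagonal entries deg f + 2E(g): second-order terms lower the degree, and the parameter terms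
lower the weight because a reflection changes E in a controlled way (`lapl_reflOp_mem_lower`). The
entries vanish exactly at group elements with E(g) = 0. Hence a functional killing the image of
`lapl` exists uniquely for any values on these elements. Twisted traces kill this image, which gives
uniqueness.

For existence, replace ν by sν and solve over polynomials in s. The solution T is conjugation
invariant by uniqueness. Its failure to be a twisted trace, `defect`, satisfies a homotopy identity
in degree one (`defect_homotopy`) whose right side carries an extra factor s. Since the degree-one
operator on the left is triangular with nonzero diagonal, induction shows that every power of s
divides the defect (`X_pow_dvd_defect`). So it vanishes, and s = 1 gives the required functional. -/

theorem refl_conj (w : V N ≃ₗᵢ[ℝ] V N) (v : V N) : w * refl v = refl (w v) * w := by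
  ext1 x
  simp only [LinearIsometryEquiv.coe_mul, Function.comp_apply, refl_apply, map_sub, map_smul,
    LinearIsometryEquiv.inner_map_map]

theorem refl_mul_self (v : V N) : refl v * refl v = 1 := by
  rw [refl, Submodule.reflection_mul_reflection]

theorem refl_inv (v : V N) : (refl v)⁻¹ = refl v :=
  inv_eq_of_mul_eq_one_left (refl_mul_self v)

theorem IsRootSystem.apply_mem (hR : IsRootSystem R) (w : W R) {v : V N} (hv : v ∈ R) :
    (w : V N ≃ₗᵢ[ℝ] V N) v ∈ R := by
  obtain ⟨w, hw⟩ := w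
  suffices h : ∀ v ∈ R, w v ∈ R ∧ w⁻¹ v ∈ R from (h v hv).1
  induction hw using Subgroup.closure_induction with
  | mem x hx =>
    obtain ⟨u, hu, rfl⟩ := hx
    intro v hv
    rw [refl_inv]
    exact ⟨hR.refl_mem u hu v hv, hR.refl_mem u hu v hv⟩
  | one => intro v hv; simpa using hv
  | mul x y _ _ hx hy =>
    intro v hv
    rw [mul_inv_rev]
    exact ⟨(hx _ (hy v hv).1).1, (hy _ (hx v hv).2).2⟩
  | inv x _ hx =>
    intro v hv
    rw [inv_inv]
    exact (hx v hv).symm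

theorem IsRootSystem.ne_zero (hR : IsRootSystem R) (v : R) : (v : V N) ≠ 0 :=
  fun h => hR.zero_notMem (h ▸ v.2)

/-- The permutation of the roots induced by an element of the reflection group. -/
noncomputable def IsRootSystem.perm (hR : IsRootSystem R) (w : W R) : Equiv.Perm R where
  toFun v := ⟨(w : V N ≃ₗᵢ[ℝ] V N) v, hR.apply_mem w v.2⟩
  invFun v := ⟨((w⁻¹ : W R) : V N ≃ₗᵢ[ℝ] V N) v, hR.apply_mem w⁻¹ v.2⟩
  left_inv v := by
    ext1
    exact (w : V N ≃ₗᵢ[ℝ] V N).symm_apply_apply v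
  right_inv v := by
    ext1
    exact (w : V N ≃ₗᵢ[ℝ] V N).apply_symm_apply v

@[simp]
theorem IsRootSystem.coe_perm (hR : IsRootSystem R) (w : W R) (v : R) :
    (hR.perm w v : V N) = (w : V N ≃ₗᵢ[ℝ] V N) v := rfl

theorem sub_mem_span_roots (w : W R) (x : V N) :
    (w : V N ≃ₗᵢ[ℝ] V N) x - x ∈ Submodule.span ℝ (R : Set (V N)) := by
  obtain ⟨w, hw⟩ := w
  induction hw using Subgroup.closure_induction generalizing x with
  | mem u hu =>
    obtain ⟨v, hv, rfl⟩ := hu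
    simp only [refl_apply, sub_sub_cancel_left]
    exact Submodule.neg_mem _ (Submodule.smul_mem _ _ (Submodule.subset_span hv))
  | one => simp
  | mul a b _ _ ha hb =>
    have := Submodule.add_mem _ (ha (b x)) (hb x)
    simpa using this
  | inv a _ ha =>
    have := Submodule.neg_mem _ (ha (a⁻¹ x))
    rw [neg_sub] at this
    convert this using 2
    exact (a.apply_symm_apply x).symm

/-- The roots need not span, so fixing them all is not at once being the identity. But w x - x lies
in their span and is then fixed by w, so its inner products with w x and with x agree and its norm
is zero. -/
theorem IsRootSystem.perm_injective (hR : IsRootSystem R) : Function.Injective hR.perm := by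
  intro w₁ w₂ h
  have key : ∀ w : W R, (∀ v ∈ R, (w : V N ≃ₗᵢ[ℝ] V N) v = v) → w = 1 := by
    intro w hw
    have hspan : ∀ p ∈ Submodule.span ℝ (R : Set (V N)), (w : V N ≃ₗᵢ[ℝ] V N) p = p := by
      intro p hp
      induction hp using Submodule.span_induction with
      | mem x hx => exact hw x hx
      | zero => simp
      | add x y _ _ hx hy => rw [map_add, hx, hy]
      | smul a x _ hx => rw [map_smul, hx]
    ext1
    ext1 x
    have h1 := sub_mem_span_roots w x
    have h2 : ⟪(w : V N ≃ₗᵢ[ℝ] V N) x - x, (w : V N ≃ₗᵢ[ℝ] V N) x - x⟫_ℝ = 0 := by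
      have h3 := (w : V N ≃ₗᵢ[ℝ] V N).inner_map_map x ((w : V N ≃ₗᵢ[ℝ] V N) x - x)
      rw [hspan _ h1] at h3
      rw [inner_sub_left, h3, sub_self]
    exact sub_eq_zero.1 (inner_self_eq_zero.1 h2)
  have : w₂⁻¹ * w₁ = 1 := by
    apply key
    intro v hv
    have h4 := congrArg (fun p : Equiv.Perm R => ((p ⟨v, hv⟩ : R) : V N)) h
    simp only [coe_perm] at h4
    change (w₂ : V N ≃ₗᵢ[ℝ] V N).symm ((w₁ : V N ≃ₗᵢ[ℝ] V N) v) = v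
    rw [h4]
    exact (w₂ : V N ≃ₗᵢ[ℝ] V N).symm_apply_apply v
  exact (inv_mul_eq_one.1 this).symm

theorem IsRootSystem.finite (hR : IsRootSystem R) : Finite (W R) :=
  Finite.of_injective _ hR.perm_injective

theorem mul_reflW (hR : IsRootSystem R) (w : W R) (v : R) :
    w * reflW v = reflW (hR.perm w v) * w := by
  ext1
  exact refl_conj _ _

@[simp]
theorem coe_reflW (v : R) : ((reflW v : W R) : V N ≃ₗᵢ[ℝ] V N) = refl (v : V N) := rfl

theorem IsInvariantParam.perm {ν : R → ℂ} (hν : IsInvariantParam ν) (hR : IsRootSystem R)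
    (w : W R) (v : R) : ν (hR.perm w v) = ν v := by
  refine hν _ _ (isConj_comm.1 (isConj_iff.2 ⟨w, ?_⟩))
  rw [mul_reflW hR, mul_inv_cancel_right]

end Group

end Calogero

namespace Calogero
open scoped InnerProductSpace
open MvPolynomial

/-! ### Polynomials in two copies of V: derivatives, isometries and divided differences. -/

section Polynomials

variable {N : ℕ} {E F : Type*} [AddCommGroup E] [Module ℂ E] [AddCommGroup F] [Module ℂ F]

/-- The standard basis vectors of `V N`. -/
noncomputable abbrev e (i : Fin N) : V N := EuclideanSpace.single i 1

/-- The semilinear map from `V N` to a complex vector space with prescribed values on the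
standard basis. -/
noncomputable def comb (c : Fin N → E) : V N →ₛₗ[Complex.ofRealHom] E where
  toFun x := ∑ i, ((x i : ℝ) : ℂ) • c i
  map_add' x y := by simp [add_smul, Finset.sum_add_distrib]
  map_smul' r x := by simp [Finset.smul_sum, mul_smul]

theorem comb_apply (c : Fin N → E) (x : V N) : comb c x = ∑ i, ((x i : ℝ) : ℂ) • c i := rfl

@[simp]
theorem comb_e (c : Fin N → E) (i : Fin N) : comb c (e i) = c i := by
  simp only [comb_apply, PiLp.single_apply]
  rw [Finset.sum_eq_single i] <;> simp +contextual

theorem sum_coord (x : V N) : ∑ i, x i • e i = x := by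
  ext j
  simp [Pi.single_apply]

theorem semilinear_apply (f : V N →ₛₗ[Complex.ofRealHom] E) (x : V N) :
    f x = ∑ i, ((x i : ℝ) : ℂ) • f (e i) := by
  conv_lhs => rw [← sum_coord x]
  simp only [map_sum, map_smulₛₗ]
  rfl

theorem inner_eq_sum (x y : V N) : ⟪x, y⟫_ℝ = ∑ i, x i * y i := by
  simp [PiLp.inner_apply, mul_comm]

theorem inner_e (x : V N) (i : Fin N) : ⟪x, e i⟫_ℝ = x i := by
  simp [EuclideanSpace.inner_single_right]

/-- Polynomials in the commuting letters `a_{α i}`. -/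
abbrev Pol (N : ℕ) : Type := MvPolynomial (Fin 2 × Fin N) ℂ

/-- The linear form `x_α`. -/
noncomputable def lin (α : Fin 2) : V N →ₛₗ[Complex.ofRealHom] Pol N :=
  comb fun i => X (α, i)

@[simp]
theorem lin_e (α : Fin 2) (i : Fin N) : lin α (e i) = X (α, i) := comb_e _ _

theorem lin_ne_zero {α : Fin 2} {x : V N} (hx : x ≠ 0) : lin α x ≠ 0 := by
  intro h
  apply hx
  ext i
  have h1 := congrArg (coeff (Finsupp.single (α, i) 1)) h
  simp only [lin, comb_apply, coeff_sum, coeff_smul, coeff_X, coeff_zero] at h1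
  rw [Finset.sum_eq_single i] at h1
  · simpa using h1
  · intro j _ hj
    rw [if_neg, smul_zero]
    intro h2
    rw [Finsupp.single_left_inj one_ne_zero] at h2
    exact hj (congrArg Prod.snd h2)
  · simp

/-- The derivative in the direction `x_α`. -/
noncomputable def pd (α : Fin 2) : V N →ₛₗ[Complex.ofRealHom] (Pol N →ₗ[ℂ] Pol N) :=
  comb fun i => (pderiv (α, i)).toLinearMap

@[simp]
theorem pd_e (α : Fin 2) (i : Fin N) (f : Pol N) : pd α (e i) f = pderiv (α, i) f := by
  rw [pd, comb_e]
  rfl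

theorem pd_apply (α : Fin 2) (x : V N) (f : Pol N) :
    pd α x f = ∑ i, ((x i : ℝ) : ℂ) • pderiv (α, i) f := by
  simp [pd, comb_apply]

theorem pd_mul (α : Fin 2) (x : V N) (f h : Pol N) :
    pd α x (f * h) = pd α x f * h + f * pd α x h := by
  simp only [pd_apply, Finset.sum_mul, Finset.mul_sum]
  rw [← Finset.sum_add_distrib]
  refine Finset.sum_congr rfl fun i _ => ?_
  rw [Derivation.leibniz]
  simp only [smul_eq_mul, smul_eq_C_mul]
  ring

@[simp]
theorem pd_C (α : Fin 2) (x : V N) (c : ℂ) : pd α x (C c) = 0 := by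
  simp [pd_apply]

theorem pd_X (α β : Fin 2) (x : V N) (i : Fin N) :
    pd α x (X (β, i)) = if α = β then C ((x i : ℝ) : ℂ) else 0 := by
  rw [pd_apply]
  split_ifs with h
  · subst h
    rw [Finset.sum_eq_single i]
    · simp [smul_eq_C_mul]
    · intro j _ hj
      rw [pderiv_X_of_ne, smul_zero]
      intro h
      exact hj (congrArg Prod.snd h).symm
    · simp
  · refine Finset.sum_eq_zero fun j _ => ?_
    rw [pderiv_X_of_ne, smul_zero]
    intro h1
    exact h (congrArg Prod.fst h1).symm

theorem pd_lin (α β : Fin 2) (x y : V N) :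
    pd α x (lin β y) = if α = β then C ((⟪x, y⟫_ℝ : ℝ) : ℂ) else 0 := by
  rw [lin, comb_apply]
  simp only [map_sum, map_smul, pd_X, inner_eq_sum]
  split_ifs
  · simp only [Complex.ofReal_sum, map_sum, Complex.ofReal_mul, map_mul, smul_eq_C_mul]
    exact Finset.sum_congr rfl fun i _ => mul_comm _ _
  · simp

theorem pd_comm (α β : Fin 2) (x y : V N) (f : Pol N) :
    pd α x (pd β y f) = pd β y (pd α x f) := by
  induction f using MvPolynomial.induction_on with
  | C a => simp
  | add p q hp hq => simp only [map_add, hp, hq]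
  | mul_X p i hp =>
    obtain ⟨γ, i⟩ := i
    have h1 : ∀ (α β : Fin 2) (x y : V N), pd α x (pd β y (X (γ, i))) = 0 := by
      intro α β x y
      rw [pd_X]
      split_ifs <;> simp
    simp only [pd_mul, map_add, hp, h1]
    ring

/-- The action of a pair of isometries on polynomials, one on each kind of letters. -/
noncomputable def act (A : Fin 2 → V N ≃ₗᵢ[ℝ] V N) : Pol N →ₐ[ℂ] Pol N :=
  aeval fun p => lin p.1 (A p.1 (e p.2))

@[simp]
theorem act_X (A : Fin 2 → V N ≃ₗᵢ[ℝ] V N) (α : Fin 2) (i : Fin N) :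
    act A (X (α, i)) = lin α (A α (e i)) := by
  simp [act]

@[simp]
theorem act_lin (A : Fin 2 → V N ≃ₗᵢ[ℝ] V N) (α : Fin 2) (x : V N) :
    act A (lin α x) = lin α (A α x) := by
  conv_rhs => rw [← sum_coord x]
  rw [lin, comb_apply]
  simp only [map_sum, map_smul, act_X, map_smulₛₗ]
  rfl

theorem act_act (A B : Fin 2 → V N ≃ₗᵢ[ℝ] V N) (f : Pol N) :
    act A (act B f) = act (A * B) f := by
  have : (act A).comp (act B) = act (A * B) := by
    apply MvPolynomial.algHom_ext
    rintro ⟨α, i⟩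
    simp
  exact DFunLike.congr_fun this f

@[simp]
theorem act_one (f : Pol N) : act 1 f = f := by
  have : act (1 : Fin 2 → V N ≃ₗᵢ[ℝ] V N) = AlgHom.id ℂ _ := by
    apply MvPolynomial.algHom_ext
    rintro ⟨α, i⟩
    simp
  rw [this]
  rfl

@[simp]
theorem act_C (A : Fin 2 → V N ≃ₗᵢ[ℝ] V N) (c : ℂ) : act A (C c) = C c := by
  simp [act]

theorem act_pd (A : Fin 2 → V N ≃ₗᵢ[ℝ] V N) (α : Fin 2) (x : V N) (f : Pol N) :
    act A (pd α x f) = pd α (A α x) (act A f) := by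
  induction f using MvPolynomial.induction_on with
  | C a => simp
  | add p q hp hq => simp only [map_add, hp, hq]
  | mul_X p i hp =>
    obtain ⟨β, i⟩ := i
    rw [← lin_e]
    simp only [pd_mul, map_add, map_mul, hp, act_lin, pd_lin]
    split_ifs with h
    · subst h
      simp only [act_C, LinearIsometryEquiv.inner_map_map]
    · simp

/-- The reflection acting on one kind of letters only. -/
noncomputable abbrev pr (α : Fin 2) (v : V N) : Fin 2 → V N ≃ₗᵢ[ℝ] V N :=
  Pi.mulSingle α (refl v)

theorem lin_dvd_sub_act (α : Fin 2) (v : V N) (f : Pol N) :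
    2 * lin α v ∣ f - act (pr α v) f := by
  induction f using MvPolynomial.induction_on with
  | C a => simp
  | add p q hp hq =>
    rw [map_add, add_sub_add_comm]
    exact dvd_add hp hq
  | mul_X p i hp =>
    obtain ⟨β, i⟩ := i
    rw [map_mul, ← lin_e, act_lin]
    have h : p * lin β (e i) - act (pr α v) p * lin β (pr α v β (e i)) =
        (p - act (pr α v) p) * lin β (e i) +
          act (pr α v) p * (lin β (e i) - lin β (pr α v β (e i))) := by ring
    rw [h]
    refine dvd_add (dvd_mul_of_dvd_left hp _) (dvd_mul_of_dvd_right ?_ _)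
    by_cases hβ : β = α
    · subst hβ
      rw [pr, Pi.mulSingle_eq_same, refl_apply, ← map_sub, sub_sub_cancel, map_smulₛₗ]
      refine ⟨C ((⟪e i, v⟫_ℝ / ⟪v, v⟫_ℝ : ℝ) : ℂ), ?_⟩
      simp only [smul_eq_C_mul, Complex.ofRealHom_eq_coe, map_mul]
      simp only [Complex.ofReal_ofNat, map_ofNat]
      ring
    · rw [pr, Pi.mulSingle_eq_of_ne hβ]
      simp

/-- The divided difference `(f - R_v f) / (2 v)` in one kind of letters. -/
noncomputable def dd (α : Fin 2) (v : V N) : Pol N →ₗ[ℂ] Pol N :=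
  open scoped Classical in
  -- The value at v = 0 is never used, roots being nonzero.
  if hv : v = 0 then 0 else
  { toFun f := (lin_dvd_sub_act α v f).choose
    map_add' f h := by
      have h0 : 2 * lin α v ≠ 0 := mul_ne_zero two_ne_zero (lin_ne_zero hv)
      apply mul_left_cancel₀ h0
      rw [mul_add, ← (lin_dvd_sub_act α v f).choose_spec, ← (lin_dvd_sub_act α v h).choose_spec,
        ← (lin_dvd_sub_act α v (f + h)).choose_spec, map_add]
      ring
    map_smul' c f := by
      have h0 : 2 * lin α v ≠ 0 := mul_ne_zero two_ne_zero (lin_ne_zero hv)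
      apply mul_left_cancel₀ h0
      rw [RingHom.id_apply, mul_smul_comm, ← (lin_dvd_sub_act α v f).choose_spec,
        ← (lin_dvd_sub_act α v (c • f)).choose_spec, map_smul, smul_sub] }

theorem lin_mul_dd (α : Fin 2) {v : V N} (hv : v ≠ 0) (f : Pol N) :
    2 * lin α v * dd α v f = f - act (pr α v) f := by
  rw [dd, dif_neg hv]
  exact (lin_dvd_sub_act α v f).choose_spec.symm

theorem eq_dd_of_mul {α : Fin 2} {v : V N} (hv : v ≠ 0) {f h : Pol N}
    (hh : 2 * lin α v * h = f - act (pr α v) f) : dd α v f = h := by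
  apply mul_left_cancel₀ (mul_ne_zero two_ne_zero (lin_ne_zero (α := α) hv))
  rw [lin_mul_dd α hv, hh]

/-- A twisted Leibniz rule: the reflection produced inside a word passes through the factors to its
right, and only these are reflected. -/
theorem dd_mul (α : Fin 2) {v : V N} (hv : v ≠ 0) (f h : Pol N) :
    dd α v (f * h) = dd α v f * act (pr α v) h + f * dd α v h := by
  apply eq_dd_of_mul hv
  rw [mul_add, ← mul_assoc, lin_mul_dd α hv, mul_left_comm, lin_mul_dd α hv, map_mul]
  ring

theorem dd_lin_same (α : Fin 2) {v : V N} (hv : v ≠ 0) (x : V N) :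
    dd α v (lin α x) = C ((⟪x, v⟫_ℝ / ⟪v, v⟫_ℝ : ℝ) : ℂ) := by
  apply eq_dd_of_mul hv
  rw [act_lin, pr, Pi.mulSingle_eq_same, refl_apply, ← map_sub, sub_sub_cancel, map_smulₛₗ]
  simp only [smul_eq_C_mul, Complex.ofRealHom_eq_coe, map_mul]
  simp only [Complex.ofReal_ofNat, map_ofNat]
  ring

theorem dd_eq_zero {α : Fin 2} {v : V N} (hv : v ≠ 0) {f : Pol N}
    (hf : act (pr α v) f = f) : dd α v f = 0 := by
  apply eq_dd_of_mul hv
  rw [hf, sub_self, mul_zero]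

theorem act_pr_lin_of_ne {α β : Fin 2} (h : β ≠ α) (v x : V N) :
    act (pr α v) (lin β x) = lin β x := by
  rw [act_lin, pr, Pi.mulSingle_eq_of_ne h]
  rfl

@[simp]
theorem dd_C (α : Fin 2) {v : V N} (hv : v ≠ 0) (c : ℂ) : dd α v (C c) = 0 :=
  dd_eq_zero hv (by simp)

theorem act_dd (A : Fin 2 → V N ≃ₗᵢ[ℝ] V N) (α : Fin 2) {v : V N} (hv : v ≠ 0) (f : Pol N) :
    act A (dd α v f) = dd α (A α v) (act A f) := by
  have hv' : A α v ≠ 0 := by simpa using hv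
  symm
  apply eq_dd_of_mul hv'
  have h1 := congrArg (act A) (lin_mul_dd α hv f)
  rw [map_mul, map_mul, map_ofNat, act_lin, map_sub] at h1
  rw [h1, act_act, act_act]
  congr 3
  ext1 β
  by_cases hβ : β = α
  · subst hβ
    simp [refl_conj]
  · simp [Pi.mulSingle_eq_of_ne hβ]

end Polynomials

end Calogero

namespace Calogero
open scoped InnerProductSpace
open MvPolynomial

/-! ### The regular representation by Dunkl operators. -/

section Representation

variable {N : ℕ} {R : Finset (V N)}

/-- The underlying space of the algebra: polynomials in the letters times group elements. -/
def Mod (R : Finset (V N)) : Type := W R →₀ Pol N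

noncomputable instance : AddCommGroup (Mod R) := inferInstanceAs (AddCommGroup (W R →₀ Pol N))

noncomputable instance : Module ℂ (Mod R) := inferInstanceAs (Module ℂ (W R →₀ Pol N))

/-- The element `f g` of the algebra, for a polynomial `f` and a group element `g`. -/
noncomputable def Mod.single (g : W R) : Pol N →ₗ[ℂ] Mod R :=
  (Finsupp.lsingle g : Pol N →ₗ[ℂ] W R →₀ Pol N)

/-- The linear map with prescribed components. -/
noncomputable def Mod.lift {M : Type*} [AddCommGroup M] [Module ℂ M] (T : W R → Pol N →ₗ[ℂ] M) :
    Mod R →ₗ[ℂ] M :=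
  (Finsupp.lsum ℂ T : (W R →₀ Pol N) →ₗ[ℂ] M)

@[simp]
theorem Mod.lift_single {M : Type*} [AddCommGroup M] [Module ℂ M] (T : W R → Pol N →ₗ[ℂ] M)
    (g : W R) (f : Pol N) : Mod.lift T (Mod.single g f) = T g f :=
  Finsupp.lsum_single ℂ T g f

theorem Mod.hom_ext {M : Type*} [AddCommGroup M] [Module ℂ M] {S T : Mod R →ₗ[ℂ] M}
    (h : ∀ g f, S (Mod.single g f) = T (Mod.single g f)) : S = T := by
  have : ∀ S T : (W R →₀ Pol N) →ₗ[ℂ] M,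
      (∀ g f, S (Finsupp.single g f) = T (Finsupp.single g f)) → S = T := by
    intro S T h
    ext1 g
    exact LinearMap.ext fun f => h g f
  exact this S T h

/-- The diagonal action of an isometry on polynomials. -/
noncomputable abbrev actW (w : W R) : Pol N →ₐ[ℂ] Pol N := act fun _ => (w : V N ≃ₗᵢ[ℝ] V N)

/-- Left multiplication by a group element. -/
noncomputable def leftGrp (w : W R) : Module.End ℂ (Mod R) :=
  Mod.lift fun g => Mod.single (w * g) ∘ₗ (actW w).toLinearMap

@[simp]
theorem leftGrp_single (w g : W R) (f : Pol N) :
    leftGrp w (Mod.single g f) = Mod.single (w * g) (actW w f) := by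
  simp [leftGrp]

/-- Left multiplication by `x_0`. -/
noncomputable def leftZero : V N →ₛₗ[Complex.ofRealHom] Module.End ℂ (Mod R) where
  toFun x := Mod.lift fun g => Mod.single g ∘ₗ LinearMap.mulLeft ℂ (lin 0 x)
  map_add' x y := by
    refine Mod.hom_ext fun g f => ?_
    simp only [LinearMap.add_apply, Mod.lift_single, LinearMap.comp_apply,
      LinearMap.mulLeft_apply, map_add, add_mul]
  map_smul' r x := by
    refine Mod.hom_ext fun g f => ?_
    simp only [LinearMap.smul_apply, Mod.lift_single, LinearMap.comp_apply,
      LinearMap.mulLeft_apply, map_smulₛₗ, smul_mul_assoc, RingHom.id_apply]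

@[simp]
theorem leftZero_single (x : V N) (g : W R) (f : Pol N) :
    leftZero x (Mod.single g f) = Mod.single g (lin 0 x * f) := by
  simp only [leftZero, LinearMap.coe_mk, AddHom.coe_mk, Mod.lift_single, LinearMap.comp_apply,
    LinearMap.mulLeft_apply]

/-- Left multiplication by `x_1`, given by Dunkl operators. -/
noncomputable def leftOne (ν : R → ℂ) : V N →ₛₗ[Complex.ofRealHom] Module.End ℂ (Mod R) where
  toFun x := Mod.lift fun g =>
    Mod.single g ∘ₗ (LinearMap.mulLeft ℂ (lin 1 x) - pd 0 x) -
      -- Moving x_1 to the right past the letters a_0 creates R_v, which is then carried on to g. On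
      -- its way it reflects the remaining a_0 letters, as recorded by `dd 0 v`, and all the a_1
      -- letters, whence `act (pr 1 v)`.
      ∑ v : R, (ν v * (⟪x, (v : V N)⟫_ℝ : ℝ)) •
        (Mod.single (reflW v * g) ∘ₗ dd 0 (v : V N) ∘ₗ (act (pr 1 (v : V N))).toLinearMap)
  map_add' x y := by
    refine Mod.hom_ext fun g f => ?_
    simp only [LinearMap.add_apply, Mod.lift_single, LinearMap.comp_apply, map_add,
      LinearMap.mulLeft_apply, add_mul, LinearMap.sub_apply, LinearMap.sum_apply,
      LinearMap.smul_apply, inner_add_left, mul_add, Complex.ofReal_add, add_smul,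
      Finset.sum_add_distrib, map_sub]
    abel
  map_smul' r x := by
    refine Mod.hom_ext fun g f => ?_
    simp only [LinearMap.smul_apply, Mod.lift_single, LinearMap.comp_apply,
      LinearMap.mulLeft_apply, map_smulₛₗ, smul_mul_assoc, RingHom.id_apply, LinearMap.sub_apply,
      LinearMap.sum_apply, real_inner_smul_left, Complex.ofReal_mul, smul_sub, Finset.smul_sum,
      smul_smul, map_sub, Complex.ofRealHom_eq_coe, mul_left_comm]

theorem leftOne_single (ν : R → ℂ) (x : V N) (g : W R) (f : Pol N) :
    leftOne ν x (Mod.single g f) = Mod.single g (lin 1 x * f - pd 0 x f) -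
      ∑ v : R, (ν v * (⟪x, (v : V N)⟫_ℝ : ℝ)) •
        Mod.single (reflW v * g) (dd 0 (v : V N) (act (pr 1 (v : V N)) f)) := by
  simp only [leftOne, LinearMap.coe_mk, AddHom.coe_mk, Mod.lift_single, LinearMap.comp_apply,
    LinearMap.mulLeft_apply, LinearMap.sub_apply, LinearMap.sum_apply, LinearMap.smul_apply,
    AlgHom.toLinearMap_apply]

/-- Right multiplication by `z_1`. -/
noncomputable def rightOne : V N →ₛₗ[Complex.ofRealHom] Module.End ℂ (Mod R) where
  toFun z := Mod.lift fun g =>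
    Mod.single g ∘ₗ LinearMap.mulLeft ℂ (lin 1 ((g : V N ≃ₗᵢ[ℝ] V N) z))
  map_add' x y := by
    refine Mod.hom_ext fun g f => ?_
    simp only [LinearMap.add_apply, Mod.lift_single, LinearMap.comp_apply,
      LinearMap.mulLeft_apply, map_add, add_mul]
  map_smul' r x := by
    refine Mod.hom_ext fun g f => ?_
    simp only [LinearMap.smul_apply, Mod.lift_single, LinearMap.comp_apply, map_smul,
      LinearMap.mulLeft_apply, map_smulₛₗ, smul_mul_assoc]

@[simp]
theorem rightOne_single (z : V N) (g : W R) (f : Pol N) :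
    rightOne z (Mod.single g f) =
      Mod.single g (lin 1 ((g : V N ≃ₗᵢ[ℝ] V N) z) * f) := by
  simp only [rightOne, LinearMap.coe_mk, AddHom.coe_mk, Mod.lift_single, LinearMap.comp_apply,
    LinearMap.mulLeft_apply]

theorem leftGrp_mul (w₁ w₂ : W R) : leftGrp w₁ * leftGrp w₂ = leftGrp (w₁ * w₂) := by
  refine Mod.hom_ext fun g f => ?_
  simp only [Module.End.mul_apply, leftGrp_single, act_act, mul_assoc]
  rfl

theorem leftGrp_one : leftGrp (1 : W R) = 1 := by
  refine Mod.hom_ext fun g f => ?_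
  simp only [leftGrp_single, one_mul, Module.End.one_apply]
  congr 1
  exact act_one f

theorem leftGrp_zero (w : W R) (x : V N) :
    leftGrp w * leftZero x = leftZero ((w : V N ≃ₗᵢ[ℝ] V N) x) * leftGrp w := by
  refine Mod.hom_ext fun g f => ?_
  simp only [Module.End.mul_apply, leftGrp_single, leftZero_single, map_mul, act_lin]

theorem act_pr_comm (w : V N ≃ₗᵢ[ℝ] V N) (α : Fin 2) (v : V N) (f : Pol N) :
    act (fun _ => w) (act (pr α v) f) = act (pr α (w v)) (act (fun _ => w) f) := by
  rw [act_act, act_act]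
  congr 2
  ext1 β
  by_cases hβ : β = α
  · subst hβ
    simp [refl_conj]
  · simp [Pi.mulSingle_eq_of_ne hβ]

theorem leftGrp_leftOne (hR : IsRootSystem R) {ν : R → ℂ} (hν : IsInvariantParam ν) (w : W R)
    (x : V N) :
    leftGrp w * leftOne ν x = leftOne ν ((w : V N ≃ₗᵢ[ℝ] V N) x) * leftGrp w := by
  refine Mod.hom_ext fun g f => ?_
  simp only [Module.End.mul_apply, leftGrp_single, leftOne_single, map_sub, map_sum, map_smul,
    map_mul, act_lin, act_pd]
  congr 1
  conv_rhs => rw [← Equiv.sum_comp (hR.perm w)]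
  refine Finset.sum_congr rfl fun v _ => ?_
  rw [hν.perm hR, hR.coe_perm, LinearIsometryEquiv.inner_map_map, act_dd _ _ (hR.ne_zero v),
    act_pr_comm, ← mul_assoc, mul_reflW hR, mul_assoc]

/-- Reflecting the two kinds of letters separately composes to the diagonal action of R_v. The first
term is therefore a left multiplication by a group element, the one needed in the commutator of x_0
and y_1. -/
theorem dd_zero_act_one_lin {v : V N} (hv : v ≠ 0) (x : V N) (f : Pol N) :
    dd 0 v (act (pr 1 v) (lin 0 x * f)) =
      C ((⟪x, v⟫_ℝ / ⟪v, v⟫_ℝ : ℝ) : ℂ) * act (fun _ => refl v) f +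
        lin 0 x * dd 0 v (act (pr 1 v) f) := by
  rw [map_mul, act_pr_lin_of_ne (by decide), dd_mul _ hv, dd_lin_same _ hv, act_act]
  congr 4
  ext1 β
  fin_cases β <;> simp [Pi.mulSingle, Function.update]

/-- The commutator of `x_0` and `y_1`, in terms of the images of group elements. -/
noncomputable def commValue {A : Type*} [Ring A] [Algebra ℂ A] (ν : R → ℂ) (G : W R → A)
    (x y : V N) : A :=
  algebraMap ℂ A ((⟪x, y⟫_ℝ : ℝ) : ℂ) +
    ∑ v : R, (ν v * ((⟪x, (v : V N)⟫_ℝ * ⟪y, (v : V N)⟫_ℝ /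
      ⟪(v : V N), (v : V N)⟫_ℝ : ℝ) : ℂ)) • G (reflW v)

theorem commValue_comm {A : Type*} [Ring A] [Algebra ℂ A] (ν : R → ℂ) (G : W R → A)
    (x y : V N) : commValue ν G x y = commValue ν G y x := by
  simp only [commValue, real_inner_comm x y]
  congr 1
  refine Finset.sum_congr rfl fun v _ => ?_
  rw [mul_comm ⟪x, (v : V N)⟫_ℝ]

theorem leftZero_leftOne (hR : IsRootSystem R) (ν : R → ℂ) (x y : V N) :
    leftZero x * leftOne ν y = leftOne ν y * leftZero x + commValue ν leftGrp x y := by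
  refine Mod.hom_ext fun g f => ?_
  have hsum : ∑ v : R, (ν v * (⟪y, (v : V N)⟫_ℝ : ℝ)) • (Mod.single (reflW v * g)
        (dd 0 (v : V N) (act (pr 1 (v : V N)) (lin 0 x * f))) : Mod R) =
      ∑ v : R, (ν v * ((⟪x, (v : V N)⟫_ℝ * ⟪y, (v : V N)⟫_ℝ /
        ⟪(v : V N), (v : V N)⟫_ℝ : ℝ) : ℂ)) • Mod.single (reflW v * g) (actW (reflW v) f) +
      ∑ v : R, (ν v * (⟪y, (v : V N)⟫_ℝ : ℝ)) • Mod.single (reflW v * g)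
        (lin 0 x * dd 0 (v : V N) (act (pr 1 (v : V N)) f)) := by
    rw [← Finset.sum_add_distrib]
    refine Finset.sum_congr rfl fun v _ => ?_
    rw [dd_zero_act_one_lin (hR.ne_zero v), map_add, smul_add, ← smul_eq_C_mul,
      map_smul, smul_smul]
    congr 2
    rw [mul_assoc, ← Complex.ofReal_mul]
    congr 2
    ring
  simp only [Module.End.mul_apply, leftZero_single, leftOne_single, map_sub, map_sum, map_smul,
    LinearMap.add_apply, commValue, LinearMap.sum_apply, LinearMap.smul_apply, leftGrp_single,
    Module.algebraMap_end_apply, pd_mul, pd_lin, if_true, hsum]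
  rw [real_inner_comm, ← smul_eq_C_mul, map_add, map_smul, mul_left_comm]
  abel

theorem leftZero_comm (x y : V N) :
    (leftZero x * leftZero y : Module.End ℂ (Mod R)) = leftZero y * leftZero x := by
  refine Mod.hom_ext fun g f => ?_
  simp only [Module.End.mul_apply, leftZero_single, mul_left_comm]

theorem leftOne_rightOne (hR : IsRootSystem R) (ν : R → ℂ) (x z : V N) :
    leftOne ν x * rightOne z = rightOne z * leftOne ν x := by
  refine Mod.hom_ext fun g f => ?_
  have h1 (v : R) : dd 0 (v : V N) (act (pr 1 (v : V N))
      (lin 1 ((g : V N ≃ₗᵢ[ℝ] V N) z) * f)) =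
      lin 1 (((reflW v * g : W R) : V N ≃ₗᵢ[ℝ] V N) z) *
        dd 0 (v : V N) (act (pr 1 (v : V N)) f) := by
    rw [map_mul, act_lin, dd_mul _ (hR.ne_zero v),
      dd_eq_zero (hR.ne_zero v) (act_pr_lin_of_ne (by decide) _ _), zero_mul, zero_add,
      pr, Pi.mulSingle_eq_same]
    rfl
  have h2 : lin 1 x * (lin 1 ((g : V N ≃ₗᵢ[ℝ] V N) z) * f) -
      pd 0 x (lin 1 ((g : V N ≃ₗᵢ[ℝ] V N) z) * f) =
      lin 1 ((g : V N ≃ₗᵢ[ℝ] V N) z) * (lin 1 x * f - pd 0 x f) := by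
    rw [pd_mul, pd_lin, if_neg (by decide)]
    ring
  simp only [Module.End.mul_apply, rightOne_single, leftOne_single, map_sub, map_sum, map_smul,
    h1, h2, mul_sub]

/-- The Jacobi identity for z, a, b: the hypothesis `h` says that its two terms other than [z, [a,
b]] cancel. -/
theorem commutator_jacobi {A : Type*} [Ring A] {a b z p q : A} (ha : z * a = a * z + p)
    (hb : z * b = b * z + q) (h : a * q - q * a = b * p - p * b) :
    z * (a * b - b * a) = (a * b - b * a) * z := by
  have h1 : z * (a * b - b * a) = (z * a) * b - (z * b) * a := by noncomm_ring
  have h2 : a * (z * b) = a * (b * z + q) := by rw [hb]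
  have h3 : b * (z * a) = b * (a * z + p) := by rw [ha]
  rw [h1, ha, hb, add_mul, add_mul, mul_assoc, mul_assoc, h2, h3]
  calc a * (b * z + q) + p * b - (b * (a * z + p) + q * a) =
      (a * b - b * a) * z + ((a * q - q * a) - (b * p - p * b)) := by noncomm_ring
    _ = _ := by rw [h, sub_self, add_zero]

/-- What matters is that the right side is symmetric in x and y, since x - R_v x is proportional to
v. This is the input to the Jacobi argument for `leftOne_comm`. -/
theorem leftOne_commValue (hR : IsRootSystem R) {ν : R → ℂ} (hν : IsInvariantParam ν)
    (x y z : V N) :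
    leftOne ν x * commValue ν leftGrp z y - commValue ν leftGrp z y * leftOne ν x =
      ∑ v : R, (ν v * ((⟪z, (v : V N)⟫_ℝ * ⟪y, (v : V N)⟫_ℝ * ⟪x, (v : V N)⟫_ℝ * 2 /
      (⟪(v : V N), (v : V N)⟫_ℝ * ⟪(v : V N), (v : V N)⟫_ℝ) : ℝ) : ℂ)) •
        (leftOne ν (v : V N) * leftGrp (reflW v)) := by
  simp only [commValue, mul_add, add_mul, Finset.mul_sum, Finset.sum_mul]
  rw [Algebra.commutes, add_sub_add_left_eq_sub, ← Finset.sum_sub_distrib]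
  refine Finset.sum_congr rfl fun v _ => ?_
  rw [mul_smul_comm, smul_mul_assoc, leftGrp_leftOne hR hν, ← smul_sub, ← sub_mul, ← map_sub,
    coe_reflW, refl_apply, sub_sub_cancel, map_smulₛₗ, smul_mul_assoc, smul_smul]
  congr 1
  rw [mul_assoc, Complex.ofRealHom_eq_coe, ← Complex.ofReal_mul]
  congr 2
  ring

theorem leftOne_single_C (hR : IsRootSystem R) (ν : R → ℂ) (x : V N) (g : W R) (c : ℂ) :
    leftOne ν x (Mod.single g (C c)) = Mod.single g (lin 1 x * C c) := by
  rw [leftOne_single, Finset.sum_eq_zero, pd_C, sub_zero, sub_zero]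
  intro v _
  rw [act_C, dd_C _ (hR.ne_zero v), map_zero, smul_zero]

/-- Commutativity of Dunkl operators without expanding them: the commutator commutes with `leftZero`
by Jacobi and with `rightOne`, it kills constants times group elements, and these generate the
module under the two kinds of multiplication. -/
theorem leftOne_comm (hR : IsRootSystem R) {ν : R → ℂ} (hν : IsInvariantParam ν) (x y : V N) :
    leftOne ν x * leftOne ν y = leftOne ν y * leftOne ν x := by
  have h0 : ∀ z, (leftOne ν x * leftOne ν y - leftOne ν y * leftOne ν x) * leftZero z =
      leftZero z * (leftOne ν x * leftOne ν y - leftOne ν y * leftOne ν x) := by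
    intro z
    have h1 := leftZero_leftOne hR ν z x
    have h2 := leftZero_leftOne hR ν z y
    refine (commutator_jacobi h1 h2 ?_).symm
    rw [leftOne_commValue hR hν, leftOne_commValue hR hν]
    refine Finset.sum_congr rfl fun v _ => ?_
    congr 4
    ring
  have hr : ∀ z, (leftOne ν x * leftOne ν y - leftOne ν y * leftOne ν x) * rightOne z =
      rightOne z * (leftOne ν x * leftOne ν y - leftOne ν y * leftOne ν x) := by
    intro z
    have h1 : Commute (leftOne ν x) (rightOne z) := leftOne_rightOne hR ν x z
    have h2 : Commute (leftOne ν y) (rightOne z) := leftOne_rightOne hR ν y z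
    exact (h1.mul_left h2).sub_left (h2.mul_left h1)
  rw [← sub_eq_zero]
  refine Mod.hom_ext fun g f => ?_
  rw [LinearMap.zero_apply]
  induction f using MvPolynomial.induction_on with
  | C c =>
    have hc : ∀ x y : V N, leftOne ν x (leftOne ν y (Mod.single g (C c))) =
        Mod.single g (lin 1 x * (lin 1 y * C c)) := by
      intro x y
      rw [leftOne_single_C hR, leftOne_single, Finset.sum_eq_zero, pd_mul, pd_lin]
      · simp
      · intro v _
        rw [map_mul, act_lin, act_C, dd_mul _ (hR.ne_zero v), dd_C _ (hR.ne_zero v),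
          dd_eq_zero (hR.ne_zero v) (act_pr_lin_of_ne (by decide) _ _)]
        simp
    rw [LinearMap.sub_apply, Module.End.mul_apply, Module.End.mul_apply, hc, hc, mul_left_comm,
      sub_self]
  | add p q hp hq => rw [map_add, map_add, hp, hq, add_zero]
  | mul_X p i hp =>
    obtain ⟨β, i⟩ := i
    fin_cases β
    · have h1 : (Mod.single g (p * X (0, i)) : Mod R) =
          leftZero (e i) (Mod.single g p) := by
        rw [leftZero_single, lin_e, mul_comm]
      simp only [Fin.zero_eta]
      rw [h1, ← Module.End.mul_apply, h0, Module.End.mul_apply, hp, map_zero]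
    · have h1 : (Mod.single g (p * X (1, i)) : Mod R) =
          rightOne ((g : V N ≃ₗᵢ[ℝ] V N).symm (e i)) (Mod.single g p) := by
        rw [rightOne_single, LinearIsometryEquiv.apply_symm_apply, lin_e, mul_comm]
      simp only [Fin.mk_one]
      rw [h1, ← Module.End.mul_apply, hr, Module.End.mul_apply, hp, map_zero]

end Representation

end Calogero

namespace Calogero
open scoped InnerProductSpace
open MvPolynomial

/-! ### Normal ordering and the Poincaré–Birkhoff–Witt theorem. -/

section NormalOrdering

variable {N : ℕ} {R : Finset (V N)}

/-- The image of a group element in the algebra. -/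
noncomputable def grp (ν : R → ℂ) (w : W R) : H ν := gen ν (Gen.g w)

/-- The image of the vector `x_α` in the algebra. -/
noncomputable def vec (ν : R → ℂ) (α : Fin 2) : V N →ₛₗ[Complex.ofRealHom] H ν :=
  comb fun i => gen ν (Gen.a α i)

theorem vec_e (ν : R → ℂ) (α : Fin 2) (i : Fin N) : vec ν α (e i) = gen ν (Gen.a α i) :=
  comb_e _ _

theorem mk_grp (ν : R → ℂ) (w : W R) :
    RingQuot.mkAlgHom ℂ (Rel ν) (Free.grp w) = grp ν w := rfl

theorem mk_vec (ν : R → ℂ) (α : Fin 2) (x : V N) :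
    RingQuot.mkAlgHom ℂ (Rel ν) (Free.vec α x) = vec ν α x := by
  rw [Free.vec, vec, comb_apply, map_sum]
  exact Finset.sum_congr rfl fun i _ => map_smul _ _ _

theorem grp_one (ν : R → ℂ) : grp ν 1 = 1 := by
  rw [← mk_grp, RingQuot.mkAlgHom_rel ℂ Rel.grp_one, map_one]

theorem grp_mul (ν : R → ℂ) (w₁ w₂ : W R) : grp ν w₁ * grp ν w₂ = grp ν (w₁ * w₂) := by
  simp only [← mk_grp]
  rw [← map_mul, RingQuot.mkAlgHom_rel ℂ (Rel.grp_mul w₁ w₂)]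

theorem grp_vec (ν : R → ℂ) (w : W R) (α : Fin 2) (x : V N) :
    grp ν w * vec ν α x = vec ν α ((w : V N ≃ₗᵢ[ℝ] V N) x) * grp ν w := by
  simp only [← mk_grp, ← mk_vec]
  rw [← map_mul, RingQuot.mkAlgHom_rel ℂ (Rel.grp_vec w α x), map_mul]

theorem vec_comm (ν : R → ℂ) (α β : Fin 2) (x y : V N) :
    vec ν α x * vec ν β y - vec ν β y * vec ν α x =
      eps α β • commValue ν (grp ν) x y := by
  simp only [← mk_vec]
  rw [← map_mul, ← map_mul, ← map_sub, RingQuot.mkAlgHom_rel ℂ (Rel.comm α β x y), map_smul,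
    map_add, map_sum, AlgHom.commutes]
  simp only [map_smul, mk_grp]
  rfl

theorem vec_comm_self (ν : R → ℂ) (α : Fin 2) (x y : V N) :
    vec ν α x * vec ν α y = vec ν α y * vec ν α x := by
  rw [← sub_eq_zero, vec_comm]
  fin_cases α <;> simp [eps]

theorem vec_zero_one (ν : R → ℂ) (x y : V N) :
    vec ν 0 x * vec ν 1 y = vec ν 1 y * vec ν 0 x + commValue ν (grp ν) x y := by
  rw [← sub_eq_iff_eq_add', vec_comm]
  simp [eps]

@[elab_as_elim]
theorem H.induction {ν : R → ℂ} {P : H ν → Prop} (algebraMap : ∀ c, P (algebraMap ℂ (H ν) c))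
    (grp : ∀ w, P (grp ν w)) (vec : ∀ α x, P (vec ν α x))
    (mul : ∀ a b, P a → P b → P (a * b)) (add : ∀ a b, P a → P b → P (a + b)) (h : H ν) :
    P h := by
  obtain ⟨f, rfl⟩ := RingQuot.mkAlgHom_surjective ℂ (Rel ν) h
  induction f using FreeAlgebra.induction with
  | grade0 c => rw [AlgHom.commutes]; exact algebraMap c
  | grade1 x =>
    cases x with
    | a α i =>
      have := vec α (e i)
      rwa [vec_e] at this
    | g w => exact grp w
  | mul a b ha hb => rw [map_mul]; exact mul _ _ ha hb
  | add a b ha hb => rw [map_add]; exact add _ _ ha hb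

/-- The value of the regular representation on generators. -/
noncomputable def repGen (ν : R → ℂ) : Gen R → Module.End ℂ (Mod R)
  | Gen.a α i => ![leftZero (e i), leftOne ν (e i)] α
  | Gen.g w => leftGrp w

theorem lift_repGen_vec (ν : R → ℂ) (α : Fin 2) (x : V N) :
    FreeAlgebra.lift ℂ (repGen ν) (Free.vec α x) = ![leftZero x, leftOne ν x] α := by
  rw [Free.vec, map_sum]
  simp only [map_smul, FreeAlgebra.lift_ι_apply, repGen]
  fin_cases α
  · exact (semilinear_apply leftZero x).symm
  · exact (semilinear_apply (leftOne ν) x).symm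

/-- The left regular representation. -/
noncomputable def rep (hR : IsRootSystem R) {ν : R → ℂ} (hν : IsInvariantParam ν) :
    H ν →ₐ[ℂ] Module.End ℂ (Mod R) :=
  RingQuot.liftAlgHom ℂ ⟨FreeAlgebra.lift ℂ (repGen ν), by
    intro a b hab
    cases hab with
    | grp_one => simpa [Free.grp, repGen] using leftGrp_one
    | grp_mul w₁ w₂ => simpa [Free.grp, repGen] using leftGrp_mul w₁ w₂
    | grp_vec w α x =>
      rw [map_mul, map_mul, lift_repGen_vec, lift_repGen_vec, Free.grp, FreeAlgebra.lift_ι_apply]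
      fin_cases α
      · exact leftGrp_zero w x
      · exact leftGrp_leftOne hR hν w x
    | comm α β x y =>
      have hc : FreeAlgebra.lift ℂ (repGen ν) (algebraMap ℂ (Free R) ((⟪x, y⟫_ℝ : ℝ) : ℂ) +
          ∑ v : R, (ν v * ((⟪x, (v : V N)⟫_ℝ * ⟪y, (v : V N)⟫_ℝ /
            ⟪(v : V N), (v : V N)⟫_ℝ : ℝ) : ℂ)) • Free.grp (reflW v)) =
          commValue ν leftGrp x y := by
        rw [map_add, AlgHom.commutes, map_sum]
        simp only [map_smul, Free.grp, FreeAlgebra.lift_ι_apply]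
        rfl
      rw [map_sub, map_mul, map_mul, lift_repGen_vec, lift_repGen_vec, map_smul, hc]
      fin_cases α <;> fin_cases β
      · simpa [eps] using sub_eq_zero.2 (leftZero_comm x y)
      · simpa [eps, sub_eq_iff_eq_add'] using leftZero_leftOne hR ν x y
      · have := leftZero_leftOne hR ν y x
        simp [eps, this, commValue_comm ν leftGrp x y]
      · simpa [eps] using sub_eq_zero.2 (leftOne_comm hR hν x y)⟩

theorem rep_vec_zero (hR : IsRootSystem R) {ν : R → ℂ} (hν : IsInvariantParam ν) (x : V N) :
    rep hR hν (vec ν 0 x) = leftZero x := by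
  rw [← mk_vec, rep, RingQuot.liftAlgHom_mkAlgHom_apply, lift_repGen_vec]
  rfl

theorem rep_vec_one (hR : IsRootSystem R) {ν : R → ℂ} (hν : IsInvariantParam ν) (x : V N) :
    rep hR hν (vec ν 1 x) = leftOne ν x := by
  rw [← mk_vec, rep, RingQuot.liftAlgHom_mkAlgHom_apply, lift_repGen_vec]
  rfl

theorem rep_grp (hR : IsRootSystem R) {ν : R → ℂ} (hν : IsInvariantParam ν) (w : W R) :
    rep hR hν (grp ν w) = leftGrp w := by
  rw [← mk_grp, rep, RingQuot.liftAlgHom_mkAlgHom_apply, Free.grp, FreeAlgebra.lift_ι_apply]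
  rfl

/-- The algebra homomorphism from polynomials determined by a commuting family. -/
theorem exists_polyHom {ι A : Type*} [Ring A] [Algebra ℂ A] (a : ι → A)
    (ha : ∀ i j, a i * a j = a j * a i) :
    ∃ φ : MvPolynomial ι ℂ →ₐ[ℂ] A, ∀ i, φ (X i) = a i := by
  -- Evaluation of polynomials needs a commutative target, so it is carried out in the subalgebra
  -- generated by the family.
  have hc := Algebra.isMulCommutative_adjoin ℂ (s := Set.range a) (by
    rintro _ ⟨i, rfl⟩ _ ⟨j, rfl⟩
    exact ha i j)
  let _ : CommRing (Algebra.adjoin ℂ (Set.range a)) :=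
    { (Algebra.adjoin ℂ (Set.range a)).toRing with mul_comm := hc.is_comm.comm }
  refine ⟨(Algebra.adjoin ℂ (Set.range a)).val.comp
    (aeval fun i => ⟨a i, Algebra.subset_adjoin ⟨i, rfl⟩⟩), fun i => ?_⟩
  simp

/-- The homomorphism from polynomials onto the subalgebra generated by the `a_{α i}`. -/
noncomputable def polyHom (ν : R → ℂ) (α : Fin 2) : MvPolynomial (Fin N) ℂ →ₐ[ℂ] H ν :=
  (exists_polyHom (fun i => vec ν α (e i)) fun _ _ => vec_comm_self ν α _ _).choose

theorem polyHom_X (ν : R → ℂ) (α : Fin 2) (i : Fin N) : polyHom ν α (X i) = vec ν α (e i) :=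
  (exists_polyHom (fun i => vec ν α (e i)) fun _ _ => vec_comm_self ν α _ _).choose_spec i

/-- The part of a monomial in the letters `a_{α i}`. -/
noncomputable def monoPart (α : Fin 2) (m : Fin 2 × Fin N →₀ ℕ) : MvPolynomial (Fin N) ℂ :=
  ∏ i, X i ^ m (α, i)

theorem monoPart_add (α : Fin 2) (m m' : Fin 2 × Fin N →₀ ℕ) :
    monoPart α (m + m') = monoPart α m * monoPart α m' := by
  simp [monoPart, pow_add, Finset.prod_mul_distrib]

theorem monoPart_single_same (α : Fin 2) (i : Fin N) :
    monoPart α (Finsupp.single (α, i) 1) = X i := by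
  rw [monoPart, Finset.prod_eq_single i]
  · simp
  · intro j _ hj
    rw [Finsupp.single_eq_of_ne, pow_zero]
    exact fun h => hj (congrArg Prod.snd h)
  · simp

theorem monoPart_single_of_ne {α β : Fin 2} (h : α ≠ β) (i : Fin N) :
    monoPart α (Finsupp.single (β, i) 1) = 1 := by
  rw [monoPart, Finset.prod_eq_one]
  intro j _
  rw [Finsupp.single_eq_of_ne, pow_zero]
  exact fun h1 => h (congrArg Prod.fst h1)

/-- The normally ordered element of the algebra attached to a polynomial. -/
noncomputable def normal (ν : R → ℂ) : Pol N →ₗ[ℂ] H ν :=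
  (basisMonomials (Fin 2 × Fin N) ℂ).constr ℂ fun m =>
    polyHom ν 0 (monoPart 0 m) * polyHom ν 1 (monoPart 1 m)

theorem normal_monomial (ν : R → ℂ) (m : Fin 2 × Fin N →₀ ℕ) :
    normal ν (monomial m 1) = polyHom ν 0 (monoPart 0 m) * polyHom ν 1 (monoPart 1 m) := by
  have := (basisMonomials (Fin 2 × Fin N) ℂ).constr_basis ℂ (fun m =>
    polyHom ν 0 (monoPart 0 m) * polyHom ν 1 (monoPart 1 m)) m
  rwa [coe_basisMonomials] at this

theorem normal_one (ν : R → ℂ) : normal ν 1 = 1 := by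
  have := normal_monomial ν (0 : Fin 2 × Fin N →₀ ℕ)
  simpa [monoPart] using this

theorem normal_C (ν : R → ℂ) (c : ℂ) : normal ν (C c) = algebraMap ℂ (H ν) c := by
  rw [← mul_one (C c), ← smul_eq_C_mul, map_smul, normal_one, Algebra.algebraMap_eq_smul_one]

theorem normal_X_mul (ν : R → ℂ) (i : Fin N) (f : Pol N) :
    normal ν (X (0, i) * f) = vec ν 0 (e i) * normal ν f := by
  have : normal ν ∘ₗ LinearMap.mulLeft ℂ (X (0, i)) =
      LinearMap.mulLeft ℂ (vec ν 0 (e i)) ∘ₗ normal ν := by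
    refine (basisMonomials (Fin 2 × Fin N) ℂ).ext fun m => ?_
    have h : (X (0, i) : Pol N) * monomial m 1 =
        monomial (Finsupp.single (0, i) 1 + m) 1 := by
      rw [X, monomial_mul, one_mul]
    simp only [coe_basisMonomials, LinearMap.comp_apply, LinearMap.mulLeft_apply, h,
      normal_monomial, monoPart_add, monoPart_single_same, monoPart_single_of_ne one_ne_zero,
      map_mul, polyHom_X, one_mul, mul_assoc]
  exact LinearMap.congr_fun this f

theorem normal_mul_X (ν : R → ℂ) (i : Fin N) (f : Pol N) :
    normal ν (f * X (1, i)) = normal ν f * vec ν 1 (e i) := by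
  have : normal ν ∘ₗ LinearMap.mulRight ℂ (X (1, i)) =
      LinearMap.mulRight ℂ (vec ν 1 (e i)) ∘ₗ normal ν := by
    refine (basisMonomials (Fin 2 × Fin N) ℂ).ext fun m => ?_
    have h : (monomial m 1 : Pol N) * X (1, i) =
        monomial (m + Finsupp.single (1, i) 1) 1 := by
      rw [X, monomial_mul, one_mul]
    simp only [coe_basisMonomials, LinearMap.comp_apply, LinearMap.mulRight_apply, h,
      normal_monomial, monoPart_add, monoPart_single_same, monoPart_single_of_ne zero_ne_one,
      map_mul, polyHom_X, mul_one, mul_assoc]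
  exact LinearMap.congr_fun this f

theorem normal_lin_mul (ν : R → ℂ) (x : V N) (f : Pol N) :
    normal ν (lin 0 x * f) = vec ν 0 x * normal ν f := by
  rw [semilinear_apply (lin 0), semilinear_apply (vec ν 0), Finset.sum_mul, Finset.sum_mul,
    map_sum]
  refine Finset.sum_congr rfl fun i _ => ?_
  rw [smul_mul_assoc, smul_mul_assoc, map_smul, lin_e, normal_X_mul]

theorem normal_mul_lin (ν : R → ℂ) (x : V N) (f : Pol N) :
    normal ν (f * lin 1 x) = normal ν f * vec ν 1 x := by
  rw [semilinear_apply (lin 1), semilinear_apply (vec ν 1), Finset.mul_sum, Finset.mul_sum,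
    map_sum]
  refine Finset.sum_congr rfl fun i _ => ?_
  rw [mul_smul_comm, mul_smul_comm, map_smul, lin_e, normal_mul_X]

/-- Induction on polynomials adapted to the normal ordering. -/
theorem Pol.induction {P : Pol N → Prop} (C : ∀ c, P (C c)) (add : ∀ p q, P p → P q → P (p + q))
    (lin_mul : ∀ x p, P p → P (lin 0 x * p)) (mul_lin : ∀ x p, P p → P (p * lin 1 x))
    (f : Pol N) : P f := by
  induction f using MvPolynomial.induction_on with
  | C c => exact C c
  | add p q hp hq => exact add p q hp hq
  | mul_X p i hp =>
    obtain ⟨β, i⟩ := i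
    rw [← lin_e]
    fin_cases β
    · rw [mul_comm]
      exact lin_mul _ _ hp
    · exact mul_lin _ _ hp

theorem grp_normal (ν : R → ℂ) (w : W R) (f : Pol N) :
    grp ν w * normal ν f = normal ν (actW w f) * grp ν w := by
  induction f using Pol.induction with
  | C c => rw [act_C, normal_C, Algebra.commutes]
  | add p q hp hq => simp only [map_add, mul_add, add_mul, hp, hq]
  | lin_mul x p hp =>
    rw [normal_lin_mul, ← mul_assoc, grp_vec, mul_assoc, hp, map_mul, act_lin, normal_lin_mul,
      mul_assoc]
  | mul_lin x p hp =>
    rw [normal_mul_lin, ← mul_assoc, hp, mul_assoc, grp_vec, map_mul, act_lin, normal_mul_lin,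
      mul_assoc]

/-- The linear map from polynomials times group elements to the algebra. -/
noncomputable def toH (ν : R → ℂ) : Mod R →ₗ[ℂ] H ν :=
  Mod.lift fun g => LinearMap.mulRight ℂ (grp ν g) ∘ₗ normal ν

theorem toH_single (ν : R → ℂ) (g : W R) (f : Pol N) :
    toH ν (Mod.single g f) = normal ν f * grp ν g := by
  rw [toH, Mod.lift_single]
  rfl

theorem toH_leftGrp (ν : R → ℂ) (w : W R) (m : Mod R) :
    toH ν (leftGrp w m) = grp ν w * toH ν m := by
  have : toH ν ∘ₗ leftGrp w = LinearMap.mulLeft ℂ (grp ν w) ∘ₗ toH ν := by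
    refine Mod.hom_ext fun g f => ?_
    simp only [LinearMap.comp_apply, leftGrp_single, toH_single, LinearMap.mulLeft_apply]
    rw [← mul_assoc, grp_normal, mul_assoc, grp_mul]
  exact LinearMap.congr_fun this m

theorem toH_leftZero (ν : R → ℂ) (x : V N) (m : Mod R) :
    toH ν (leftZero x m) = vec ν 0 x * toH ν m := by
  have : toH ν ∘ₗ leftZero x = LinearMap.mulLeft ℂ (vec ν 0 x) ∘ₗ toH ν := by
    refine Mod.hom_ext fun g f => ?_
    simp only [LinearMap.comp_apply, leftZero_single, toH_single, LinearMap.mulLeft_apply,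
      normal_lin_mul, mul_assoc]
  exact LinearMap.congr_fun this m

theorem toH_rightOne (ν : R → ℂ) (x : V N) (m : Mod R) :
    toH ν (rightOne x m) = toH ν m * vec ν 1 x := by
  have : toH ν ∘ₗ rightOne x = LinearMap.mulRight ℂ (vec ν 1 x) ∘ₗ toH ν := by
    refine Mod.hom_ext fun g f => ?_
    simp only [LinearMap.comp_apply, rightOne_single, toH_single, LinearMap.mulRight_apply]
    rw [mul_comm, normal_mul_lin, mul_assoc, mul_assoc, grp_vec]
  exact LinearMap.congr_fun this m

theorem toH_commValue (ν : R → ℂ) (x y : V N) (m : Mod R) :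
    toH ν (commValue ν leftGrp x y m) = commValue ν (grp ν) x y * toH ν m := by
  simp only [commValue, LinearMap.add_apply, map_add, Module.algebraMap_end_apply, map_smul,
    add_mul, Finset.sum_mul, LinearMap.sum_apply, map_sum, LinearMap.smul_apply, toH_leftGrp,
    smul_mul_assoc]
  rw [Algebra.smul_def]

/-- The Dunkl formula is not expanded here. A factor z_0 on the left is removed with the commutation
relation, which holds both for the operators and in the algebra, and a factor z_1 on the right
because right multiplication commutes with everything on the left. -/
theorem toH_leftOne (hR : IsRootSystem R) (ν : R → ℂ) (x : V N) (m : Mod R) :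
    toH ν (leftOne ν x m) = vec ν 1 x * toH ν m := by
  have : toH ν ∘ₗ leftOne ν x = LinearMap.mulLeft ℂ (vec ν 1 x) ∘ₗ toH ν := by
    refine Mod.hom_ext fun g f => ?_
    simp only [LinearMap.comp_apply, LinearMap.mulLeft_apply]
    induction f using Pol.induction with
    | C c =>
      rw [leftOne_single_C hR, toH_single, toH_single, mul_comm, normal_mul_lin, normal_C,
        Algebra.commutes, mul_assoc]
    | add p q hp hq => simp only [map_add, mul_add, hp, hq]
    | lin_mul z p hp =>
      have h1 := LinearMap.congr_fun (leftZero_leftOne hR ν z x) (Mod.single g p)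
      simp only [Module.End.mul_apply, LinearMap.add_apply] at h1
      rw [← leftZero_single, ← sub_eq_iff_eq_add.2 h1, map_sub, toH_leftZero, hp, toH_commValue,
        toH_leftZero, ← mul_assoc, ← mul_assoc, vec_zero_one, add_mul, add_sub_cancel_right]
    | mul_lin z p hp =>
      have h1 : Mod.single g (p * lin 1 z) =
          rightOne ((g : V N ≃ₗᵢ[ℝ] V N).symm z) (Mod.single g p) := by
        rw [rightOne_single, LinearIsometryEquiv.apply_symm_apply, mul_comm]
      rw [h1, ← Module.End.mul_apply, leftOne_rightOne hR, Module.End.mul_apply, toH_rightOne, hp,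
        toH_rightOne, mul_assoc]
  exact LinearMap.congr_fun this m

theorem toH_rep (hR : IsRootSystem R) {ν : R → ℂ} (hν : IsInvariantParam ν) (h : H ν)
    (m : Mod R) : toH ν (rep hR hν h m) = h * toH ν m := by
  induction h using H.induction generalizing m with
  | algebraMap c =>
    rw [AlgHom.commutes, Module.algebraMap_end_apply, map_smul, Algebra.smul_def]
  | grp w => rw [rep_grp, toH_leftGrp]
  | vec α x =>
    fin_cases α
    · simp only [Fin.zero_eta]
      rw [rep_vec_zero, toH_leftZero]
    · simp only [Fin.mk_one]
      rw [rep_vec_one, toH_leftOne hR]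
  | mul a b ha hb => rw [map_mul, Module.End.mul_apply, ha, hb, mul_assoc]
  | add a b ha hb => rw [map_add, LinearMap.add_apply, map_add, ha, hb, add_mul]

theorem leftGrp_rightOne (w : W R) (z : V N) :
    leftGrp w * rightOne z = rightOne z * leftGrp w := by
  refine Mod.hom_ext fun g f => ?_
  simp only [Module.End.mul_apply, leftGrp_single, rightOne_single, map_mul, act_lin]
  rfl

theorem leftZero_rightOne (x z : V N) :
    (leftZero x * rightOne z : Module.End ℂ (Mod R)) = rightOne z * leftZero x := by
  refine Mod.hom_ext fun g f => ?_
  simp only [Module.End.mul_apply, leftZero_single, rightOne_single, mul_left_comm]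

theorem rep_rightOne (hR : IsRootSystem R) {ν : R → ℂ} (hν : IsInvariantParam ν) (h : H ν)
    (z : V N) : rep hR hν h * rightOne z = rightOne z * rep hR hν h := by
  induction h using H.induction with
  | algebraMap c => rw [AlgHom.commutes, Algebra.commutes]
  | grp w => rw [rep_grp, leftGrp_rightOne]
  | vec α x =>
    fin_cases α
    · simp only [Fin.zero_eta]
      rw [rep_vec_zero, leftZero_rightOne]
    · simp only [Fin.mk_one]
      rw [rep_vec_one, leftOne_rightOne hR]
  | mul a b ha hb => rw [map_mul, mul_assoc, hb, ← mul_assoc, ha, mul_assoc]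
  | add a b ha hb => rw [map_add, add_mul, ha, hb, mul_add]

/-- This gives linear independence of normally ordered words: the module recovers f from the action
of its normal ordering. -/
theorem rep_normal (hR : IsRootSystem R) {ν : R → ℂ} (hν : IsInvariantParam ν) (f : Pol N)
    (g : W R) : rep hR hν (normal ν f) (Mod.single g 1) = Mod.single g f := by
  induction f using Pol.induction with
  | C c =>
    rw [normal_C, AlgHom.commutes, Module.algebraMap_end_apply, ← map_smul, smul_eq_C_mul, mul_one]
  | add p q hp hq => simp only [map_add, LinearMap.add_apply, hp, hq]
  | lin_mul x p hp =>
    rw [normal_lin_mul, map_mul, Module.End.mul_apply, hp, rep_vec_zero, leftZero_single]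
  | mul_lin x p hp =>
    have h1 : leftOne ν x (Mod.single g 1) =
        rightOne ((g : V N ≃ₗᵢ[ℝ] V N).symm x) (Mod.single g 1) := by
      have := leftOne_single_C hR ν x g 1
      rw [map_one] at this
      rw [this, rightOne_single, LinearIsometryEquiv.apply_symm_apply]
    rw [normal_mul_lin, map_mul, Module.End.mul_apply, rep_vec_one, h1, ← Module.End.mul_apply,
      rep_rightOne, Module.End.mul_apply, hp, rightOne_single,
      LinearIsometryEquiv.apply_symm_apply, mul_comm]

theorem toH_one (ν : R → ℂ) : toH ν (Mod.single 1 1) = 1 := by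
  rw [toH_single, normal_one, grp_one, one_mul]

/-- The Poincaré–Birkhoff–Witt theorem for the algebra. -/
noncomputable def pbw (hR : IsRootSystem R) {ν : R → ℂ} (hν : IsInvariantParam ν) :
    Mod R ≃ₗ[ℂ] H ν :=
  LinearEquiv.ofLinearMap (toH ν)
    -- The inverse map lets an element of the algebra act on the vector corresponding to 1.
    (LinearMap.applyₗ (Mod.single (1 : W R) (1 : Pol N)) ∘ₗ (rep hR hν).toLinearMap)
    (by
      ext1 h
      simp only [LinearMap.comp_apply, AlgHom.toLinearMap_apply, LinearMap.applyₗ_apply_apply,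
        toH_rep, toH_one, mul_one, LinearMap.id_apply])
    (by
      refine Mod.hom_ext fun g f => ?_
      simp only [LinearMap.comp_apply, AlgHom.toLinearMap_apply, LinearMap.applyₗ_apply_apply,
        LinearMap.id_apply, toH_single, map_mul, Module.End.mul_apply, rep_grp, leftGrp_single,
        mul_one, map_one, rep_normal])

@[simp]
theorem pbw_apply (hR : IsRootSystem R) {ν : R → ℂ} (hν : IsInvariantParam ν) (m : Mod R) :
    pbw hR hν m = toH ν m := rfl

/-- Right multiplication by `z_0`. -/
noncomputable def rightZero (ν : R → ℂ) : V N →ₛₗ[Complex.ofRealHom] Module.End ℂ (Mod R) where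
  toFun z := Mod.lift fun g =>
    Mod.single g ∘ₗ (LinearMap.mulLeft ℂ (lin 0 ((g : V N ≃ₗᵢ[ℝ] V N) z)) -
        pd 1 ((g : V N ≃ₗᵢ[ℝ] V N) z)) -
      ∑ v : R, (ν v * (⟪(g : V N ≃ₗᵢ[ℝ] V N) z, (v : V N)⟫_ℝ : ℝ)) •
        (Mod.single (reflW v * g) ∘ₗ dd 1 (v : V N))
  map_add' x y := by
    refine Mod.hom_ext fun g f => ?_
    simp only [LinearMap.add_apply, Mod.lift_single, LinearMap.comp_apply, map_add,
      LinearMap.mulLeft_apply, add_mul, LinearMap.sub_apply, LinearMap.sum_apply,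
      LinearMap.smul_apply, inner_add_left, mul_add, Complex.ofReal_add, add_smul,
      Finset.sum_add_distrib, map_sub]
    abel
  map_smul' r x := by
    refine Mod.hom_ext fun g f => ?_
    simp only [LinearMap.smul_apply, Mod.lift_single, LinearMap.comp_apply, map_smul,
      LinearMap.mulLeft_apply, map_smulₛₗ, smul_mul_assoc, LinearMap.sub_apply,
      LinearMap.sum_apply, real_inner_smul_left, Complex.ofReal_mul, smul_sub, Finset.smul_sum,
      smul_smul, map_sub, Complex.ofRealHom_eq_coe, mul_left_comm]

theorem rightZero_single (ν : R → ℂ) (z : V N) (g : W R) (f : Pol N) :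
    rightZero ν z (Mod.single g f) =
      Mod.single g (lin 0 ((g : V N ≃ₗᵢ[ℝ] V N) z) * f - pd 1 ((g : V N ≃ₗᵢ[ℝ] V N) z) f) -
      ∑ v : R, (ν v * (⟪(g : V N ≃ₗᵢ[ℝ] V N) z, (v : V N)⟫_ℝ : ℝ)) •
        Mod.single (reflW v * g) (dd 1 (v : V N) f) := by
  simp only [rightZero, LinearMap.coe_mk, AddHom.coe_mk, Mod.lift_single, LinearMap.comp_apply,
    LinearMap.mulLeft_apply, LinearMap.sub_apply, LinearMap.sum_apply, LinearMap.smul_apply]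

/-- On its way to the left z_0 passes only a_1 letters, and the R_v created moves back to the right
through a_1 letters alone. Hence the a_0 letters are not reflected, in contrast with `leftOne`. -/
theorem normal_mul_vec_zero (hR : IsRootSystem R) (ν : R → ℂ) (z : V N) (f : Pol N) :
    normal ν f * vec ν 0 z = normal ν (lin 0 z * f - pd 1 z f) -
      ∑ v : R, (ν v * (⟪z, (v : V N)⟫_ℝ : ℝ)) •
        (normal ν (dd 1 (v : V N) f) * grp ν (reflW v)) := by
  induction f using Pol.induction with
  | C c =>
    rw [Finset.sum_eq_zero, pd_C, sub_zero, sub_zero, normal_lin_mul, normal_C, Algebra.commutes]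
    intro v _
    rw [dd_C _ (hR.ne_zero v), map_zero, zero_mul, smul_zero]
  | add p q hp hq =>
    simp only [map_add, add_mul, hp, hq, mul_add, smul_add, Finset.sum_add_distrib, map_sub]
    abel
  | lin_mul x p hp =>
    have h1 (v : R) : dd 1 (v : V N) (lin 0 x * p) = lin 0 x * dd 1 (v : V N) p := by
      rw [dd_mul _ (hR.ne_zero v), dd_eq_zero (hR.ne_zero v) (act_pr_lin_of_ne (by decide) _ _),
        zero_mul, zero_add]
    have h2 : lin 0 z * (lin 0 x * p) - pd 1 z (lin 0 x * p) =
        lin 0 x * (lin 0 z * p - pd 1 z p) := by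
      rw [pd_mul, pd_lin, if_neg (by decide)]
      ring
    simp only [h1, h2]
    rw [normal_lin_mul, mul_assoc, hp, mul_sub, ← normal_lin_mul, Finset.mul_sum]
    congr 1
    refine Finset.sum_congr rfl fun v _ => ?_
    rw [mul_smul_comm, ← mul_assoc, normal_lin_mul]
  | mul_lin y p hp =>
    have h1 (v : R) : dd 1 (v : V N) (p * lin 1 y) =
        dd 1 (v : V N) p * lin 1 (refl (v : V N) y) +
          ((⟪y, (v : V N)⟫_ℝ / ⟪(v : V N), (v : V N)⟫_ℝ : ℝ) : ℂ) • p := by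
      rw [dd_mul _ (hR.ne_zero v), dd_lin_same _ (hR.ne_zero v), act_lin, pr, Pi.mulSingle_eq_same,
        smul_eq_C_mul, mul_comm p]
    have h2 : lin 0 z * (p * lin 1 y) - pd 1 z (p * lin 1 y) =
        (lin 0 z * p - pd 1 z p) * lin 1 y - ((⟪z, y⟫_ℝ : ℝ) : ℂ) • p := by
      rw [pd_mul, pd_lin, if_pos rfl, smul_eq_C_mul]
      ring
    have h3 : vec ν 1 y * vec ν 0 z = vec ν 0 z * vec ν 1 y - commValue ν (grp ν) z y := by
      rw [vec_zero_one, add_sub_cancel_right]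
    have h4 (v : R) : normal ν (dd 1 (v : V N) p) * grp ν (reflW v) * vec ν 1 y =
        normal ν (dd 1 (v : V N) p * lin 1 (refl (v : V N) y)) * grp ν (reflW v) := by
      rw [mul_assoc, grp_vec, ← mul_assoc, normal_mul_lin, coe_reflW]
    generalize lin 0 z * p - pd 1 z p = A at hp h2
    rw [normal_mul_lin, mul_assoc, h3, mul_sub, ← mul_assoc, hp, sub_mul, Finset.sum_mul, h2,
      map_sub, map_smul, normal_mul_lin, commValue, mul_add, Finset.mul_sum]
    simp only [h1, smul_mul_assoc, h4, map_add, map_smul, add_mul, smul_add,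
      Finset.sum_add_distrib, mul_smul_comm, smul_smul]
    have h5 : ∀ v : R, ν v * ((⟪z, (v : V N)⟫_ℝ : ℝ) : ℂ) *
        ((⟪y, (v : V N)⟫_ℝ / ⟪(v : V N), (v : V N)⟫_ℝ : ℝ) : ℂ) =
        ν v * ((⟪z, (v : V N)⟫_ℝ * ⟪y, (v : V N)⟫_ℝ / ⟪(v : V N), (v : V N)⟫_ℝ : ℝ) : ℂ) := by
      intro v
      rw [mul_assoc, ← Complex.ofReal_mul, mul_div_assoc]
    simp only [h5]
    rw [← Algebra.commutes, ← Algebra.smul_def]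
    abel

theorem toH_rightZero (hR : IsRootSystem R) (ν : R → ℂ) (z : V N) (m : Mod R) :
    toH ν (rightZero ν z m) = toH ν m * vec ν 0 z := by
  have : toH ν ∘ₗ rightZero ν z = LinearMap.mulRight ℂ (vec ν 0 z) ∘ₗ toH ν := by
    refine Mod.hom_ext fun g f => ?_
    simp only [LinearMap.comp_apply, rightZero_single, toH_single, LinearMap.mulRight_apply,
      map_sub (toH ν), map_sum, map_smul]
    rw [mul_assoc, grp_vec, ← mul_assoc, normal_mul_vec_zero hR, sub_mul, Finset.sum_mul]
    congr 1
    refine Finset.sum_congr rfl fun v _ => ?_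
    rw [smul_mul_assoc, mul_assoc, grp_mul]
  exact LinearMap.congr_fun this m

/-- Conjugation by a group element. -/
noncomputable def conjGrp (w : W R) : Module.End ℂ (Mod R) :=
  Mod.lift fun g => Mod.single (w * g * w⁻¹) ∘ₗ (actW w).toLinearMap

@[simp]
theorem conjGrp_single (w g : W R) (f : Pol N) :
    conjGrp w (Mod.single g f) = Mod.single (w * g * w⁻¹) (actW w f) := by
  rw [conjGrp, Mod.lift_single]
  rfl

theorem toH_conjGrp (ν : R → ℂ) (w : W R) (m : Mod R) :
    toH ν (conjGrp w m) = grp ν w * toH ν m * grp ν w⁻¹ := by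
  have : toH ν ∘ₗ conjGrp w =
      LinearMap.mulRight ℂ (grp ν w⁻¹) ∘ₗ LinearMap.mulLeft ℂ (grp ν w) ∘ₗ toH ν := by
    refine Mod.hom_ext fun g f => ?_
    simp only [LinearMap.comp_apply, conjGrp_single, toH_single, LinearMap.mulRight_apply,
      LinearMap.mulLeft_apply]
    rw [← mul_assoc, grp_normal, mul_assoc, mul_assoc, grp_mul, mul_assoc, grp_mul]
  exact LinearMap.congr_fun this m

end NormalOrdering

end Calogero

namespace Calogero
open scoped InnerProductSpace

/-! ### Eigenspaces of group elements, their projections and the effect of a reflection. -/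

section Eigenspace

variable {N : ℕ} {R : Finset (V N)}

/-- A group element as a linear endomorphism. -/
noncomputable def lmap (g : W R) : Module.End ℝ (V N) :=
  ((g : V N ≃ₗᵢ[ℝ] V N).toLinearEquiv : V N →ₗ[ℝ] V N)

theorem lmap_pow (g : W R) (k : ℕ) : lmap g ^ k = lmap (g ^ k) := by
  induction k with
  | zero => rfl
  | succ k ih => rw [pow_succ, ih, pow_succ]; rfl

/-- The eigenspace of a group element with eigenvalue `κ`. -/
noncomputable def eigen (κ : ℝ) (g : W R) : Submodule ℝ (V N) :=
  Module.End.eigenspace (lmap g) κ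

theorem mem_eigen {κ : ℝ} {g : W R} {x : V N} :
    x ∈ eigen κ g ↔ (g : V N ≃ₗᵢ[ℝ] V N) x = κ • x :=
  Module.End.mem_eigenspace_iff

/-- The dimension of the eigenspace with eigenvalue `κ`. -/
noncomputable def eigenDim (κ : ℝ) (g : W R) : ℕ := Module.finrank ℝ (eigen κ g)

theorem eigenDim_eq_zero {κ : ℝ} {g : W R} :
    eigenDim κ g = 0 ↔ ¬ Module.End.HasEigenvalue
      ((g : V N ≃ₗᵢ[ℝ] V N).toLinearEquiv : V N →ₗ[ℝ] V N) κ := by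
  rw [eigenDim, Submodule.finrank_eq_zero, Module.End.hasEigenvalue_iff, not_not]
  rfl

theorem eigenDim_conj (κ : ℝ) (w g : W R) : eigenDim κ (w * g * w⁻¹) = eigenDim κ g := by
  have h : eigen κ (w * g * w⁻¹) =
      (eigen κ g).map ((w : V N ≃ₗᵢ[ℝ] V N).toLinearEquiv : V N →ₗ[ℝ] V N) := by
    ext x
    rw [Submodule.mem_map_equiv, mem_eigen, mem_eigen]
    change (w : V N ≃ₗᵢ[ℝ] V N) ((g : V N ≃ₗᵢ[ℝ] V N) ((w : V N ≃ₗᵢ[ℝ] V N).symm x)) = _ ↔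
      (g : V N ≃ₗᵢ[ℝ] V N) ((w : V N ≃ₗᵢ[ℝ] V N).symm x) =
        κ • (w : V N ≃ₗᵢ[ℝ] V N).symm x
    rw [← map_smul, LinearIsometryEquiv.eq_symm_apply]
  rw [eigenDim, eigenDim, h]
  exact LinearEquiv.finrank_map_eq _ _

theorem reflW_mul_apply (v : R) (g : W R) (x : V N) :
    ((reflW v * g : W R) : V N ≃ₗᵢ[ℝ] V N) x = refl (v : V N) ((g : V N ≃ₗᵢ[ℝ] V N) x) := rfl

theorem refl_apply_of_inner_eq_zero {v x : V N} (h : ⟪x, v⟫_ℝ = 0) : refl v x = x := by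
  rw [refl_apply, h, zero_div, mul_zero, zero_smul, sub_zero]

theorem refl_refl (v x : V N) : refl v (refl v x) = x :=
  congrArg (fun s : V N ≃ₗᵢ[ℝ] V N => s x) (refl_mul_self v)

theorem mem_eigen_of_reflW_mul {κ : ℝ} {v : R} {g : W R} {x : V N}
    (hx : x ∈ eigen κ (reflW v * g)) (h : ⟪x, (v : V N)⟫_ℝ = 0) : x ∈ eigen κ g := by
  rw [mem_eigen, reflW_mul_apply] at hx
  rw [mem_eigen]
  have := congrArg (refl (v : V N)) hx
  rwa [refl_refl, map_smul, refl_apply_of_inner_eq_zero h] at this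

/-- On the hyperplane orthogonal to v the eigenvectors of R_v g are eigenvectors of g, and passing
to a hyperplane costs at most one dimension. -/
theorem eigenDim_reflW_mul_le (κ : ℝ) (v : R) (g : W R) :
    eigenDim κ (reflW v * g) ≤ eigenDim κ g + 1 := by
  have h1 := Submodule.finrank_sup_add_finrank_inf_eq (eigen κ (reflW v * g))
    (Submodule.span ℝ {(v : V N)})ᗮ
  have h2 := Submodule.finrank_le (eigen κ (reflW v * g) ⊔ (Submodule.span ℝ {(v : V N)})ᗮ)
  have h3 := Submodule.finrank_add_finrank_orthogonal (Submodule.span ℝ {(v : V N)})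
  have h4 : Module.finrank ℝ (Submodule.span ℝ {(v : V N)}) ≤ 1 := by
    simpa using finrank_span_le_card (R := ℝ) {(v : V N)}
  have h5 : eigen κ (reflW v * g) ⊓ (Submodule.span ℝ {(v : V N)})ᗮ ≤ eigen κ g := by
    rintro x ⟨hx, hv⟩
    refine mem_eigen_of_reflW_mul hx ?_
    rw [real_inner_comm]
    exact Submodule.mem_orthogonal_singleton_iff_inner_right.1 hv
  have h6 := Submodule.finrank_mono h5
  rw [eigenDim, eigenDim]
  omega

/-- If R_v g x = κ x, then g x = κ R_v x. Pairing with g y = κ y gives (R_v x, y) = (x, y), so (x,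
v)(v, y) = 0 and x is orthogonal to v. The eigenspace of R_v g thus sits inside that of g and misses
y. -/
theorem eigenDim_reflW_mul_lt {κ : ℝ} (hκ : κ * κ = 1) {v : R} {g : W R} {y : V N}
    (hy : y ∈ eigen κ g) (hyv : ⟪y, (v : V N)⟫_ℝ ≠ 0) :
    eigenDim κ (reflW v * g) < eigenDim κ g := by
  have key : ∀ x ∈ eigen κ (reflW v * g), ⟪x, (v : V N)⟫_ℝ = 0 := by
    intro x hx
    rw [mem_eigen, reflW_mul_apply] at hx
    have h1 : (g : V N ≃ₗᵢ[ℝ] V N) x = κ • refl (v : V N) x := by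
      have := congrArg (refl (v : V N)) hx
      rwa [refl_refl, map_smul] at this
    have h2 := (g : V N ≃ₗᵢ[ℝ] V N).inner_map_map x y
    rw [h1, mem_eigen.1 hy, real_inner_smul_left, real_inner_smul_right, ← mul_assoc, hκ, one_mul,
      refl_apply, inner_sub_left, real_inner_smul_left, sub_eq_self, mul_eq_zero] at h2
    rcases h2 with h2 | h2
    · rw [mul_eq_zero, div_eq_zero_iff] at h2
      rcases h2 with h2 | h2 | h2
      · norm_num at h2
      · exact h2
      · rw [inner_self_eq_zero] at h2
        rw [h2, inner_zero_right]
    · rw [real_inner_comm] at h2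
      exact absurd h2 hyv
  refine Submodule.finrank_lt_finrank_of_lt (lt_of_le_of_ne
    (fun x hx => mem_eigen_of_reflW_mul hx (key x hx)) ?_)
  intro h
  exact hyv (key y (h ▸ hy))

/-- The group element multiplied by the sign `κ`. -/
noncomputable def twist (κ : ℝ) (g : W R) : Module.End ℝ (V N) := κ • lmap g

theorem twist_apply (κ : ℝ) (g : W R) (x : V N) :
    twist κ g x = κ • (g : V N ≃ₗᵢ[ℝ] V N) x := rfl

theorem twist_pow_conj (κ : ℝ) (w g : W R) (k : ℕ) (x : V N) :
    (w : V N ≃ₗᵢ[ℝ] V N) ((twist κ g ^ k) x) =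
      (twist κ (w * g * w⁻¹) ^ k) ((w : V N ≃ₗᵢ[ℝ] V N) x) := by
  induction k generalizing x with
  | zero => rfl
  | succ k ih =>
    rw [pow_succ, pow_succ, Module.End.mul_apply, Module.End.mul_apply, ih, twist_apply,
      twist_apply, map_smul]
    congr 2
    change _ = (w : V N ≃ₗᵢ[ℝ] V N) ((g : V N ≃ₗᵢ[ℝ] V N)
      ((w : V N ≃ₗᵢ[ℝ] V N).symm ((w : V N ≃ₗᵢ[ℝ] V N) x)))
    rw [LinearIsometryEquiv.symm_apply_apply]

/-- A common period of the elements `κ g`. -/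
noncomputable def period (R : Finset (V N)) : ℕ := 2 * Nat.card (W R)

theorem twist_pow_period {κ : ℝ} (hκ : κ * κ = 1) (g : W R) : twist κ g ^ period R = 1 := by
  rw [twist, smul_pow, period, pow_mul, pow_two, hκ, one_pow, one_smul, lmap_pow, mul_comm,
    pow_mul, pow_card_eq_one', one_pow]
  rfl

theorem period_ne_zero (hR : IsRootSystem R) : (period R : ℝ) ≠ 0 := by
  have := hR.finite
  have h : Nat.card (W R) ≠ 0 := Nat.card_pos.ne'
  simpa [period] using h

/-- The orthogonal projection onto the eigenspace with eigenvalue `κ`. -/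
noncomputable def proj (κ : ℝ) (g : W R) : Module.End ℝ (V N) :=
  (period R : ℝ)⁻¹ • ∑ k ∈ Finset.range (period R), twist κ g ^ k

/-- An inverse of `g - κ` on the orthogonal complement of the eigenspace. -/
noncomputable def pinv (κ : ℝ) (g : W R) : Module.End ℝ (V N) :=
  (κ * (period R : ℝ)⁻¹) • ∑ k ∈ Finset.range (period R), (k : ℝ) • twist κ g ^ k

theorem twist_mul_sum {κ : ℝ} (hκ : κ * κ = 1) (g : W R) :
    twist κ g * ∑ k ∈ Finset.range (period R), twist κ g ^ k =
      ∑ k ∈ Finset.range (period R), twist κ g ^ k := by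
  rw [Finset.mul_sum]
  simp only [← pow_succ']
  have h1 := Finset.sum_range_succ (fun k => twist κ g ^ k) (period R)
  have h2 := Finset.sum_range_succ' (fun k => twist κ g ^ k) (period R)
  rw [twist_pow_period hκ] at h1
  rw [pow_zero] at h2
  exact add_right_cancel (h2.symm.trans h1)

theorem twist_mul_proj {κ : ℝ} (hκ : κ * κ = 1) (g : W R) :
    twist κ g * proj κ g = proj κ g := by
  rw [proj, mul_smul_comm, twist_mul_sum hκ]

theorem commute_twist_proj (κ : ℝ) (g : W R) : Commute (twist κ g) (proj κ g) :=
  (Commute.sum_right _ _ _ fun _ _ => Commute.self_pow _ _).smul_right _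

theorem commute_twist_pinv (κ : ℝ) (g : W R) : Commute (twist κ g) (pinv κ g) :=
  (Commute.sum_right _ _ _ fun _ _ => (Commute.self_pow _ _).smul_right _).smul_right _

/-- Summation by parts: with T = κ g and T^n = 1, (T - 1) ∑ k T^k = n - ∑ T^k, and the last sum is n
times the projection. The factor 2 in `period` makes T^n = 1 also for κ = -1. -/
theorem twist_sub_one_mul_pinv (hR : IsRootSystem R) {κ : ℝ} (hκ : κ * κ = 1) (g : W R) :
    (twist κ g - 1) * pinv κ g = κ • (1 - proj κ g) := by
  have h : ∀ n : ℕ, (twist κ g - 1) * ∑ k ∈ Finset.range n, (k : ℝ) • twist κ g ^ k =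
      (n : ℝ) • twist κ g ^ n - twist κ g * ∑ k ∈ Finset.range n, twist κ g ^ k := by
    intro n
    induction n with
    | zero => simp
    | succ n ih =>
      rw [Finset.sum_range_succ, mul_add, ih, Finset.sum_range_succ, mul_add, mul_smul_comm,
        sub_mul, ← pow_succ', one_mul, Nat.cast_succ, add_smul, one_smul, smul_sub]
      abel
  rw [pinv, mul_smul_comm, h, twist_pow_period hκ, twist_mul_sum hκ, mul_smul, smul_sub,
    smul_smul, inv_mul_cancel₀ (period_ne_zero hR), one_smul, proj]

theorem sub_eq_twist {κ : ℝ} (hκ : κ * κ = 1) (g : W R) (x : V N) :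
    (g : V N ≃ₗᵢ[ℝ] V N) x - κ • x = κ • (twist κ g - 1) x := by
  rw [LinearMap.sub_apply, twist_apply, smul_sub, smul_smul, hκ, one_smul]
  rfl

theorem sub_pinv (hR : IsRootSystem R) {κ : ℝ} (hκ : κ * κ = 1) (g : W R) (x : V N) :
    (g : V N ≃ₗᵢ[ℝ] V N) (pinv κ g x) - κ • pinv κ g x = x - proj κ g x := by
  rw [sub_eq_twist hκ, ← Module.End.mul_apply, twist_sub_one_mul_pinv hR hκ, LinearMap.smul_apply,
    smul_smul, hκ, one_smul]
  rfl

theorem pinv_sub (hR : IsRootSystem R) {κ : ℝ} (hκ : κ * κ = 1) (g : W R) (x : V N) :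
    pinv κ g ((g : V N ≃ₗᵢ[ℝ] V N) x - κ • x) = x - proj κ g x := by
  rw [← sub_pinv hR hκ, sub_eq_twist hκ, sub_eq_twist hκ, map_smul, ← Module.End.mul_apply,
    ← Module.End.mul_apply, mul_sub, sub_mul, (commute_twist_pinv κ g).eq, mul_one, one_mul]

theorem apply_proj {κ : ℝ} (hκ : κ * κ = 1) (g : W R) (x : V N) :
    (g : V N ≃ₗᵢ[ℝ] V N) (proj κ g x) = κ • proj κ g x := by
  have h := LinearMap.congr_fun (twist_mul_proj hκ g) x
  rw [Module.End.mul_apply, twist_apply] at h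
  have := congrArg (κ • ·) h
  simpa only [smul_smul, hκ, one_smul] using this

theorem proj_apply_map {κ : ℝ} (hκ : κ * κ = 1) (g : W R) (x : V N) :
    proj κ g ((g : V N ≃ₗᵢ[ℝ] V N) x) = κ • proj κ g x := by
  have h := LinearMap.congr_fun (twist_mul_proj hκ g) x
  rw [(commute_twist_proj κ g).eq, Module.End.mul_apply, twist_apply, map_smul] at h
  have := congrArg (κ • ·) h
  simpa only [smul_smul, hκ, one_smul] using this

theorem proj_mem {κ : ℝ} (hκ : κ * κ = 1) (g : W R) (x : V N) : proj κ g x ∈ eigen κ g :=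
  mem_eigen.2 (apply_proj hκ g x)

theorem proj_of_mem (hR : IsRootSystem R) {κ : ℝ} (hκ : κ * κ = 1) {g : W R} {x : V N}
    (hx : x ∈ eigen κ g) : proj κ g x = x := by
  have h := sub_pinv hR hκ g x
  have h1 := pinv_sub hR hκ g x
  rw [mem_eigen.1 hx, sub_self, map_zero] at h1
  exact (sub_eq_zero.1 h1.symm).symm

theorem inner_proj_of_mem (hR : IsRootSystem R) {κ : ℝ} (hκ : κ * κ = 1) {g : W R} {z : V N}
    (hz : z ∈ eigen κ g) (x : V N) : ⟪proj κ g x, z⟫_ℝ = ⟪x, z⟫_ℝ := by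
  have h1 : ∀ y : V N, ⟪(g : V N ≃ₗᵢ[ℝ] V N) y - κ • y, z⟫_ℝ = 0 := by
    intro y
    have h2 := (g : V N ≃ₗᵢ[ℝ] V N).inner_map_map y z
    rw [mem_eigen.1 hz, real_inner_smul_right] at h2
    rw [inner_sub_left, real_inner_smul_left, ← h2, ← mul_assoc, hκ, one_mul, sub_self]
  have h2 := h1 (pinv κ g x)
  rw [sub_pinv hR hκ, inner_sub_left, sub_eq_zero] at h2
  exact h2.symm

theorem inner_proj (hR : IsRootSystem R) {κ : ℝ} (hκ : κ * κ = 1) (g : W R) (x y : V N) :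
    ⟪proj κ g x, y⟫_ℝ = ⟪x, proj κ g y⟫_ℝ := by
  rw [← inner_proj_of_mem hR hκ (proj_mem hκ g y), real_inner_comm,
    ← inner_proj_of_mem hR hκ (proj_mem hκ g x), real_inner_comm]

theorem trace_proj (hR : IsRootSystem R) {κ : ℝ} (hκ : κ * κ = 1) (g : W R) :
    ∑ i, proj κ g (e i) i = eigenDim κ g := by
  have h : LinearMap.IsProj (eigen κ g) (proj κ g) :=
    ⟨proj_mem hκ g, fun x hx => proj_of_mem hR hκ hx⟩
  have h1 := h.trace
  rw [LinearMap.trace_eq_matrix_trace ℝ (EuclideanSpace.basisFun (Fin N) ℝ).toBasis] at h1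
  rw [eigenDim, ← h1, Matrix.trace]
  refine Finset.sum_congr rfl fun i _ => ?_
  simp [LinearMap.toMatrix_apply]

theorem proj_conj (κ : ℝ) (w g : W R) (x : V N) :
    (w : V N ≃ₗᵢ[ℝ] V N) (proj κ g x) =
      proj κ (w * g * w⁻¹) ((w : V N ≃ₗᵢ[ℝ] V N) x) := by
  simp only [proj, LinearMap.smul_apply, LinearMap.sum_apply, map_smul, map_sum, twist_pow_conj]

theorem pinv_conj (κ : ℝ) (w g : W R) (x : V N) :
    (w : V N ≃ₗᵢ[ℝ] V N) (pinv κ g x) =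
      pinv κ (w * g * w⁻¹) ((w : V N ≃ₗᵢ[ℝ] V N) x) := by
  simp only [pinv, LinearMap.smul_apply, LinearMap.sum_apply, map_smul, map_sum, twist_pow_conj]

end Eigenspace

end Calogero

namespace Calogero
open scoped InnerProductSpace
open MvPolynomial

/-! ### Twisted commutators with the letters, and the Laplacian. -/

section CommutatorOperators

variable {N : ℕ} {R : Finset (V N)}

/-- The vector along which the commutator with `x_γ` differentiates. -/
noncomputable def shift (κ : ℝ) (γ : Fin 2) (g : W R) : Module.End ℝ (V N) :=
  ![-lmap g, κ • 1] γ

/-- The divided difference operator entering the commutator with `x_γ`. -/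
noncomputable def dunkl (γ : Fin 2) (v : V N) : Pol N →ₗ[ℂ] Pol N :=
  ![dd 1 v, dd 0 v ∘ₗ (act (pr 1 v)).toLinearMap] γ

/-- The action of `F ↦ F x_γ - κ x_γ F` on polynomials times `g` for zero parameters. -/
noncomputable def weylPoly (κ : ℝ) (γ : Fin 2) (x : V N) (g : W R) : Pol N →ₗ[ℂ] Pol N :=
  LinearMap.mulLeft ℂ (lin γ ((g : V N ≃ₗᵢ[ℝ] V N) x - κ • x)) + pd γ.rev (shift κ γ g x)

theorem weylPoly_apply (κ : ℝ) (γ : Fin 2) (x : V N) (g : W R) (f : Pol N) :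
    weylPoly κ γ x g f =
      lin γ ((g : V N ≃ₗᵢ[ℝ] V N) x - κ • x) * f + pd γ.rev (shift κ γ g x) f := rfl

/-- The operator `F ↦ F x_γ - κ x_γ F` for zero parameters. -/
noncomputable def weylOp (R : Finset (V N)) (κ : ℝ) (γ : Fin 2) :
    V N →ₛₗ[Complex.ofRealHom] Module.End ℂ (Mod R) where
  toFun x := Mod.lift fun g => Mod.single g ∘ₗ weylPoly κ γ x g
  map_add' x y := by
    refine Mod.hom_ext fun g f => ?_
    simp only [LinearMap.add_apply, Mod.lift_single, LinearMap.comp_apply, weylPoly_apply,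
      map_add, add_mul, smul_add, map_sub, sub_mul]
    abel
  map_smul' r x := by
    refine Mod.hom_ext fun g f => ?_
    have h : (g : V N ≃ₗᵢ[ℝ] V N) (r • x) - κ • (r • x) =
        r • ((g : V N ≃ₗᵢ[ℝ] V N) x - κ • x) := by
      rw [map_smul, smul_comm κ r x, smul_sub]
    simp only [LinearMap.smul_apply, Mod.lift_single, LinearMap.comp_apply, weylPoly_apply, h]
    simp only [map_smul, map_smulₛₗ, LinearMap.smul_apply, smul_mul_assoc, map_add, smul_add]

theorem weylOp_single (κ : ℝ) (γ : Fin 2) (x : V N) (g : W R) (f : Pol N) :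
    weylOp R κ γ x (Mod.single g f) = Mod.single g (weylPoly κ γ x g f) := by
  simp only [weylOp, LinearMap.coe_mk, AddHom.coe_mk, Mod.lift_single, LinearMap.comp_apply]

/-- The part of `F ↦ F x_γ - κ x_γ F` depending on the parameters. -/
noncomputable def reflOp (ν : R → ℂ) (κ : ℝ) (γ : Fin 2) :
    V N →ₛₗ[Complex.ofRealHom] Module.End ℂ (Mod R) where
  toFun x := Mod.lift fun g => ∑ v : R, (ν v * (⟪shift κ γ g x, (v : V N)⟫_ℝ : ℝ)) •
    (Mod.single (reflW v * g) ∘ₗ dunkl γ (v : V N))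
  map_add' x y := by
    refine Mod.hom_ext fun g f => ?_
    simp only [LinearMap.add_apply, Mod.lift_single, map_add, LinearMap.sum_apply,
      LinearMap.smul_apply, inner_add_left, mul_add, Complex.ofReal_add, add_smul,
      Finset.sum_add_distrib]
  map_smul' r x := by
    refine Mod.hom_ext fun g f => ?_
    simp only [LinearMap.smul_apply, Mod.lift_single, map_smul, LinearMap.sum_apply,
      real_inner_smul_left, Complex.ofReal_mul, Finset.smul_sum,
      smul_smul, Complex.ofRealHom_eq_coe, mul_left_comm]

theorem reflOp_single (ν : R → ℂ) (κ : ℝ) (γ : Fin 2) (x : V N) (g : W R) (f : Pol N) :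
    reflOp ν κ γ x (Mod.single g f) = ∑ v : R, (ν v * (⟪shift κ γ g x, (v : V N)⟫_ℝ : ℝ)) •
      Mod.single (reflW v * g) (dunkl γ (v : V N) f) := by
  simp only [reflOp, LinearMap.coe_mk, AddHom.coe_mk, Mod.lift_single, LinearMap.comp_apply,
    LinearMap.sum_apply, LinearMap.smul_apply]

/-- The operator `F ↦ F x_γ - κ x_γ F`. -/
noncomputable def commOp (ν : R → ℂ) (κ : ℝ) (γ : Fin 2) :
    V N →ₛₗ[Complex.ofRealHom] Module.End ℂ (Mod R) :=
  weylOp R κ γ + reflOp ν κ γ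

theorem commOp_apply (ν : R → ℂ) (κ : ℝ) (γ : Fin 2) (x : V N) (m : Mod R) :
    commOp ν κ γ x m = weylOp R κ γ x m + reflOp ν κ γ x m := rfl

theorem reflOp_smul (s : ℂ) (ν : R → ℂ) (κ : ℝ) (γ : Fin 2) (x : V N) (m : Mod R) :
    reflOp (s • ν) κ γ x m = s • reflOp ν κ γ x m := by
  have : reflOp (s • ν) κ γ x = s • reflOp ν κ γ x := by
    refine Mod.hom_ext fun g f => ?_
    simp only [LinearMap.smul_apply, reflOp_single, Finset.smul_sum, smul_smul, Pi.smul_apply,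
      smul_eq_mul, mul_assoc]
  exact LinearMap.congr_fun this m

theorem reflOp_zero (κ : ℝ) (γ : Fin 2) (x : V N) (m : Mod R) :
    reflOp (0 : R → ℂ) κ γ x m = 0 := by
  have := reflOp_smul (0 : ℂ) (0 : R → ℂ) κ γ x m
  rwa [zero_smul, zero_smul] at this

theorem toH_commOp (hR : IsRootSystem R) (ν : R → ℂ) (κ : ℝ) (γ : Fin 2) (x : V N) (m : Mod R) :
    toH ν (commOp ν κ γ x m) = toH ν m * vec ν γ x - (κ : ℂ) • (vec ν γ x * toH ν m) := by
  fin_cases γ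
  · simp only [Fin.zero_eta]
    rw [← toH_leftZero, ← toH_rightZero hR, ← map_smul, ← map_sub]
    congr 1
    have : commOp ν κ 0 x = rightZero ν x - (κ : ℂ) • leftZero x := by
      refine Mod.hom_ext fun g f => ?_
      simp only [LinearMap.sub_apply, LinearMap.smul_apply, commOp_apply, weylOp_single,
        weylPoly_apply, reflOp_single, rightZero_single, leftZero_single]
      have h1 : shift κ 0 g x = -((g : V N ≃ₗᵢ[ℝ] V N) x) := rfl
      have h2 : dunkl (0 : Fin 2) = fun v : V N => dd 1 v := rfl
      have h3 : Fin.rev (0 : Fin 2) = 1 := rfl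
      simp only [h1, h2, h3, map_sub, map_neg, map_smulₛₗ, inner_neg_left, Complex.ofReal_neg,
        mul_neg, neg_smul, Finset.sum_neg_distrib, sub_mul, smul_mul_assoc, map_add,
        LinearMap.neg_apply, RingHom.id_apply, Complex.ofRealHom_eq_coe]
      abel
    exact LinearMap.congr_fun this m
  · simp only [Fin.mk_one]
    rw [← toH_leftOne hR, ← toH_rightOne, ← map_smul, ← map_sub]
    congr 1
    have : commOp ν κ 1 x = rightOne x - (κ : ℂ) • leftOne ν x := by
      refine Mod.hom_ext fun g f => ?_
      simp only [LinearMap.sub_apply, LinearMap.smul_apply, commOp_apply, weylOp_single,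
        weylPoly_apply, reflOp_single, rightOne_single, leftOne_single]
      have h1 : shift κ 1 g x = κ • x := rfl
      have h2 : dunkl (1 : Fin 2) = fun v : V N => dd 0 v ∘ₗ (act (pr 1 v)).toLinearMap := rfl
      have h3 : Fin.rev (1 : Fin 2) = 0 := rfl
      simp only [h1, h2, h3, map_sub, map_smulₛₗ, real_inner_smul_left, Complex.ofReal_mul,
        sub_mul, smul_mul_assoc, map_add, smul_sub, Finset.smul_sum, smul_smul,
        LinearMap.smul_apply, RingHom.id_apply, Complex.ofRealHom_eq_coe, LinearMap.comp_apply,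
        AlgHom.toLinearMap_apply, mul_left_comm]
      abel
    exact LinearMap.congr_fun this m

/-- Checked in the algebra, where `conjGrp` is honest conjugation, and transported back by
injectivity of `pbw`. -/
theorem conjGrp_commOp (hR : IsRootSystem R) {ν : R → ℂ} (hν : IsInvariantParam ν) (κ : ℝ)
    (γ : Fin 2) (w : W R) (x : V N) (m : Mod R) :
    conjGrp w (commOp ν κ γ x m) =
      commOp ν κ γ ((w : V N ≃ₗᵢ[ℝ] V N) x) (conjGrp w m) := by
  apply (pbw hR hν).injective
  have h1 : grp ν w⁻¹ * vec ν γ ((w : V N ≃ₗᵢ[ℝ] V N) x) = vec ν γ x * grp ν w⁻¹ := by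
    rw [grp_vec]
    congr 2
    exact (w : V N ≃ₗᵢ[ℝ] V N).symm_apply_apply x
  simp only [pbw_apply, toH_conjGrp, toH_commOp hR, mul_sub, sub_mul, mul_smul_comm,
    smul_mul_assoc]
  congr 1
  · rw [mul_assoc (_ * _) (grp ν w⁻¹), h1]
    simp only [mul_assoc]
  · rw [← mul_assoc, ← mul_assoc, grp_vec]
    simp only [mul_assoc]

theorem isInvariantParam_smul {ν : R → ℂ} (hν : IsInvariantParam ν) (s : ℂ) :
    IsInvariantParam (s • ν) := fun v w h => by
  rw [Pi.smul_apply, Pi.smul_apply, hν v w h]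

/-- The case ν = 0 of `conjGrp_commOp`. Equivariance of `reflOp` then follows by subtraction. -/
theorem conjGrp_weylOp (hR : IsRootSystem R) (κ : ℝ) (γ : Fin 2) (w : W R) (x : V N)
    (m : Mod R) : conjGrp w (weylOp R κ γ x m) =
      weylOp R κ γ ((w : V N ≃ₗᵢ[ℝ] V N) x) (conjGrp w m) := by
  have := conjGrp_commOp hR (ν := (0 : R → ℂ)) (fun _ _ _ => rfl) κ γ w x m
  simpa only [commOp_apply, reflOp_zero, add_zero] using this

theorem conjGrp_reflOp (hR : IsRootSystem R) {ν : R → ℂ} (hν : IsInvariantParam ν) (κ : ℝ)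
    (γ : Fin 2) (w : W R) (x : V N) (m : Mod R) : conjGrp w (reflOp ν κ γ x m) =
      reflOp ν κ γ ((w : V N ≃ₗᵢ[ℝ] V N) x) (conjGrp w m) := by
  have := conjGrp_commOp hR hν κ γ w x m
  rw [commOp_apply, commOp_apply, map_add, conjGrp_weylOp hR] at this
  exact add_left_cancel this

/-- Invariant functionals vanish on commutators with group elements, hence do not see the
commutators of the operators `F ↦ F x_γ - κ x_γ F`. -/
theorem apply_commOp_commOp (hR : IsRootSystem R) {ν : R → ℂ} (hν : IsInvariantParam ν) {κ : ℝ}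
    (hκ : κ * κ = 1) {t : Mod R →ₗ[ℂ] ℂ} (ht : ∀ w m, t (conjGrp w m) = t m) (α β : Fin 2)
    (x y : V N) (m : Mod R) :
    t (commOp ν κ α x (commOp ν κ β y m)) = t (commOp ν κ β y (commOp ν κ α x m)) := by
  let τ : H ν →ₗ[ℂ] ℂ := t ∘ₗ (pbw hR hν).symm.toLinearMap
  have hτ : ∀ m, t m = τ (toH ν m) := by
    intro m
    simp only [τ, LinearMap.comp_apply, LinearEquiv.coe_coe]
    rw [← pbw_apply hR hν, LinearEquiv.symm_apply_apply]
  have hg : ∀ w h, τ (h * grp ν w) = τ (grp ν w * h) := by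
    intro w h
    obtain ⟨m, hm⟩ := (pbw hR hν).surjective (h * grp ν w)
    rw [pbw_apply] at hm
    rw [← hm, ← hτ, ← ht w m, hτ, toH_conjGrp, hm, mul_assoc, mul_assoc, grp_mul, mul_inv_cancel,
      grp_one, mul_one]
  have hc : ∀ h, τ (h * commValue ν (grp ν) x y) = τ (commValue ν (grp ν) x y * h) := by
    intro h
    simp only [commValue, mul_add, add_mul, Finset.mul_sum, Finset.sum_mul, map_add, map_sum,
      mul_smul_comm, smul_mul_assoc, map_smul, hg, Algebra.commutes]
  have hκ' : (κ : ℂ) * κ = 1 := by exact_mod_cast hκ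
  rw [hτ, hτ, ← sub_eq_zero, ← map_sub]
  simp only [toH_commOp hR]
  generalize toH ν m = h at *
  -- Mixed terms cancel and κ² = 1, so only the commutator of h with [x_α, y_β] remains. That
  -- bracket lies in the group algebra, on which τ is tracial.
  have key : (h * vec ν β y - (κ : ℂ) • (vec ν β y * h)) * vec ν α x -
      (κ : ℂ) • (vec ν α x * (h * vec ν β y - (κ : ℂ) • (vec ν β y * h))) -
      ((h * vec ν α x - (κ : ℂ) • (vec ν α x * h)) * vec ν β y -
      (κ : ℂ) • (vec ν β y * (h * vec ν α x - (κ : ℂ) • (vec ν α x * h)))) =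
      eps α β • (commValue ν (grp ν) x y * h - h * commValue ν (grp ν) x y) := by
    have h1 : eps α β • (commValue ν (grp ν) x y * h) =
        (vec ν α x * vec ν β y - vec ν β y * vec ν α x) * h := by
      rw [vec_comm, smul_mul_assoc]
    have h2 : eps α β • (h * commValue ν (grp ν) x y) =
        h * (vec ν α x * vec ν β y - vec ν β y * vec ν α x) := by
      rw [vec_comm, mul_smul_comm]
    rw [smul_sub, h1, h2]
    simp only [mul_sub, sub_mul, smul_sub, mul_smul_comm, smul_mul_assoc, smul_smul, hκ',
      one_smul, mul_assoc]
    abel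
  rw [key, map_smul, map_sub, hc, sub_self, smul_zero]

/-- The sign attached to the two kinds of letters. -/
def sgn : Fin 2 → ℝ := ![-1, 1]

/-- The composition of a contracting homotopy with the differential given by `d`. -/
noncomputable def lapl (κ : ℝ) (d : Fin 2 → V N →ₛₗ[Complex.ofRealHom] Module.End ℂ (Mod R)) :
    Module.End ℂ (Mod R) :=
  -- Off the eigenspace the differential has leading part multiplication by (g - κ)x, undone by
  -- `pinv` followed by contraction with a derivative (Koszul). On it the differential is, up to the
  -- sign κ `sgn α`, a derivative in the letters of the other kind, undone by multiplication (de
  -- Rham).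
  Mod.lift fun g => ∑ α, ∑ i, (d α (pinv κ g (e i)) ∘ₗ Mod.single g ∘ₗ
    (pderiv (α, i)).toLinearMap + ((κ * sgn α : ℝ) : ℂ) • (d α (proj κ g (e i)) ∘ₗ
      Mod.single g ∘ₗ LinearMap.mulLeft ℂ (X (α.rev, i))))

theorem lapl_single (κ : ℝ) (d : Fin 2 → V N →ₛₗ[Complex.ofRealHom] Module.End ℂ (Mod R))
    (g : W R) (f : Pol N) : lapl κ d (Mod.single g f) =
      ∑ α, ∑ i, (d α (pinv κ g (e i)) (Mod.single g (pderiv (α, i) f)) +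
        ((κ * sgn α : ℝ) : ℂ) • d α (proj κ g (e i)) (Mod.single g (X (α.rev, i) * f))) := by
  simp only [lapl, Mod.lift_single, LinearMap.sum_apply, LinearMap.add_apply,
    LinearMap.smul_apply, LinearMap.comp_apply, LinearMap.mulLeft_apply]
  rfl

theorem lapl_commOp (κ : ℝ) (ν : R → ℂ) (m : Mod R) :
    lapl κ (commOp ν κ) m = lapl κ (weylOp R κ) m + lapl κ (reflOp ν κ) m := by
  have : lapl κ (commOp ν κ) = lapl κ (weylOp R κ) + lapl κ (reflOp ν κ) := by
    refine Mod.hom_ext fun g f => ?_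
    simp only [LinearMap.add_apply, lapl_single, commOp_apply, ← Finset.sum_add_distrib, smul_add]
    refine Finset.sum_congr rfl fun α _ => Finset.sum_congr rfl fun i _ => ?_
    abel
  exact LinearMap.congr_fun this m

theorem lapl_reflOp_smul (κ : ℝ) (s : ℂ) (ν : R → ℂ) (m : Mod R) :
    lapl κ (reflOp (s • ν) κ) m = s • lapl κ (reflOp ν κ) m := by
  have : lapl κ (reflOp (s • ν) κ) = s • lapl κ (reflOp ν κ) := by
    refine Mod.hom_ext fun g f => ?_
    simp only [LinearMap.smul_apply, lapl_single, reflOp_smul, Finset.smul_sum, smul_add]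
    refine Finset.sum_congr rfl fun α _ => Finset.sum_congr rfl fun i _ => ?_
    rw [smul_comm s]
  exact LinearMap.congr_fun this m

/-- The canonical element of `V ⊗ V` is invariant under isometries. -/
theorem sum_isometry {E : Type*} [AddCommGroup E] [Module ℂ E]
    (B : V N →ₛₗ[Complex.ofRealHom] V N →ₛₗ[Complex.ofRealHom] E) (w : V N ≃ₗᵢ[ℝ] V N) :
    ∑ i, B (w (e i)) (w (e i)) = ∑ i, B (e i) (e i) := by
  have h1 : ∀ i, B (w (e i)) (w (e i)) =
      ∑ j, ∑ k, (((w (e i) j * w (e i) k : ℝ) : ℂ)) • B (e j) (e k) := by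
    intro i
    rw [semilinear_apply B (w (e i)), LinearMap.sum_apply]
    refine Finset.sum_congr rfl fun j _ => ?_
    rw [LinearMap.smul_apply, semilinear_apply (B (e j)), Finset.smul_sum]
    refine Finset.sum_congr rfl fun k _ => ?_
    rw [smul_smul, Complex.ofReal_mul]
  have h2 : ∀ j k, ∑ i, w (e i) j * w (e i) k = ⟪e j, e k⟫_ℝ := by
    intro j k
    rw [← w.symm.inner_map_map, inner_eq_sum]
    refine Finset.sum_congr rfl fun i _ => ?_
    rw [← inner_e (w.symm (e j)), ← inner_e (w.symm (e k)), ← inner_e (w (e i)) j,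
      ← inner_e (w (e i)) k, ← w.inner_map_map (w.symm (e j)), ← w.inner_map_map (w.symm (e k)),
      w.apply_symm_apply, w.apply_symm_apply, real_inner_comm, real_inner_comm (e k)]
  simp only [h1]
  rw [Finset.sum_comm]
  refine Finset.sum_congr rfl fun j _ => ?_
  rw [Finset.sum_comm, Finset.sum_eq_single j]
  · rw [← Finset.sum_smul, ← Complex.ofReal_sum, h2]
    simp
  · intro k _ hk
    rw [← Finset.sum_smul, ← Complex.ofReal_sum, h2, inner_e]
    simp [hk]
  · simp

end CommutatorOperators

end Calogero

namespace Calogero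
open scoped InnerProductSpace
open MvPolynomial

/-! ### The Laplacian: equivariance, value at ν = 0, homotopy identity in degree one. -/

section Laplacian

variable {N : ℕ} {R : Finset (V N)}

theorem semilinear_map_apply {E : Type*} [AddCommGroup E] [Module ℂ E]
    (f : V N →ₛₗ[Complex.ofRealHom] E) (T : Module.End ℝ (V N)) (x : V N) :
    f (T x) = ∑ i, ((x i : ℝ) : ℂ) • f (T (e i)) := by
  conv_lhs => rw [← sum_coord x]
  simp only [map_sum, map_smul, map_smulₛₗ]
  rfl

theorem sum_adjoint {E : Type*} [AddCommGroup E] [Module ℂ E]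
    (B : V N →ₛₗ[Complex.ofRealHom] V N →ₛₗ[Complex.ofRealHom] E) {S T : Module.End ℝ (V N)}
    (h : ∀ x y, ⟪S x, y⟫_ℝ = ⟪x, T y⟫_ℝ) :
    ∑ i, B (S (e i)) (e i) = ∑ i, B (e i) (T (e i)) := by
  have h1 : ∀ i, B (S (e i)) (e i) = ∑ j, ((S (e i) j : ℝ) : ℂ) • B (e j) (e i) := by
    intro i
    rw [semilinear_apply B, LinearMap.sum_apply]
    rfl
  have h2 : ∀ i, B (e i) (T (e i)) = ∑ j, ((S (e j) i : ℝ) : ℂ) • B (e i) (e j) := by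
    intro i
    rw [semilinear_apply (B (e i))]
    refine Finset.sum_congr rfl fun j _ => ?_
    rw [← inner_e (T (e i)), real_inner_comm, ← h, inner_e]
  simp only [h1, h2]
  exact Finset.sum_comm

/-- The Laplacian depends on the basis only through ∑ e_i ⊗ e_i, which isometries preserve, and
`pinv` and `proj` are conjugation equivariant. -/
theorem conjGrp_lapl {κ : ℝ} {d : Fin 2 → V N →ₛₗ[Complex.ofRealHom] Module.End ℂ (Mod R)}
    {w : W R} (hd : ∀ α x m, conjGrp w (d α x m) =
      d α ((w : V N ≃ₗᵢ[ℝ] V N) x) (conjGrp w m)) (m : Mod R) :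
    conjGrp w (lapl κ d m) = lapl κ d (conjGrp w m) := by
  have : conjGrp w ∘ₗ lapl κ d = lapl κ d ∘ₗ conjGrp w := by
    refine Mod.hom_ext fun g f => ?_
    have hterm (α : Fin 2) (i : Fin N) :
        conjGrp w (d α (pinv κ g (e i)) (Mod.single g (pderiv (α, i) f)) +
          ((κ * sgn α : ℝ) : ℂ) • d α (proj κ g (e i)) (Mod.single g (X (α.rev, i) * f))) =
        d α (pinv κ (w * g * w⁻¹) ((w : V N ≃ₗᵢ[ℝ] V N) (e i))) (Mod.single (w * g * w⁻¹)
          (pd α ((w : V N ≃ₗᵢ[ℝ] V N) (e i)) (actW w f))) +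
        ((κ * sgn α : ℝ) : ℂ) • d α (proj κ (w * g * w⁻¹) ((w : V N ≃ₗᵢ[ℝ] V N) (e i)))
          (Mod.single (w * g * w⁻¹)
            (lin α.rev ((w : V N ≃ₗᵢ[ℝ] V N) (e i)) * actW w f)) := by
      rw [map_add, LinearMap.map_smul, hd, hd, conjGrp_single, conjGrp_single, pinv_conj,
        proj_conj, ← pd_e, act_pd, map_mul, act_X]
    rw [LinearMap.comp_apply, LinearMap.comp_apply, conjGrp_single, lapl_single, lapl_single,
      map_sum]
    have hsum (α : Fin 2) := map_sum (conjGrp w) (fun i => d α (pinv κ g (e i))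
      (Mod.single g (pderiv (α, i) f)) + ((κ * sgn α : ℝ) : ℂ) •
        d α (proj κ g (e i)) (Mod.single g (X (α.rev, i) * f))) Finset.univ
    refine (Finset.sum_congr rfl fun α _ =>
      (hsum α).trans (Finset.sum_congr rfl fun i _ => hterm α i)).trans ?_
    refine Finset.sum_congr rfl fun α _ => ?_
    rw [Finset.sum_add_distrib, Finset.sum_add_distrib]
    refine congrArg₂ (· + ·) ?_ ?_
    · let B : V N →ₛₗ[Complex.ofRealHom] V N →ₛₗ[Complex.ofRealHom] Mod R :=
        LinearMap.mk₂'ₛₗ _ _ (fun x y => d α (pinv κ (w * g * w⁻¹) x)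
            (Mod.single (w * g * w⁻¹) (pd α y (actW w f))))
          (by intros; simp only [map_add, LinearMap.add_apply])
          (by intros; simp only [map_smul, map_smulₛₗ, LinearMap.smul_apply])
          (by intros; simp only [map_add, LinearMap.add_apply])
          (by intros; simp only [map_smul, map_smulₛₗ, LinearMap.smul_apply])
      have := sum_isometry B (w : V N ≃ₗᵢ[ℝ] V N)
      simp only [B, LinearMap.mk₂'ₛₗ_apply, pd_e] at this
      exact this
    · let B : V N →ₛₗ[Complex.ofRealHom] V N →ₛₗ[Complex.ofRealHom] Mod R :=
        LinearMap.mk₂'ₛₗ _ _ (fun x y => ((κ * sgn α : ℝ) : ℂ) • d α (proj κ (w * g * w⁻¹) x)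
            (Mod.single (w * g * w⁻¹) (lin α.rev y * actW w f)))
          (by intros; simp only [map_add, LinearMap.add_apply, smul_add])
          (by
            intro c x y
            simp only [map_smul, map_smulₛₗ, LinearMap.smul_apply]
            rw [smul_comm])
          (by intros; simp only [map_add, add_mul, smul_add])
          (by
            intro c x y
            simp only [map_smul, map_smulₛₗ, smul_mul_assoc]
            rw [smul_comm])
      have := sum_isometry B (w : V N ≃ₗᵢ[ℝ] V N)
      simp only [B, LinearMap.mk₂'ₛₗ_apply, lin_e] at this
      exact this
  exact LinearMap.congr_fun this m

theorem shift_proj {κ : ℝ} (hκ : κ * κ = 1) (γ : Fin 2) (g : W R) (x : V N) :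
    shift κ γ g (proj κ g x) = (κ * sgn γ) • proj κ g x := by
  fin_cases γ
  · change -((g : V N ≃ₗᵢ[ℝ] V N) (proj κ g x)) = (κ * -1) • proj κ g x
    rw [apply_proj hκ, mul_neg_one, neg_smul]
  · change κ • proj κ g x = (κ * 1) • proj κ g x
    rw [mul_one]

theorem proj_shift {κ : ℝ} (hκ : κ * κ = 1) (γ : Fin 2) (g : W R) (x : V N) :
    proj κ g (shift κ γ g x) = (κ * sgn γ) • proj κ g x := by
  fin_cases γ
  · change proj κ g (-((g : V N ≃ₗᵢ[ℝ] V N) x)) = (κ * -1) • proj κ g x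
    rw [map_neg, proj_apply_map hκ, mul_neg_one, neg_smul]
  · change proj κ g (κ • x) = (κ * 1) • proj κ g x
    rw [mul_one, map_smul]

theorem sgn_mul_self {κ : ℝ} (hκ : κ * κ = 1) (γ : Fin 2) : (κ * sgn γ) * (κ * sgn γ) = 1 := by
  have h : sgn γ * sgn γ = 1 := by fin_cases γ <;> simp [sgn]
  rw [mul_mul_mul_comm, hκ, h, one_mul]

theorem sgn_mul_self' {κ : ℝ} (hκ : κ * κ = 1) (γ : Fin 2) :
    ((κ * sgn γ : ℝ) : ℂ) * ((κ * sgn γ : ℝ) : ℂ) = 1 := by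
  rw [← Complex.ofReal_mul, sgn_mul_self hκ, Complex.ofReal_one]

/-- The second order part of the Laplacian for zero parameters. -/
noncomputable def secondOrder (κ : ℝ) (g : W R) : Pol N →ₗ[ℂ] Pol N :=
  ∑ α : Fin 2, ∑ i, pd α.rev (shift κ α g (pinv κ g (e i))) ∘ₗ (pderiv (α, i)).toLinearMap

theorem secondOrder_apply (κ : ℝ) (g : W R) (f : Pol N) : secondOrder κ g f =
    ∑ α : Fin 2, ∑ i, pd α.rev (shift κ α g (pinv κ g (e i))) (pderiv (α, i) f) := by
  simp only [secondOrder, LinearMap.sum_apply, LinearMap.comp_apply]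
  rfl

/-- The Laplacian for zero parameters. -/
theorem lapl_weylOp_single (hR : IsRootSystem R) {κ : ℝ} (hκ : κ * κ = 1) (g : W R)
    (f : Pol N) : lapl κ (weylOp R κ) (Mod.single g f) =
      Mod.single g ((∑ p, X p * pderiv p f) + (2 * eigenDim κ g : ℂ) • f +
        secondOrder κ g f) := by
  have h1 (α : Fin 2) (i : Fin N) : weylPoly κ α (pinv κ g (e i)) g (pderiv (α, i) f) =
      X (α, i) * pderiv (α, i) f - lin α (proj κ g (e i)) * pd α (e i) f +
        pd α.rev (shift κ α g (pinv κ g (e i))) (pderiv (α, i) f) := by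
    rw [weylPoly_apply, sub_pinv hR hκ, map_sub, lin_e, sub_mul, pd_e]
  have h2 (α : Fin 2) (i : Fin N) : ((κ * sgn α : ℝ) : ℂ) •
      weylPoly κ α (proj κ g (e i)) g (X (α.rev, i) * f) =
      ((proj κ g (e i) i : ℝ) : ℂ) • f + lin α.rev (e i) * pd α.rev (proj κ g (e i)) f := by
    rw [weylPoly_apply, apply_proj hκ, sub_self, map_zero, zero_mul, zero_add, shift_proj hκ,
      map_smulₛₗ, LinearMap.smul_apply, Complex.ofRealHom_eq_coe, smul_smul, sgn_mul_self' hκ,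
      one_smul, pd_mul, pd_X, if_pos rfl, smul_eq_C_mul, lin_e]
  -- By self-adjointness of the projection, the Euler terms missing along the eigenspace are exactly
  -- those restored by the second half of the homotopy, with the two kinds of letters exchanged. The
  -- derivative of the multiplied letter leaves tr `proj` = E(g) for each kind.
  have h3 (α : Fin 2) : ∑ i, lin α (proj κ g (e i)) * pd α (e i) f =
      ∑ i, lin α (e i) * pd α (proj κ g (e i)) f := by
    let B : V N →ₛₗ[Complex.ofRealHom] V N →ₛₗ[Complex.ofRealHom] Pol N :=
        LinearMap.mk₂'ₛₗ _ _ (fun x y => lin α x * pd α y f)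
          (by intros; simp only [map_add, add_mul])
          (by intros; simp only [map_smulₛₗ, smul_mul_assoc])
          (by intros; simp only [map_add, LinearMap.add_apply, mul_add])
          (by intros; simp only [map_smulₛₗ, LinearMap.smul_apply, mul_smul_comm])
    exact sum_adjoint B (inner_proj hR hκ g)
  have h4 : ∑ α : Fin 2, ∑ i, lin α.rev (e i) * pd α.rev (proj κ g (e i)) f =
      ∑ α : Fin 2, ∑ i, lin α (e i) * pd α (proj κ g (e i)) f :=
    Equiv.sum_comp Fin.revPerm fun α => ∑ i, lin α (e i) * pd α (proj κ g (e i)) f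
  have h5 : ∑ _α : Fin 2, ∑ i, ((proj κ g (e i) i : ℝ) : ℂ) • f =
      (2 * eigenDim κ g : ℂ) • f := by
    have h := trace_proj hR hκ g
    rw [Finset.sum_const, ← Finset.sum_smul, ← Complex.ofReal_sum, h, Finset.card_univ,
      Fintype.card_fin, ← Nat.cast_smul_eq_nsmul ℂ, smul_smul]
    simp
  have h6 (α : Fin 2) (i : Fin N) : weylOp R κ α (pinv κ g (e i))
        (Mod.single g (pderiv (α, i) f)) + ((κ * sgn α : ℝ) : ℂ) •
          weylOp R κ α (proj κ g (e i)) (Mod.single g (X (α.rev, i) * f)) =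
      Mod.single g ((X (α, i) * pderiv (α, i) f - lin α (proj κ g (e i)) * pd α (e i) f +
        pd α.rev (shift κ α g (pinv κ g (e i))) (pderiv (α, i) f)) +
        (((proj κ g (e i) i : ℝ) : ℂ) • f +
          lin α.rev (e i) * pd α.rev (proj κ g (e i)) f)) := by
    rw [weylOp_single, weylOp_single, h1, ← LinearMap.map_smul, h2, ← map_add]
  rw [lapl_single, secondOrder_apply, Fintype.sum_prod_type]
  simp only [h6]
  simp only [← map_sum (Mod.single g)]
  congr 1
  simp only [Finset.sum_add_distrib, Finset.sum_sub_distrib, h3, h4, h5]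
  abel

theorem pderiv_weylPoly (κ : ℝ) (α γ : Fin 2) (i : Fin N) (x : V N) (g : W R) (f : Pol N) :
    pderiv (α, i) (weylPoly κ γ x g f) = weylPoly κ γ x g (pderiv (α, i) f) +
      if α = γ then ((((g : V N ≃ₗᵢ[ℝ] V N) x - κ • x) i : ℝ) : ℂ) • f else 0 := by
  simp only [← pd_e, weylPoly_apply, map_add, pd_mul, pd_lin, pd_comm α]
  rw [real_inner_comm, inner_e]
  split_ifs
  · rw [smul_eq_C_mul]
    ring
  · ring

theorem X_mul_weylPoly (κ : ℝ) (α γ : Fin 2) (i : Fin N) (x : V N) (g : W R) (f : Pol N) :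
    X (α.rev, i) * weylPoly κ γ x g f = weylPoly κ γ x g (X (α.rev, i) * f) -
      if α = γ then ((shift κ γ g x i : ℝ) : ℂ) • f else 0 := by
  simp only [weylPoly_apply, pd_mul, pd_X, Fin.rev_inj, eq_comm (a := γ)]
  split_ifs
  · rw [smul_eq_C_mul]
    ring
  · ring

/-- The homotopy identity in degree one, seen through an invariant functional vanishing on the
image of the Laplacian. -/
theorem homotopy_identity (hR : IsRootSystem R) {ν : R → ℂ} (hν : IsInvariantParam ν) {κ : ℝ}
    (hκ : κ * κ = 1) {t : Mod R →ₗ[ℂ] ℂ} (ht : ∀ w m, t (conjGrp w m) = t m)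
    (hl : ∀ m, t (lapl κ (commOp ν κ) m) = 0) (γ : Fin 2) (x : V N) (g : W R) (f : Pol N) :
    t (commOp ν κ γ x (lapl κ (commOp ν κ) (Mod.single g f))) +
      t (commOp ν κ γ (x - proj κ g x - proj κ g x) (Mod.single g f)) =
    ∑ α, ∑ i, (t (commOp ν κ α (pinv κ g (e i))
        (reflOp ν κ γ x (Mod.single g (pderiv (α, i) f)))) +
      ((κ * sgn α : ℝ) : ℂ) * t (commOp ν κ α (proj κ g (e i))
        (reflOp ν κ γ x (Mod.single g (X (α.rev, i) * f))))) := by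
  -- The Laplacian is applied to `weylOp` of `single g f`, and x_γ is moved outwards through the
  -- homotopy. The outer operators commute under t; the corrections come from `pderiv` and
  -- multiplication by X acting on the form and the derivative in `weylPoly`, and from writing
  -- `weylOp` as `commOp - reflOp`.
  have h0 := hl (Mod.single g (weylPoly κ γ x g f))
  have hw (h : Pol N) : Mod.single g (weylPoly κ γ x g h) =
      commOp ν κ γ x (Mod.single g h) - reflOp ν κ γ x (Mod.single g h) := by
    rw [commOp_apply, add_sub_cancel_right, weylOp_single]
  have h1 (α : Fin 2) (i : Fin N) :
      t (commOp ν κ α (pinv κ g (e i)) (Mod.single g (pderiv (α, i) (weylPoly κ γ x g f)))) =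
      t (commOp ν κ γ x (commOp ν κ α (pinv κ g (e i)) (Mod.single g (pderiv (α, i) f)))) -
      t (commOp ν κ α (pinv κ g (e i)) (reflOp ν κ γ x (Mod.single g (pderiv (α, i) f)))) +
      if α = γ then ((((g : V N ≃ₗᵢ[ℝ] V N) x - κ • x) i : ℝ) : ℂ) *
        t (commOp ν κ γ (pinv κ g (e i)) (Mod.single g f)) else 0 := by
    rw [pderiv_weylPoly, map_add, hw, map_add, map_sub, map_add, map_sub,
      apply_commOp_commOp hR hν hκ ht α γ]
    split_ifs with h
    · rw [h, map_smul, map_smul, map_smul, smul_eq_mul]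
    · rw [map_zero, map_zero, map_zero]
  have h2 (α : Fin 2) (i : Fin N) :
      t (commOp ν κ α (proj κ g (e i)) (Mod.single g (X (α.rev, i) * weylPoly κ γ x g f))) =
      t (commOp ν κ γ x (commOp ν κ α (proj κ g (e i)) (Mod.single g (X (α.rev, i) * f)))) -
      t (commOp ν κ α (proj κ g (e i)) (reflOp ν κ γ x (Mod.single g (X (α.rev, i) * f)))) -
      if α = γ then ((shift κ γ g x i : ℝ) : ℂ) *
        t (commOp ν κ γ (proj κ g (e i)) (Mod.single g f)) else 0 := by
    rw [X_mul_weylPoly, map_sub, hw, map_sub, map_sub, map_sub, map_sub,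
      apply_commOp_commOp hR hν hκ ht α γ]
    split_ifs with h
    · rw [h, map_smul, map_smul, map_smul, smul_eq_mul]
    · rw [map_zero, map_zero, map_zero]
  -- These corrections assemble to `pinv` of (g - κ)x, that is x - `proj x`. Those in `h4` give
  -- `proj x` once more, whence the reflected vector x - 2 `proj x`.
  have h3 : ∑ α, ∑ i, (if α = γ then ((((g : V N ≃ₗᵢ[ℝ] V N) x - κ • x) i : ℝ) : ℂ) *
        t (commOp ν κ γ (pinv κ g (e i)) (Mod.single g f)) else 0) =
      t (commOp ν κ γ (x - proj κ g x) (Mod.single g f)) := by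
    rw [Finset.sum_eq_single γ (fun α _ hα => by simp [hα]) (by simp), ← pinv_sub hR hκ,
      semilinear_map_apply, LinearMap.sum_apply, map_sum]
    refine Finset.sum_congr rfl fun i _ => ?_
    rw [if_pos rfl, LinearMap.smul_apply, map_smul, smul_eq_mul]
  have h4 : ∑ α, ∑ i, ((κ * sgn α : ℝ) : ℂ) * (if α = γ then ((shift κ γ g x i : ℝ) : ℂ) *
        t (commOp ν κ γ (proj κ g (e i)) (Mod.single g f)) else 0) =
      t (commOp ν κ γ (proj κ g x) (Mod.single g f)) := by
    have h5 : proj κ g x = (κ * sgn γ) • proj κ g (shift κ γ g x) := by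
      rw [proj_shift hκ, smul_smul, sgn_mul_self hκ, one_smul]
    rw [Finset.sum_eq_single γ (fun α _ hα => by simp [hα]) (by simp), h5, map_smulₛₗ,
      semilinear_map_apply, LinearMap.smul_apply, LinearMap.sum_apply, map_smul, map_sum,
      Finset.smul_sum]
    refine Finset.sum_congr rfl fun i _ => ?_
    rw [if_pos rfl, LinearMap.smul_apply, map_smul, smul_eq_mul]
    rfl
  rw [map_sub (commOp ν κ γ) (x - proj κ g x), LinearMap.sub_apply, map_sub t, ← h3, ← h4]
  rw [lapl_single] at h0 ⊢
  simp only [map_sum, map_add, map_smul, smul_eq_mul, h1, h2, mul_sub,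
    Finset.sum_add_distrib, Finset.sum_sub_distrib] at h0 ⊢
  linear_combination h0

end Laplacian

end Calogero

namespace Calogero
open scoped InnerProductSpace
open MvPolynomial

/-! ### Functionals killing a triangular operator. -/

section Triangular

variable {ι M P : Type*} [AddCommGroup M] [Module ℂ M] [AddCommGroup P] [Module ℂ P]

/-- The span of the basis vectors of weight less than `n`. -/
def lowerSpan (b : Module.Basis ι ℂ M) (wt : ι → ℕ) (n : ℕ) : Submodule ℂ M :=
  Submodule.span ℂ (b '' {i | wt i < n})

theorem eq_of_mem_lowerSpan {b : Module.Basis ι ℂ M} {wt : ι → ℕ} {n : ℕ} {S T : M →ₗ[ℂ] P}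
    (h : ∀ i, wt i < n → S (b i) = T (b i)) {m : M} (hm : m ∈ lowerSpan b wt n) : S m = T m := by
  refine LinearMap.eqOn_span (s := b '' {i | wt i < n}) ?_ hm
  rintro _ ⟨i, hi, rfl⟩
  exact h i hi

/-- A functional killing a triangular family of operators is determined by its values on the
kernel of the diagonal part. -/
theorem eq_zero_of_triangular {b : Module.Basis ι ℂ M} {wt : ι → ℕ} {lam : ι → ℂ}
    {L₀ L₁ : M →ₗ[ℂ] M} (h₀ : ∀ i, L₀ (b i) - lam i • b i ∈ lowerSpan b wt (wt i))
    (h₁ : ∀ i, L₁ (b i) ∈ lowerSpan b wt (wt i)) (ξ : P →ₗ[ℂ] P) {T : M →ₗ[ℂ] P}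
    (hT : ∀ m, T (L₀ m) + ξ (T (L₁ m)) = 0) (h : ∀ i, lam i = 0 → T (b i) = 0) : T = 0 := by
  refine b.ext fun i => ?_
  induction hn : wt i using Nat.strong_induction_on generalizing i with
  | _ n ih =>
    -- The second operator has no diagonal part, so `ξ` never meets the value at i, and no
    -- assumption on `ξ` is required.
    by_cases hi : lam i = 0
    · exact h i hi
    · have hlow : ∀ j, wt j < wt i → T (b j) = (0 : M →ₗ[ℂ] P) (b j) :=
        fun j hj => ih (wt j) (hn ▸ hj) j rfl
      have e0 := eq_of_mem_lowerSpan hlow (h₀ i)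
      have e1 := eq_of_mem_lowerSpan hlow (h₁ i)
      have e := hT (b i)
      rw [e1, LinearMap.zero_apply, map_zero, add_zero] at e
      rw [map_sub, e, map_smul, zero_sub, LinearMap.zero_apply, neg_eq_zero] at e0
      exact (smul_eq_zero.1 e0).resolve_left hi

/-- A functional killing a triangular family of operators can be prescribed on the kernel of the
diagonal part. -/
theorem exists_of_triangular {b : Module.Basis ι ℂ M} {wt : ι → ℕ} {lam : ι → ℂ}
    {L₀ L₁ : M →ₗ[ℂ] M} (h₀ : ∀ i, L₀ (b i) - lam i • b i ∈ lowerSpan b wt (wt i))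
    (h₁ : ∀ i, L₁ (b i) ∈ lowerSpan b wt (wt i))
    (hz : ∀ i, lam i = 0 → L₀ (b i) = 0 ∧ L₁ (b i) = 0) (ξ : P →ₗ[ℂ] P) (φ : ι → P) :
    ∃ T : M →ₗ[ℂ] P, (∀ m, T (L₀ m) + ξ (T (L₁ m)) = 0) ∧ ∀ i, lam i = 0 → T (b i) = φ i := by
  classical
  -- Values are defined by recursion on the weight: where the diagonal entry is nonzero, the
  -- equation at b i is solved for the value at b i.
  have wf : WellFounded fun i j : ι => wt i < wt j := (measure wt).wf
  let S (i : ι) (r : (j : ι) → wt j < wt i → P) : M →ₗ[ℂ] P :=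
    b.constr ℂ fun j => if hj : wt j < wt i then r j hj else 0
  let step (i : ι) (r : (j : ι) → wt j < wt i → P) : P :=
    if lam i = 0 then φ i else
      -(lam i)⁻¹ • (S i r (L₀ (b i) - lam i • b i) + ξ (S i r (L₁ (b i))))
  let τ : ι → P := wf.fix step
  have hτ (i : ι) : τ i = step i fun j _ => τ j := wf.fix_eq step i
  let T : M →ₗ[ℂ] P := b.constr ℂ τ
  have hTb (i : ι) : T (b i) = τ i := b.constr_basis ℂ τ i
  have hS (i : ι) {m : M} (hm : m ∈ lowerSpan b wt (wt i)) : S i (fun j _ => τ j) m = T m := by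
    refine eq_of_mem_lowerSpan (fun j hj => ?_) hm
    rw [hTb, b.constr_basis, dif_pos hj]
  refine ⟨T, fun m => ?_, fun i hi => ?_⟩
  · have : T ∘ₗ L₀ + ξ ∘ₗ T ∘ₗ L₁ = 0 := by
      refine b.ext fun i => ?_
      simp only [LinearMap.add_apply, LinearMap.comp_apply, LinearMap.zero_apply]
      by_cases hi : lam i = 0
      · rw [(hz i hi).1, (hz i hi).2, map_zero, map_zero, add_zero]
      · have h1 : T (b i) = -(lam i)⁻¹ • (T (L₀ (b i) - lam i • b i) + ξ (T (L₁ (b i)))) := by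
          rw [hTb, hτ]
          simp only [step, if_neg hi]
          rw [hS i (h₀ i), hS i (h₁ i)]
        have h2 : lam i • T (b i) = -(T (L₀ (b i) - lam i • b i) + ξ (T (L₁ (b i)))) := by
          rw [h1, smul_smul, mul_neg, mul_inv_cancel₀ hi, neg_smul, one_smul]
        rw [map_sub, map_smul] at h2
        rw [← sub_eq_zero.2 h2]
        abel
    exact LinearMap.congr_fun this m
  · rw [hTb, hτ]
    exact if_pos hi

end Triangular

/-! ### Degrees of the operators on polynomials. -/

section Degree

variable {N : ℕ} {R : Finset (V N)}

theorem lin_isHomogeneous (α : Fin 2) (x : V N) : (lin α x).IsHomogeneous 1 := by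
  rw [lin, comb_apply]
  refine IsHomogeneous.sum _ _ _ fun i _ => ?_
  rw [smul_eq_C_mul]
  exact (isHomogeneous_X ℂ _).C_mul _

theorem act_isHomogeneous (A : Fin 2 → V N ≃ₗᵢ[ℝ] V N) {f : Pol N} {n : ℕ}
    (hf : f.IsHomogeneous n) : (act A f).IsHomogeneous n := by
  have := hf.aeval (fun p : Fin 2 × Fin N => lin p.1 (A p.1 (e p.2)))
    (fun p => lin_isHomogeneous _ _)
  rwa [one_mul] at this

/-- Division by a linear form lowers the degree by one. The nonvanishing hypothesis is needed since
the zero polynomial has `totalDegree` 0. -/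
theorem totalDegree_dd_lt (α : Fin 2) {v : V N} (hv : v ≠ 0) {f : Pol N} {n : ℕ}
    (hf : f.IsHomogeneous n) (h : dd α v f ≠ 0) : (dd α v f).totalDegree + 1 ≤ n := by
  have hl : (2 * lin α v : Pol N) ≠ 0 := mul_ne_zero two_ne_zero (lin_ne_zero hv)
  have h1 : (2 * lin α v : Pol N).IsHomogeneous 1 := by
    rw [two_mul]
    exact (lin_isHomogeneous α v).add (lin_isHomogeneous α v)
  have h2 := totalDegree_mul_of_isDomain hl h
  rw [lin_mul_dd α hv, h1.totalDegree hl] at h2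
  have h3 := (hf.sub (act_isHomogeneous (pr α v) hf)).totalDegree_le
  omega

theorem totalDegree_dunkl_lt (γ : Fin 2) {v : V N} (hv : v ≠ 0) {f : Pol N} {n : ℕ}
    (hf : f.IsHomogeneous n) (h : dunkl γ v f ≠ 0) : (dunkl γ v f).totalDegree + 1 ≤ n := by
  fin_cases γ
  · exact totalDegree_dd_lt 1 hv hf h
  · exact totalDegree_dd_lt 0 hv (act_isHomogeneous _ hf) h

theorem pd_isHomogeneous (α : Fin 2) (x : V N) {f : Pol N} {n : ℕ} (hf : f.IsHomogeneous n) :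
    (pd α x f).IsHomogeneous (n - 1) := by
  rw [pd_apply]
  refine IsHomogeneous.sum _ _ _ fun i _ => ?_
  rw [smul_eq_C_mul]
  exact hf.pderiv.C_mul _

theorem secondOrder_isHomogeneous (κ : ℝ) (g : W R) {f : Pol N} {n : ℕ}
    (hf : f.IsHomogeneous n) : (secondOrder κ g f).IsHomogeneous (n - 1 - 1) := by
  rw [secondOrder_apply]
  exact IsHomogeneous.sum _ _ _ fun α _ => IsHomogeneous.sum _ _ _ fun i _ =>
    pd_isHomogeneous _ _ hf.pderiv

theorem secondOrder_C (κ : ℝ) (g : W R) (c : ℂ) : secondOrder κ g (C c) = 0 := by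
  simp only [secondOrder_apply, pderiv_C, map_zero, Finset.sum_const_zero]

theorem lapl_weylOp_of_isHomogeneous (hR : IsRootSystem R) {κ : ℝ} (hκ : κ * κ = 1) (g : W R)
    {f : Pol N} {n : ℕ} (hf : f.IsHomogeneous n) : lapl κ (weylOp R κ) (Mod.single g f) =
      (n + 2 * eigenDim κ g : ℂ) • Mod.single g f + Mod.single g (secondOrder κ g f) := by
  rw [lapl_weylOp_single hR hκ, hf.sum_X_mul_pderiv, ← Nat.cast_smul_eq_nsmul ℂ, ← add_smul,
    map_add, map_smul]

end Degree

/-! ### Triangularity of the Laplacian with respect to the weight. -/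

section Weights

variable {N : ℕ} {R : Finset (V N)}

/-- The basis of monomials times group elements. -/
noncomputable def modBasis (R : Finset (V N)) :
    Module.Basis (Σ _ : W R, Fin 2 × Fin N →₀ ℕ) ℂ (Mod R) :=
  (Finsupp.basis fun _ : W R => basisMonomials (Fin 2 × Fin N) ℂ :
    Module.Basis (Σ _ : W R, Fin 2 × Fin N →₀ ℕ) ℂ (W R →₀ Pol N))

theorem modBasis_apply (i : Σ _ : W R, Fin 2 × Fin N →₀ ℕ) :
    modBasis R i = Mod.single i.1 (monomial i.2 1) := by
  have : (Finsupp.basis fun _ : W R => basisMonomials (Fin 2 × Fin N) ℂ) i =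
      Finsupp.single i.1 (monomial i.2 1) := by
    rw [Finsupp.coe_basis, coe_basisMonomials]
  exact this

/-- The weight of a basis vector. -/
noncomputable def weight (κ : ℝ) (i : Σ _ : W R, Fin 2 × Fin N →₀ ℕ) : ℕ :=
  i.2.degree + eigenDim κ i.1

/-- The diagonal entries of the Laplacian. -/
noncomputable def laplDiag (κ : ℝ) (i : Σ _ : W R, Fin 2 × Fin N →₀ ℕ) : ℂ :=
  i.2.degree + 2 * eigenDim κ i.1

theorem laplDiag_eq_zero {κ : ℝ} {i : Σ _ : W R, Fin 2 × Fin N →₀ ℕ} :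
    laplDiag κ i = 0 ↔ i.2 = 0 ∧ eigenDim κ i.1 = 0 := by
  have h : laplDiag κ i = ((i.2.degree + 2 * eigenDim κ i.1 : ℕ) : ℂ) := by
    rw [laplDiag]
    push_cast
    rfl
  rw [h, Nat.cast_eq_zero, Nat.add_eq_zero_iff, Finsupp.degree_eq_zero_iff, mul_eq_zero]
  simp

/-- The elements of weight less than `n`. -/
noncomputable abbrev lower (κ : ℝ) (n : ℕ) : Submodule ℂ (Mod R) :=
  lowerSpan (modBasis R) (weight κ) n

theorem single_mem_lower {κ : ℝ} {n : ℕ} {g : W R} {f : Pol N}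
    (h : f ≠ 0 → f.totalDegree + eigenDim κ g < n) : Mod.single g f ∈ lower κ n := by
  by_cases hf : f = 0
  · rw [hf, map_zero]
    exact Submodule.zero_mem _
  · rw [f.as_sum, map_sum]
    refine Submodule.sum_mem _ fun m hm => ?_
    have h1 : Mod.single g (monomial m (coeff m f)) = coeff m f • modBasis R ⟨g, m⟩ := by
      rw [modBasis_apply, ← map_smul, smul_monomial, smul_eq_mul, mul_one]
    rw [h1]
    refine Submodule.smul_mem _ _ (Submodule.subset_span ⟨_, ?_, rfl⟩)
    have h2 : m.degree ≤ f.totalDegree := le_totalDegree hm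
    have h3 := h hf
    change m.degree + eigenDim κ g < n
    omega

theorem inner_shift_proj {κ : ℝ} (hκ : κ * κ = 1) (γ : Fin 2) (g : W R) (x v : V N)
    (h : ⟪shift κ γ g (proj κ g x), v⟫_ℝ ≠ 0) : ⟪proj κ g x, v⟫_ℝ ≠ 0 := by
  rw [shift_proj hκ, real_inner_smul_left] at h
  exact right_ne_zero_of_mul h

theorem reflOp_single_mem_lower (ν : R → ℂ) {κ : ℝ} {γ : Fin 2} {x : V N}
    {g : W R} {f : Pol N} {n : ℕ} (h : ∀ v : R, ⟪shift κ γ g x, (v : V N)⟫_ℝ ≠ 0 →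
      dunkl γ (v : V N) f ≠ 0 →
      (dunkl γ (v : V N) f).totalDegree + eigenDim κ (reflW v * g) < n) :
    reflOp ν κ γ x (Mod.single g f) ∈ lower κ n := by
  rw [reflOp_single]
  refine Submodule.sum_mem _ fun v _ => ?_
  by_cases hv : ⟪shift κ γ g x, (v : V N)⟫_ℝ = 0
  · rw [hv, Complex.ofReal_zero, mul_zero, zero_smul]
    exact Submodule.zero_mem _
  · exact Submodule.smul_mem _ _ (single_mem_lower (h v hv))

/-- In the `pinv` terms the derivative and the divided difference lower the degree by at least two,
while E rises by at most one. In the `proj` terms the degree does not rise, and a nonzero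
coefficient means that an eigenvector is not orthogonal to v, so E drops. -/
theorem lapl_reflOp_mem_lower (hR : IsRootSystem R) (ν : R → ℂ) {κ : ℝ} (hκ : κ * κ = 1)
    {g : W R} {f : Pol N} {n : ℕ} (hf : f.IsHomogeneous n) :
    lapl κ (reflOp ν κ) (Mod.single g f) ∈ lower κ (n + eigenDim κ g) := by
  rw [lapl_single]
  refine Submodule.sum_mem _ fun α _ => Submodule.sum_mem _ fun i _ =>
    Submodule.add_mem _ ?_ (Submodule.smul_mem _ _ ?_)
  · refine reflOp_single_mem_lower ν fun v _ h => ?_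
    have h1 := totalDegree_dunkl_lt α (hR.ne_zero v) hf.pderiv h
    have h2 := eigenDim_reflW_mul_le κ v g
    omega
  · refine reflOp_single_mem_lower ν fun v hv h => ?_
    have h1 := totalDegree_dunkl_lt α (hR.ne_zero v) ((isHomogeneous_X ℂ (α.rev, i)).mul hf) h
    have h2 := eigenDim_reflW_mul_lt hκ (proj_mem hκ g (e i)) (inner_shift_proj hκ _ _ _ _ hv)
    omega

theorem lapl_weylOp_sub_mem_lower (hR : IsRootSystem R) {κ : ℝ} (hκ : κ * κ = 1)
    (i : Σ _ : W R, Fin 2 × Fin N →₀ ℕ) :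
    lapl κ (weylOp R κ) (modBasis R i) - laplDiag κ i • modBasis R i ∈
      lower κ (weight κ i) := by
  have hf : (monomial i.2 (1 : ℂ)).IsHomogeneous i.2.degree := isHomogeneous_monomial 1 rfl
  rw [modBasis_apply, lapl_weylOp_of_isHomogeneous hR hκ _ hf, laplDiag, add_sub_cancel_left]
  refine single_mem_lower fun h => ?_
  have h1 := (secondOrder_isHomogeneous κ i.1 hf).totalDegree_le
  -- In degree 0 the truncated difference n - 1 - 1 is not smaller than n, but there the
  -- second-order part vanishes.
  have h2 : i.2.degree ≠ 0 := by
    intro h2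
    rw [Finsupp.degree_eq_zero_iff] at h2
    rw [h2] at h
    exact h (secondOrder_C κ i.1 1)
  rw [weight]
  omega

theorem proj_eq_zero {κ : ℝ} (hκ : κ * κ = 1) {g : W R} (hg : eigenDim κ g = 0) (x : V N) :
    proj κ g x = 0 := by
  have h := proj_mem hκ g x
  rwa [Submodule.finrank_eq_zero.1 hg, Submodule.mem_bot] at h

theorem lapl_single_C {κ : ℝ} (hκ : κ * κ = 1)
    (d : Fin 2 → V N →ₛₗ[Complex.ofRealHom] Module.End ℂ (Mod R)) {g : W R}
    (hg : eigenDim κ g = 0) (c : ℂ) : lapl κ d (Mod.single g (C c)) = 0 := by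
  rw [lapl_single]
  refine Finset.sum_eq_zero fun α _ => Finset.sum_eq_zero fun i _ => ?_
  rw [proj_eq_zero hκ hg, pderiv_C, map_zero, map_zero, map_zero, LinearMap.zero_apply, smul_zero,
    add_zero]

theorem lapl_modBasis {κ : ℝ} (hκ : κ * κ = 1)
    (d : Fin 2 → V N →ₛₗ[Complex.ofRealHom] Module.End ℂ (Mod R))
    {i : Σ _ : W R, Fin 2 × Fin N →₀ ℕ} (hi : laplDiag κ i = 0) :
    lapl κ d (modBasis R i) = 0 := by
  rw [laplDiag_eq_zero] at hi
  rw [modBasis_apply, hi.1]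
  exact lapl_single_C hκ d hi.2 1

end Weights

end Calogero

namespace Calogero
open scoped InnerProductSpace
open MvPolynomial

/-! ### Existence and uniqueness of twisted traces by deformation in the parameters. -/

section Deformation

variable {N : ℕ} {R : Finset (V N)}

theorem Mod.induction {p : Mod R → Prop} (zero : p 0) (add : ∀ m m', p m → p m' → p (m + m'))
    (single : ∀ g f, p (Mod.single g f)) (m : Mod R) : p m :=
  Finsupp.induction_linear (M := Pol N) (motive := p) m zero add single

/-- Functionals killing the Laplacian are determined by their values on the group elements
without eigenvalue `κ`. -/
theorem eq_zero_of_lapl (hR : IsRootSystem R) {ν : R → ℂ} {κ : ℝ} (hκ : κ * κ = 1)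
    {P : Type*} [AddCommGroup P] [Module ℂ P] (ξ : P →ₗ[ℂ] P) {T : Mod R →ₗ[ℂ] P}
    (hT : ∀ m, T (lapl κ (weylOp R κ) m) + ξ (T (lapl κ (reflOp ν κ) m)) = 0)
    (h : ∀ g, eigenDim κ g = 0 → T (Mod.single g 1) = 0) : T = 0 := by
  refine eq_zero_of_triangular (lapl_weylOp_sub_mem_lower hR hκ) (fun i => ?_) ξ hT fun i hi => ?_
  · rw [modBasis_apply]
    exact lapl_reflOp_mem_lower hR ν hκ (isHomogeneous_monomial 1 rfl)
  · rw [laplDiag_eq_zero] at hi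
    rw [modBasis_apply, hi.1]
    exact h _ hi.2

/-- For parameters depending linearly on a variable, a functional killing the Laplacian with
prescribed values on the group elements without eigenvalue `κ`. -/
theorem exists_apply_lapl_eq_zero (hR : IsRootSystem R) {ν : R → ℂ} (hν : IsInvariantParam ν)
    {κ : ℝ} (hκ : κ * κ = 1) {φ : W R → ℂ} (hφ : ∀ w g, φ (w * g * w⁻¹) = φ g) :
    ∃ T : Mod R →ₗ[ℂ] Polynomial ℂ,
      (∀ m, T (lapl κ (weylOp R κ) m) + Polynomial.X * T (lapl κ (reflOp ν κ) m) = 0) ∧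
      (∀ w m, T (conjGrp w m) = T m) ∧
      ∀ g, eigenDim κ g = 0 → T (Mod.single g 1) = Polynomial.C (φ g) := by
  obtain ⟨T, hT, hT1⟩ := exists_of_triangular (lapl_weylOp_sub_mem_lower hR hκ) (fun i => by
    rw [modBasis_apply]
    exact lapl_reflOp_mem_lower hR ν hκ (isHomogeneous_monomial 1 rfl))
    (fun i hi => ⟨lapl_modBasis hκ (weylOp R κ) hi, lapl_modBasis hκ (reflOp ν κ) hi⟩)
    (LinearMap.mulLeft ℂ Polynomial.X) fun i => Polynomial.C (φ i.1)
  have h1 : ∀ g, eigenDim κ g = 0 → T (Mod.single g 1) = Polynomial.C (φ g) := by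
    intro g hg
    have := hT1 ⟨g, 0⟩ (laplDiag_eq_zero.2 ⟨rfl, hg⟩)
    rw [modBasis_apply] at this
    exact this
  refine ⟨T, hT, fun w m => ?_, h1⟩
  -- Invariance comes from uniqueness: the conjugate of T solves the same equation with the same
  -- values, as φ is a class function.
  have : T ∘ₗ conjGrp w - T = 0 := by
    refine eq_zero_of_lapl hR hκ (LinearMap.mulLeft ℂ Polynomial.X) (ν := ν) (fun m => ?_)
      fun g hg => ?_
    · have e1 := hT (conjGrp w m)
      have e2 := hT m
      rw [← conjGrp_lapl (conjGrp_weylOp hR κ · w),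
        ← conjGrp_lapl (conjGrp_reflOp hR hν κ · w)] at e1
      simp only [LinearMap.sub_apply, LinearMap.comp_apply, map_sub]
      rw [sub_add_sub_comm, e2, sub_zero]
      exact e1
    · rw [LinearMap.sub_apply, LinearMap.comp_apply, conjGrp_single, map_one, h1 _ hg,
        h1 _ ((eigenDim_conj κ w g).trans hg), hφ, sub_self]
  exact sub_eq_zero.1 (LinearMap.congr_fun this m)

/-- The defect of `T` from being a twisted trace, for parameters depending linearly on a
variable. -/
noncomputable def defect (T : Mod R →ₗ[ℂ] Polynomial ℂ) (ν : R → ℂ) (κ : ℝ) (γ : Fin 2)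
    (x : V N) : Mod R →ₗ[ℂ] Polynomial ℂ :=
  T ∘ₗ weylOp R κ γ x + LinearMap.mulLeft ℂ Polynomial.X ∘ₗ T ∘ₗ reflOp ν κ γ x

theorem defect_apply (T : Mod R →ₗ[ℂ] Polynomial ℂ) (ν : R → ℂ) (κ : ℝ) (γ : Fin 2)
    (x : V N) (m : Mod R) : defect T ν κ γ x m =
      T (weylOp R κ γ x m) + Polynomial.X * T (reflOp ν κ γ x m) := rfl

theorem defect_add (T : Mod R →ₗ[ℂ] Polynomial ℂ) (ν : R → ℂ) (κ : ℝ) (γ : Fin 2)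
    (x y : V N) (m : Mod R) :
    defect T ν κ γ (x + y) m = defect T ν κ γ x m + defect T ν κ γ y m := by
  simp only [defect_apply, map_add, LinearMap.add_apply, mul_add]
  ring

theorem defect_neg (T : Mod R →ₗ[ℂ] Polynomial ℂ) (ν : R → ℂ) (κ : ℝ) (γ : Fin 2)
    (x : V N) (m : Mod R) : defect T ν κ γ (-x) m = -defect T ν κ γ x m := by
  simp only [defect_apply, map_neg, LinearMap.neg_apply, mul_neg]
  ring

theorem defect_zero (T : Mod R →ₗ[ℂ] Polynomial ℂ) (ν : R → ℂ) (κ : ℝ) (γ : Fin 2)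
    (m : Mod R) : defect T ν κ γ 0 m = 0 := by
  simp only [defect_apply, map_zero, LinearMap.zero_apply, mul_zero, add_zero]

theorem eval_defect (T : Mod R →ₗ[ℂ] Polynomial ℂ) (ν : R → ℂ) (κ : ℝ) (γ : Fin 2)
    (x : V N) (m : Mod R) (s : ℂ) : (defect T ν κ γ x m).eval s =
      (Polynomial.leval s ∘ₗ T) (commOp (s • ν) κ γ x m) := by
  rw [defect_apply, commOp_apply, reflOp_smul, map_add, map_smul, Polynomial.eval_add,
    Polynomial.eval_mul, Polynomial.eval_X]
  rfl

theorem defect_homotopy (hR : IsRootSystem R) {ν : R → ℂ} (hν : IsInvariantParam ν) {κ : ℝ}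
    (hκ : κ * κ = 1) {T : Mod R →ₗ[ℂ] Polynomial ℂ}
    (hl : ∀ m, T (lapl κ (weylOp R κ) m) + Polynomial.X * T (lapl κ (reflOp ν κ) m) = 0)
    (ht : ∀ w m, T (conjGrp w m) = T m) (γ : Fin 2) (x : V N) (g : W R) (f : Pol N) :
    defect T ν κ γ x (lapl κ (weylOp R κ) (Mod.single g f)) +
      Polynomial.X * defect T ν κ γ x (lapl κ (reflOp ν κ) (Mod.single g f)) +
      defect T ν κ γ (x - proj κ g x - proj κ g x) (Mod.single g f) =
    Polynomial.X * ∑ α, ∑ i, (defect T ν κ α (pinv κ g (e i))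
        (reflOp ν κ γ x (Mod.single g (pderiv (α, i) f))) +
      Polynomial.C ((κ * sgn α : ℝ) : ℂ) * defect T ν κ α (proj κ g (e i))
        (reflOp ν κ γ x (Mod.single g (X (α.rev, i) * f)))) := by
  -- At each complex number s this is `homotopy_identity` for the parameters s ν.
  refine Polynomial.funext fun s => ?_
  have h := homotopy_identity hR (isInvariantParam_smul hν s) hκ
    (t := Polynomial.leval s ∘ₗ T)
    (fun w m => by rw [LinearMap.comp_apply, LinearMap.comp_apply, ht])
    (fun m => by
      rw [lapl_commOp, lapl_reflOp_smul, map_add, map_smul]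
      have := congrArg (Polynomial.eval s) (hl m)
      rwa [Polynomial.eval_add, Polynomial.eval_mul, Polynomial.eval_X, Polynomial.eval_zero]
        at this) γ x g f
  simp only [lapl_commOp, lapl_reflOp_smul, reflOp_smul, LinearMap.map_add, LinearMap.map_smul,
    smul_eq_mul] at h
  simp only [Polynomial.eval_add, Polynomial.eval_mul, Polynomial.eval_finsetSum,
    Polynomial.eval_X, Polynomial.eval_C, eval_defect, Finset.mul_sum, mul_add]
  rw [h]
  refine Finset.sum_congr rfl fun α _ => Finset.sum_congr rfl fun i _ => ?_
  ring

/-- All parameter terms in `defect_homotopy` carry a factor X, so divisibility by X^k makes them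
divisible by X^(k+1). What remains is the ν = 0 part, treated by induction on the degree. The formal
parameter thus avoids any weight estimate for the parameter terms in degree one. -/
theorem X_pow_dvd_defect (hR : IsRootSystem R) {ν : R → ℂ} (hν : IsInvariantParam ν) {κ : ℝ}
    (hκ : κ * κ = 1) {T : Mod R →ₗ[ℂ] Polynomial ℂ}
    (hl : ∀ m, T (lapl κ (weylOp R κ) m) + Polynomial.X * T (lapl κ (reflOp ν κ) m) = 0)
    (ht : ∀ w m, T (conjGrp w m) = T m) (k : ℕ) (γ : Fin 2) (x : V N) (m : Mod R) :
    Polynomial.X ^ k ∣ defect T ν κ γ x m := by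
  induction k generalizing γ x m with
  | zero => exact one_dvd _
  | succ k ihk =>
    have hom : ∀ n : ℕ, ∀ (γ : Fin 2) (x : V N) (g : W R) (f : Pol N), f.IsHomogeneous n →
        Polynomial.X ^ (k + 1) ∣ defect T ν κ γ x (Mod.single g f) := by
      intro n
      induction n using Nat.strong_induction_on with
      | _ n ihn =>
        intro γ x g f hf
        have h2 : ∀ y, Polynomial.X ^ (k + 1) ∣
            defect T ν κ γ y (Mod.single g (secondOrder κ g f)) := by
          intro y
          -- For n = 0 the degree n - 1 - 1 is not smaller than n, so constants are treated apart.
          rcases Nat.eq_zero_or_pos n with rfl | hn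
          · rw [← totalDegree_zero_iff_isHomogeneous, totalDegree_eq_zero_iff_eq_C] at hf
            rw [hf, secondOrder_C, map_zero, map_zero]
            exact dvd_zero _
          · exact ihn (n - 1 - 1) (by omega) γ y g _ (secondOrder_isHomogeneous κ g hf)
        have h3 : ∀ y, Polynomial.X ^ (k + 1) ∣
            (n + 2 * eigenDim κ g : ℂ) • defect T ν κ γ y (Mod.single g f) +
              defect T ν κ γ (y - proj κ g y - proj κ g y) (Mod.single g f) := by
          intro y
          have h4 := defect_homotopy hR hν hκ hl ht γ y g f
          rw [lapl_weylOp_of_isHomogeneous hR hκ g hf, map_add, map_smul] at h4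
          have h5 : (n + 2 * eigenDim κ g : ℂ) • defect T ν κ γ y (Mod.single g f) +
              defect T ν κ γ (y - proj κ g y - proj κ g y) (Mod.single g f) =
              Polynomial.X * ∑ α, ∑ i, (defect T ν κ α (pinv κ g (e i))
                (reflOp ν κ γ y (Mod.single g (pderiv (α, i) f))) +
                Polynomial.C ((κ * sgn α : ℝ) : ℂ) * defect T ν κ α (proj κ g (e i))
                (reflOp ν κ γ y (Mod.single g (X (α.rev, i) * f)))) -
              Polynomial.X * defect T ν κ γ y (lapl κ (reflOp ν κ) (Mod.single g f)) -
              defect T ν κ γ y (Mod.single g (secondOrder κ g f)) := by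
            rw [← h4]
            ring
          rw [h5, pow_succ']
          refine dvd_sub (dvd_sub (mul_dvd_mul_left _ ?_) (mul_dvd_mul_left _ (ihk _ _ _)))
            (by rw [← pow_succ']; exact h2 y)
          exact Finset.dvd_sum fun α _ => Finset.dvd_sum fun i _ =>
            dvd_add (ihk _ _ _) ((ihk _ _ _).mul_left _)
        have hcancel : ∀ (c : ℂ) (p : Polynomial ℂ), c ≠ 0 →
            Polynomial.X ^ (k + 1) ∣ c • p → Polynomial.X ^ (k + 1) ∣ p := by
          intro c p hc hp
          have := hp.mul_left (Polynomial.C c⁻¹)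
          rwa [Polynomial.smul_eq_C_mul, ← mul_assoc, ← Polynomial.C_mul, inv_mul_cancel₀ hc,
            Polynomial.C_1, one_mul] at this
        have hp := proj_of_mem hR hκ (proj_mem hκ g x)
        have h6 : Polynomial.X ^ (k + 1) ∣ defect T ν κ γ (proj κ g x) (Mod.single g f) := by
          by_cases hE : eigenDim κ g = 0
          · rw [proj_eq_zero hκ hE, defect_zero]
            exact dvd_zero _
          -- On the eigenspace x - 2 `proj x` is -x, so the factor is n + 2E - 1, which is at least
          -- 1 because E ≥ 1. On the orthogonal complement, treated next, it is n + 2E + 1.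
          · refine hcancel (n + 2 * eigenDim κ g - 1 : ℂ) _ ?_ ?_
            · intro h0
              have h0' : ((n + 2 * eigenDim κ g : ℕ) : ℂ) = ((1 : ℕ) : ℂ) := by
                push_cast
                linear_combination h0
              rw [Nat.cast_inj] at h0'
              omega
            · have := h3 (proj κ g x)
              rw [sub_smul, one_smul]
              rwa [hp, sub_self, zero_sub, defect_neg, ← sub_eq_add_neg] at this
        have h7 : Polynomial.X ^ (k + 1) ∣
            defect T ν κ γ (x - proj κ g x) (Mod.single g f) := by
          refine hcancel (n + 2 * eigenDim κ g + 1 : ℂ) _ ?_ ?_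
          · exact_mod_cast Nat.succ_ne_zero (n + 2 * eigenDim κ g)
          · have := h3 (x - proj κ g x)
            rw [add_smul, one_smul]
            rwa [map_sub, hp, sub_self, sub_zero, sub_zero] at this
        have h8 := dvd_add h6 h7
        rwa [← defect_add, add_sub_cancel] at h8
    induction m using Mod.induction with
    | zero => rw [map_zero]; exact dvd_zero _
    | add m m' h h' => rw [map_add]; exact dvd_add h h'
    | single g f =>
      rw [← sum_homogeneousComponent f, map_sum, map_sum]
      exact Finset.dvd_sum fun n _ => hom n γ x g _ (homogeneousComponent_isHomogeneous n f)

theorem defect_eq_zero (hR : IsRootSystem R) {ν : R → ℂ} (hν : IsInvariantParam ν) {κ : ℝ}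
    (hκ : κ * κ = 1) {T : Mod R →ₗ[ℂ] Polynomial ℂ}
    (hl : ∀ m, T (lapl κ (weylOp R κ) m) + Polynomial.X * T (lapl κ (reflOp ν κ) m) = 0)
    (ht : ∀ w m, T (conjGrp w m) = T m) (γ : Fin 2) (x : V N) (m : Mod R) :
    defect T ν κ γ x m = 0 := by
  ext k
  exact Polynomial.X_pow_dvd_iff.1 (X_pow_dvd_defect hR hν hκ hl ht (k + 1) γ x m) k
    (Nat.lt_succ_self k)

/-- Existence of twisted traces with prescribed values on the group elements without
eigenvalue `κ`. -/
theorem exists_twistedTrace (hR : IsRootSystem R) {ν : R → ℂ} (hν : IsInvariantParam ν) {κ : ℝ}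
    (hκ : κ * κ = 1) {φ : W R → ℂ} (hφ : ∀ w g, φ (w * g * w⁻¹) = φ g) :
    ∃ t : Mod R →ₗ[ℂ] ℂ, (∀ γ x m, t (commOp ν κ γ x m) = 0) ∧
      (∀ w m, t (conjGrp w m) = t m) ∧
      ∀ g, eigenDim κ g = 0 → t (Mod.single g 1) = φ g := by
  obtain ⟨T, hl, ht, h1⟩ := exists_apply_lapl_eq_zero hR hν hκ hφ
  -- Setting the variable equal to 1 returns to the parameters ν.
  refine ⟨Polynomial.leval 1 ∘ₗ T, fun γ x m => ?_, fun w m => ?_, fun g hg => ?_⟩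
  · have := eval_defect T ν κ γ x m 1
    rw [defect_eq_zero hR hν hκ hl ht, one_smul, Polynomial.eval_zero] at this
    exact this.symm
  · rw [LinearMap.comp_apply, LinearMap.comp_apply, ht]
  · rw [LinearMap.comp_apply, h1 g hg]
    exact Polynomial.eval_C

/-- Every term of the Laplacian ends with a `commOp`, so twisted traces fall under the uniqueness
statement for `lapl`. -/
theorem lapl_commOp_eq_zero {ν : R → ℂ} {κ : ℝ} {t : Mod R →ₗ[ℂ] ℂ}
    (h : ∀ γ x m, t (commOp ν κ γ x m) = 0) (m : Mod R) : t (lapl κ (commOp ν κ) m) = 0 := by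
  have : t ∘ₗ lapl κ (commOp ν κ) = 0 := by
    refine Mod.hom_ext fun g f => ?_
    rw [LinearMap.comp_apply, lapl_single, map_sum]
    refine Finset.sum_eq_zero fun α _ => ?_
    rw [map_sum]
    refine Finset.sum_eq_zero fun i _ => ?_
    rw [map_add, map_smul, h, h, smul_zero, add_zero]
  exact LinearMap.congr_fun this m

/-- Twisted traces are determined by their values on the group elements without
eigenvalue `κ`. -/
theorem twistedTrace_eq_zero (hR : IsRootSystem R) {ν : R → ℂ} {κ : ℝ}
    (hκ : κ * κ = 1) {t : Mod R →ₗ[ℂ] ℂ} (h : ∀ γ x m, t (commOp ν κ γ x m) = 0)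
    (h1 : ∀ g, eigenDim κ g = 0 → t (Mod.single g 1) = 0) : t = 0 := by
  refine eq_zero_of_lapl hR hκ LinearMap.id (ν := ν) (fun m => ?_) h1
  have := lapl_commOp_eq_zero h m
  rwa [lapl_commOp, map_add] at this

end Deformation

end Calogero

namespace Calogero
open scoped InnerProductSpace

/-! ### Twisted traces on the algebra and their dimension; traces. -/

section TwistedTraces

variable {N : ℕ} {R : Finset (V N)}

/-- The functionals which are traces with respect to the group elements and satisfy the trace
property up to the factor `κ` with respect to the letters. -/
noncomputable def twistedTraces (ν : R → ℂ) (κ : ℝ) : Submodule ℂ (Module.Dual ℂ (H ν)) where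
  carrier := {t | (∀ γ x h, t (h * vec ν γ x) = κ * t (vec ν γ x * h)) ∧
    ∀ w h, t (h * grp ν w) = t (grp ν w * h)}
  add_mem' := by
    intro s t hs ht
    refine ⟨fun γ x h => ?_, fun w h => ?_⟩
    · rw [LinearMap.add_apply, LinearMap.add_apply, hs.1, ht.1, mul_add]
    · rw [LinearMap.add_apply, LinearMap.add_apply, hs.2, ht.2]
  zero_mem' := by
    refine ⟨fun γ x h => ?_, fun w h => rfl⟩
    rw [LinearMap.zero_apply, LinearMap.zero_apply, mul_zero]
  smul_mem' := by
    intro c t ht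
    refine ⟨fun γ x h => ?_, fun w h => ?_⟩
    · rw [LinearMap.smul_apply, LinearMap.smul_apply, ht.1, smul_eq_mul, smul_eq_mul,
        mul_left_comm]
    · rw [LinearMap.smul_apply, LinearMap.smul_apply, ht.2]

theorem eq_zero_of_mem_twistedTraces (hR : IsRootSystem R) {ν : R → ℂ} (hν : IsInvariantParam ν)
    {κ : ℝ} (hκ : κ * κ = 1) {t : Module.Dual ℂ (H ν)} (ht : t ∈ twistedTraces ν κ)
    (h : ∀ g, eigenDim κ g = 0 → t (grp ν g) = 0) : t = 0 := by
  have h0 : t ∘ₗ toH ν = 0 := by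
    refine twistedTrace_eq_zero hR hκ (ν := ν) (fun γ x m => ?_) fun g hg => ?_
    · rw [LinearMap.comp_apply, toH_commOp hR, map_sub, map_smul, ht.1, smul_eq_mul, sub_self]
    · rw [LinearMap.comp_apply, toH_single, normal_one, one_mul, h g hg]
  refine LinearMap.ext fun x => ?_
  obtain ⟨m, rfl⟩ := (pbw hR hν).surjective x
  exact LinearMap.congr_fun h0 m

theorem exists_mem_twistedTraces (hR : IsRootSystem R) {ν : R → ℂ} (hν : IsInvariantParam ν)
    {κ : ℝ} (hκ : κ * κ = 1) {φ : W R → ℂ} (hφ : ∀ w g, φ (w * g * w⁻¹) = φ g) :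
    ∃ t ∈ twistedTraces ν κ, ∀ g, eigenDim κ g = 0 → t (grp ν g) = φ g := by
  obtain ⟨t, h1, h2, h3⟩ := exists_twistedTrace hR hν hκ hφ
  let τ : H ν →ₗ[ℂ] ℂ := t ∘ₗ (pbw hR hν).symm.toLinearMap
  have hτ : ∀ m, τ (toH ν m) = t m := by
    intro m
    simp only [τ, LinearMap.comp_apply, LinearEquiv.coe_coe]
    rw [← pbw_apply hR hν, LinearEquiv.symm_apply_apply]
  refine ⟨τ, ⟨fun γ x h => ?_, fun w h => ?_⟩, fun g hg => ?_⟩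
  · obtain ⟨m, rfl⟩ := (pbw hR hν).surjective h
    have := h1 γ x m
    rwa [← hτ, toH_commOp hR, map_sub, map_smul, smul_eq_mul, sub_eq_zero] at this
  · obtain ⟨m, hm⟩ := (pbw hR hν).surjective (h * grp ν w)
    rw [pbw_apply] at hm
    rw [← hm, hτ, ← h2 w m, ← hτ, toH_conjGrp, hm, mul_assoc, mul_assoc, grp_mul, mul_inv_cancel,
      grp_one, mul_one]
  · rw [← h3 g hg, ← hτ, toH_single, normal_one, one_mul]

theorem apply_grp_of_isConj {ν : R → ℂ} {κ : ℝ} {t : Module.Dual ℂ (H ν)}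
    (ht : t ∈ twistedTraces ν κ) {a b : W R} (h : IsConj a b) : t (grp ν a) = t (grp ν b) := by
  obtain ⟨c, rfl⟩ := isConj_iff.1 h
  rw [← grp_mul, ht.2, grp_mul, inv_mul_cancel_left]

/-- The conjugacy classes of the reflection group whose elements do not have the
eigenvalue `κ`. -/
abbrev ClassesWithoutEigenvalue (R : Finset (V N)) (κ : ℝ) : Type :=
  {C : ConjClasses (W R) // ∀ w ∈ C.carrier,
    ¬ Module.End.HasEigenvalue
      ((w : V N ≃ₗᵢ[ℝ] V N).toLinearEquiv : V N →ₗ[ℝ] V N) κ}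

theorem forall_mem_carrier_mk {κ : ℝ} {g : W R} : (∀ w ∈ (ConjClasses.mk g).carrier,
    ¬ Module.End.HasEigenvalue
      ((w : V N ≃ₗᵢ[ℝ] V N).toLinearEquiv : V N →ₗ[ℝ] V N) κ) ↔ eigenDim κ g = 0 := by
  simp only [← eigenDim_eq_zero, ConjClasses.mem_carrier_iff_mk_eq, ConjClasses.mk_eq_mk_iff_isConj]
  refine ⟨fun h => h g (IsConj.refl g), fun h w hw => ?_⟩
  obtain ⟨c, rfl⟩ := isConj_iff.1 hw.symm
  rw [eigenDim_conj, h]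

/-- The values of a twisted trace on conjugacy classes. -/
noncomputable def classValues (ν : R → ℂ) (κ : ℝ) :
    twistedTraces ν κ →ₗ[ℂ] (ClassesWithoutEigenvalue R κ → ℂ) where
  toFun t C := t.1 (grp ν C.1.exists_rep.choose)
  map_add' _ _ := rfl
  map_smul' _ _ := rfl

theorem classValues_mk {ν : R → ℂ} {κ : ℝ} (t : twistedTraces ν κ) (g : W R) (hg) :
    classValues ν κ t ⟨ConjClasses.mk g, hg⟩ = t.1 (grp ν g) := by
  refine apply_grp_of_isConj t.2 ?_
  rw [← ConjClasses.mk_eq_mk_iff_isConj]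
  exact (ConjClasses.mk g).exists_rep.choose_spec

theorem classValues_bijective (hR : IsRootSystem R) {ν : R → ℂ} (hν : IsInvariantParam ν)
    {κ : ℝ} (hκ : κ * κ = 1) : Function.Bijective (classValues ν κ) := by
  classical
  constructor
  · rw [← LinearMap.ker_eq_bot, LinearMap.ker_eq_bot']
    intro t ht
    refine Subtype.ext (eq_zero_of_mem_twistedTraces hR hν hκ t.2 fun g hg => ?_)
    rw [← classValues_mk t g (forall_mem_carrier_mk.2 hg), ht]
    rfl
  · intro c
    let φ : W R → ℂ := fun g => if h : eigenDim κ g = 0 then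
      c ⟨ConjClasses.mk g, forall_mem_carrier_mk.2 h⟩ else 0
    have hφ : ∀ w g, φ (w * g * w⁻¹) = φ g := by
      intro w g
      have h : ConjClasses.mk (w * g * w⁻¹) = ConjClasses.mk g :=
        ConjClasses.mk_eq_mk_iff_isConj.2 (isConj_iff.2 ⟨w, rfl⟩).symm
      simp only [φ, eigenDim_conj, h]
    obtain ⟨t, ht, h1⟩ := exists_mem_twistedTraces hR hν hκ hφ
    refine ⟨⟨t, ht⟩, funext fun C => ?_⟩
    obtain ⟨C, hC⟩ := C
    obtain ⟨g, rfl⟩ := C.exists_rep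
    have hg : eigenDim κ g = 0 := forall_mem_carrier_mk.1 hC
    refine (classValues_mk ⟨t, ht⟩ g hC).trans ((h1 g hg).trans ?_)
    simp only [φ, dif_pos hg]

theorem finrank_twistedTraces (hR : IsRootSystem R) {ν : R → ℂ} (hν : IsInvariantParam ν)
    {κ : ℝ} (hκ : κ * κ = 1) : Module.Finite ℂ (twistedTraces ν κ) ∧
      Module.finrank ℂ (twistedTraces ν κ) = numClassesWithoutEigenvalue R κ := by
  have := hR.finite
  have : Finite (ConjClasses (W R)) := Finite.of_surjective _ ConjClasses.mk_surjective
  have : Fintype (ClassesWithoutEigenvalue R κ) := Fintype.ofFinite _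
  let E := LinearEquiv.ofBijective (classValues ν κ) (classValues_bijective hR hν hκ)
  refine ⟨Module.Finite.equiv E.symm, ?_⟩
  rw [E.finrank_eq, Module.finrank_fintype_fun_eq_card, numClassesWithoutEigenvalue,
    Nat.card_eq_fintype_card]

/-- If the trace property holds for a and for b as one of the two factors, it holds for ab, so
generators suffice. -/
theorem traces_eq (ν : R → ℂ) : traces ν = twistedTraces ν 1 := by
  ext t
  constructor
  · intro ht
    refine ⟨fun γ x h => ?_, fun w h => ht _ _⟩
    rw [Complex.ofReal_one, one_mul]
    exact ht _ _
  · intro ht f g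
    induction g using H.induction generalizing f with
    | algebraMap c => rw [Algebra.commutes]
    | grp w => exact ht.2 w f
    | vec α x =>
      have := ht.1 α x f
      rwa [Complex.ofReal_one, one_mul] at this
    | mul a b ha hb => rw [← mul_assoc, hb, ← mul_assoc, ha, mul_assoc]
    | add a b ha hb => rw [mul_add, add_mul, map_add, map_add, ha, hb]

end TwistedTraces

/-! ### Parity and supertraces. -/

section Parity

variable {N : ℕ} {R : Finset (V N)}

/-- The sign of a parity. -/
def paritySign (p : ZMod 2) : ℂ := (-1) ^ p.val

theorem paritySign_zero : paritySign 0 = 1 := pow_zero _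

theorem paritySign_one : paritySign 1 = -1 := pow_one _

theorem paritySign_add (p q : ZMod 2) : paritySign (p + q) = paritySign p * paritySign q := by
  have h : ∀ p : ZMod 2, p = 0 ∨ p = 1 := by decide
  rcases h p with rfl | rfl <;> rcases h q with rfl | rfl
  · rw [add_zero, paritySign_zero, mul_one]
  · rw [zero_add, paritySign_zero, one_mul]
  · rw [add_zero, paritySign_zero, mul_one]
  · rw [show (1 + 1 : ZMod 2) = 0 from rfl, paritySign_zero, paritySign_one]
    norm_num

theorem list_prod_mem_parityPart (ν : R → ℂ) (l : List (Gen R)) :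
    (l.map (gen ν)).prod ∈ parityPart ν (l.map genParity).sum :=
  Submodule.subset_span ⟨l, rfl, rfl⟩

theorem gen_mem_parityPart (ν : R → ℂ) (x : Gen R) : gen ν x ∈ parityPart ν (genParity x) := by
  have := list_prod_mem_parityPart ν [x]
  simpa using this

theorem grp_mem_parityPart (ν : R → ℂ) (w : W R) : grp ν w ∈ parityPart ν 0 :=
  gen_mem_parityPart ν (Gen.g w)

theorem vec_mem_parityPart (ν : R → ℂ) (α : Fin 2) (x : V N) : vec ν α x ∈ parityPart ν 1 := by
  rw [vec, comb_apply]
  exact Submodule.sum_mem _ fun i _ =>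
    Submodule.smul_mem _ _ (gen_mem_parityPart ν (Gen.a α i))

theorem mul_mem_parityPart {ν : R → ℂ} {p q : ZMod 2} {f g : H ν} (hf : f ∈ parityPart ν p)
    (hg : g ∈ parityPart ν q) {r : ZMod 2} (hr : p + q = r) : f * g ∈ parityPart ν r := by
  subst hr
  induction hf, hg using Submodule.span_induction₂ with
  | mem_mem x y hx hy =>
    obtain ⟨l, rfl, rfl⟩ := hx
    obtain ⟨l', rfl, rfl⟩ := hy
    have := list_prod_mem_parityPart ν (l ++ l')
    simpa using this
  | zero_left y hy => rw [zero_mul]; exact Submodule.zero_mem _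
  | zero_right y hy => rw [mul_zero]; exact Submodule.zero_mem _
  | add_left x y z _ _ _ h h' => rw [add_mul]; exact Submodule.add_mem _ h h'
  | add_right x y z _ _ _ h h' => rw [mul_add]; exact Submodule.add_mem _ h h'
  | smul_left r x y _ _ h => rw [smul_mul_assoc]; exact Submodule.smul_mem _ _ h
  | smul_right r x y _ _ h => rw [mul_smul_comm]; exact Submodule.smul_mem _ _ h

theorem exists_add_parityPart {ν : R → ℂ} (h : H ν) :
    ∃ f ∈ parityPart ν 0, ∃ g ∈ parityPart ν 1, h = f + g := by
  induction h using H.induction with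
  | algebraMap c =>
    refine ⟨_, ?_, 0, Submodule.zero_mem _, (add_zero _).symm⟩
    rw [Algebra.algebraMap_eq_smul_one]
    exact Submodule.smul_mem _ _ (list_prod_mem_parityPart ν [])
  | grp w => exact ⟨_, grp_mem_parityPart ν w, 0, Submodule.zero_mem _, (add_zero _).symm⟩
  | vec α x => exact ⟨0, Submodule.zero_mem _, _, vec_mem_parityPart ν α x, (zero_add _).symm⟩
  | mul a b ha hb =>
    obtain ⟨f, hf, g, hg, rfl⟩ := ha
    obtain ⟨f', hf', g', hg', rfl⟩ := hb
    refine ⟨f * f' + g * g', ?_, f * g' + g * f', ?_, ?_⟩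
    · exact Submodule.add_mem _ (mul_mem_parityPart hf hf' rfl) (mul_mem_parityPart hg hg' rfl)
    · exact Submodule.add_mem _ (mul_mem_parityPart hf hg' rfl) (mul_mem_parityPart hg hf' rfl)
    · rw [add_mul, mul_add, mul_add, add_comm (g * f'), add_add_add_comm]
  | add a b ha hb =>
    obtain ⟨f, hf, g, hg, rfl⟩ := ha
    obtain ⟨f', hf', g', hg', rfl⟩ := hb
    exact ⟨f + f', Submodule.add_mem _ hf hf', g + g', Submodule.add_mem _ hg hg',
      add_add_add_comm _ _ _ _⟩

theorem eq_of_parityPart {ν : R → ℂ} {A B : Module.Dual ℂ (H ν)}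
    (h0 : ∀ f ∈ parityPart ν 0, A f = B f) (h1 : ∀ f ∈ parityPart ν 1, A f = B f) (h : H ν) :
    A h = B h := by
  obtain ⟨f, hf, g, hg, rfl⟩ := exists_add_parityPart h
  rw [map_add, map_add, h0 f hf, h1 g hg]

/-- The parity automorphism. -/
noncomputable def parityHom (ν : R → ℂ) : H ν →ₐ[ℂ] H ν :=
  RingQuot.liftAlgHom ℂ ⟨FreeAlgebra.lift ℂ fun x => paritySign (genParity x) • gen ν x, by
    have hg : ∀ w : W R, FreeAlgebra.lift ℂ (fun x => paritySign (genParity x) • gen ν x)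
        (Free.grp w) = grp ν w := by
      intro w
      rw [Free.grp, FreeAlgebra.lift_ι_apply, genParity, paritySign_zero, one_smul]
      rfl
    have hv : ∀ (α : Fin 2) (x : V N),
        FreeAlgebra.lift ℂ (fun x => paritySign (genParity x) • gen ν x)
        (Free.vec α x) = (-1 : ℂ) • vec ν α x := by
      intro α x
      rw [Free.vec, map_sum, vec, comb_apply, Finset.smul_sum]
      refine Finset.sum_congr rfl fun i _ => ?_
      rw [map_smul, FreeAlgebra.lift_ι_apply, genParity, paritySign_one, smul_comm]
    intro a b hab
    cases hab with
    | grp_one => rw [hg, grp_one, map_one]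
    | grp_mul w₁ w₂ => rw [map_mul, hg, hg, hg, grp_mul]
    | grp_vec w α x => rw [map_mul, map_mul, hg, hv, hv, mul_smul_comm, smul_mul_assoc, grp_vec]
    | comm α β x y =>
      have h1 : (-1 : ℂ) * -1 = 1 := by norm_num
      rw [map_sub, map_mul, map_mul, hv, hv, smul_mul_smul_comm, smul_mul_smul_comm, h1,
        one_smul, one_smul, vec_comm, map_smul,
        map_add, AlgHom.commutes, map_sum]
      simp only [map_smul, hg]
      rfl⟩

theorem parityHom_gen (ν : R → ℂ) (x : Gen R) :
    parityHom ν (gen ν x) = paritySign (genParity x) • gen ν x := by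
  rw [parityHom, gen, RingQuot.liftAlgHom_mkAlgHom_apply, FreeAlgebra.lift_ι_apply]
  rfl

theorem parityHom_of_mem {ν : R → ℂ} {p : ZMod 2} {f : H ν} (hf : f ∈ parityPart ν p) :
    parityHom ν f = paritySign p • f := by
  induction hf using Submodule.span_induction with
  | mem x hx =>
    obtain ⟨l, rfl, rfl⟩ := hx
    induction l with
    | nil => simp [paritySign_zero]
    | cons a l ih =>
      rw [List.map_cons, List.prod_cons, map_mul, ih, parityHom_gen, List.map_cons, List.sum_cons,
        paritySign_add, smul_mul_smul_comm]
  | zero => rw [map_zero, smul_zero]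
  | add x y _ _ hx hy => rw [map_add, hx, hy, smul_add]
  | smul c x _ hx => rw [map_smul, hx, smul_comm]

theorem parityHom_grp (ν : R → ℂ) (w : W R) : parityHom ν (grp ν w) = grp ν w := by
  rw [parityHom_of_mem (grp_mem_parityPart ν w), paritySign_zero, one_smul]

theorem parityHom_vec (ν : R → ℂ) (α : Fin 2) (x : V N) :
    parityHom ν (vec ν α x) = (-1 : ℂ) • vec ν α x := by
  rw [parityHom_of_mem (vec_mem_parityPart ν α x), paritySign_one]

theorem comp_parityHom_mem {ν : R → ℂ} {κ : ℝ} {t : Module.Dual ℂ (H ν)}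
    (ht : t ∈ twistedTraces ν κ) : t ∘ₗ (parityHom ν).toLinearMap ∈ twistedTraces ν κ := by
  refine ⟨fun γ x h => ?_, fun w h => ?_⟩
  · simp only [LinearMap.comp_apply, AlgHom.toLinearMap_apply, map_mul, parityHom_vec,
      mul_smul_comm, smul_mul_assoc, map_smul, ht.1, smul_eq_mul, mul_left_comm]
  · simp only [LinearMap.comp_apply, AlgHom.toLinearMap_apply, map_mul, parityHom_grp, ht.2]

/-- The parity automorphism preserves twisted traces and fixes the group elements, on which they are
determined. Hence twisted traces vanish on odd elements. -/
theorem twistedTraces_parityHom (hR : IsRootSystem R) {ν : R → ℂ} (hν : IsInvariantParam ν)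
    {κ : ℝ} (hκ : κ * κ = 1) {t : Module.Dual ℂ (H ν)} (ht : t ∈ twistedTraces ν κ) (h : H ν) :
    t (parityHom ν h) = t h := by
  have h0 : t ∘ₗ (parityHom ν).toLinearMap - t = 0 := by
    refine eq_zero_of_mem_twistedTraces hR hν hκ
      (Submodule.sub_mem _ (comp_parityHom_mem ht) ht) fun g _ => ?_
    rw [LinearMap.sub_apply, LinearMap.comp_apply, AlgHom.toLinearMap_apply, parityHom_grp,
      sub_self]
  exact sub_eq_zero.1 (LinearMap.congr_fun h0 h)

theorem apply_eq_zero_of_odd (hR : IsRootSystem R) {ν : R → ℂ} (hν : IsInvariantParam ν)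
    {κ : ℝ} (hκ : κ * κ = 1) {t : Module.Dual ℂ (H ν)} (ht : t ∈ twistedTraces ν κ) {h : H ν}
    (hh : h ∈ parityPart ν 1) : t h = 0 := by
  have := twistedTraces_parityHom hR hν hκ ht h
  rw [parityHom_of_mem hh, paritySign_one, map_smul, neg_one_smul] at this
  exact self_eq_neg.1 this.symm

theorem supertrace_mul_grp {ν : R → ℂ} {s : Module.Dual ℂ (H ν)} (hs : s ∈ supertraces ν)
    (w : W R) (h : H ν) : s (h * grp ν w) = s (grp ν w * h) := by
  refine eq_of_parityPart (A := s ∘ₗ LinearMap.mulRight ℂ (grp ν w))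
    (B := s ∘ₗ LinearMap.mulLeft ℂ (grp ν w)) (fun f hf => ?_) (fun f hf => ?_) h
  · have h1 := hs 0 0 f hf _ (grp_mem_parityPart ν w)
    rwa [ZMod.val_zero, mul_zero, pow_zero, one_mul] at h1
  · have h1 := hs 1 0 f hf _ (grp_mem_parityPart ν w)
    rwa [ZMod.val_zero, mul_zero, pow_zero, one_mul] at h1

/-- Supertraces vanish on odd elements. -/
theorem supertrace_eq_zero_of_odd (hR : IsRootSystem R) {ν : R → ℂ} (hν : IsInvariantParam ν)
    {s : Module.Dual ℂ (H ν)} (hs : s ∈ supertraces ν) {h : H ν} (hh : h ∈ parityPart ν 1) :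
    s h = 0 := by
  have hev : ∀ f ∈ parityPart ν 0, (s - s ∘ₗ (parityHom ν).toLinearMap) f = 0 := by
    intro f hf
    rw [LinearMap.sub_apply, LinearMap.comp_apply, AlgHom.toLinearMap_apply, parityHom_of_mem hf,
      paritySign_zero, one_smul, sub_self]
  have hodd : ∀ f ∈ parityPart ν 1, (s - s ∘ₗ (parityHom ν).toLinearMap) f = s f + s f := by
    intro f hf
    rw [LinearMap.sub_apply, LinearMap.comp_apply, AlgHom.toLinearMap_apply, parityHom_of_mem hf,
      paritySign_one, map_smul, neg_one_smul, sub_neg_eq_add]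
  -- This difference is zero on even elements and 2s on odd ones. An odd product has one even
  -- factor, so no sign arises and the difference is an ordinary trace. As it vanishes on the group,
  -- it is zero.
  have hmem : s - s ∘ₗ (parityHom ν).toLinearMap ∈ twistedTraces ν 1 := by
    refine ⟨fun γ x h => ?_, fun w h => ?_⟩
    · have hv := vec_mem_parityPart ν γ x
      rw [Complex.ofReal_one, one_mul]
      refine eq_of_parityPart
        (A := (s - s ∘ₗ (parityHom ν).toLinearMap) ∘ₗ LinearMap.mulRight ℂ (vec ν γ x))
        (B := (s - s ∘ₗ (parityHom ν).toLinearMap) ∘ₗ LinearMap.mulLeft ℂ (vec ν γ x))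
        (fun f hf => ?_) (fun f hf => ?_) h
      · have h1 := hs 0 1 f hf _ hv
        rw [ZMod.val_zero, zero_mul, pow_zero, one_mul] at h1
        have e1 := hodd _ (mul_mem_parityPart hf hv rfl)
        have e2 := hodd _ (mul_mem_parityPart hv hf rfl)
        rw [← h1] at e2
        exact e1.trans e2.symm
      · exact (hev _ (mul_mem_parityPart hf hv rfl)).trans (hev _ (mul_mem_parityPart hv hf rfl)).symm
    · have h1 := supertrace_mul_grp hs w h
      have h2 := supertrace_mul_grp hs w (parityHom ν h)
      simp only [LinearMap.sub_apply, LinearMap.comp_apply, AlgHom.toLinearMap_apply, map_mul,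
        parityHom_grp, h1, h2]
  have h0 : s - s ∘ₗ (parityHom ν).toLinearMap = 0 :=
    eq_zero_of_mem_twistedTraces hR hν (one_mul 1) hmem fun g _ => hev _ (grp_mem_parityPart ν g)
  have h1 := hodd h hh
  rw [h0, LinearMap.zero_apply] at h1
  exact add_self_eq_zero.1 h1.symm

theorem mul_eq_parityHom_mul {ν : R → ℂ} {t : Module.Dual ℂ (H ν)}
    (ht : t ∈ twistedTraces ν (-1)) (f g : H ν) : t (f * g) = t (parityHom ν g * f) := by
  induction g using H.induction generalizing f with
  | algebraMap c => rw [AlgHom.commutes, Algebra.commutes]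
  | grp w => rw [parityHom_grp, ht.2]
  | vec α x =>
    rw [parityHom_vec, ht.1, smul_mul_assoc, map_smul, Complex.ofReal_neg, Complex.ofReal_one,
      smul_eq_mul]
  | mul a b ha hb => rw [← mul_assoc, hb, ← mul_assoc, ha, map_mul (parityHom ν), mul_assoc]
  | add a b ha hb => rw [mul_add, map_add (parityHom ν), add_mul, map_add, map_add, ha, hb]

/-- The conditions differ for h x_γ with h even: a supertrace has no sign there, a twisted trace has
-1. They agree because both kinds of functional vanish on odd elements. -/
theorem supertraces_eq (hR : IsRootSystem R) {ν : R → ℂ} (hν : IsInvariantParam ν) :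
    supertraces ν = twistedTraces ν (-1) := by
  have hκ : (-1 : ℝ) * -1 = 1 := by norm_num
  have hone : (1 : ZMod 2).val = 1 := rfl
  ext t
  constructor
  · intro ht
    refine ⟨fun γ x h => ?_, supertrace_mul_grp ht⟩
    have hv := vec_mem_parityPart ν γ x
    refine eq_of_parityPart (A := t ∘ₗ LinearMap.mulRight ℂ (vec ν γ x))
      (B := ((-1 : ℝ) : ℂ) • t ∘ₗ LinearMap.mulLeft ℂ (vec ν γ x))
      (fun f hf => ?_) (fun f hf => ?_) h
    · have e1 := supertrace_eq_zero_of_odd hR hν ht (mul_mem_parityPart hf hv rfl)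
      have e2 := supertrace_eq_zero_of_odd hR hν ht (mul_mem_parityPart hv hf rfl)
      rw [LinearMap.smul_apply, LinearMap.comp_apply, LinearMap.comp_apply,
        LinearMap.mulRight_apply, LinearMap.mulLeft_apply, e1, e2, smul_zero]
    · have h1 := ht 1 1 f hf _ hv
      rw [hone, mul_one, pow_one] at h1
      rw [LinearMap.smul_apply, LinearMap.comp_apply, LinearMap.comp_apply,
        LinearMap.mulRight_apply, LinearMap.mulLeft_apply, h1, Complex.ofReal_neg,
        Complex.ofReal_one, smul_eq_mul]
  · intro ht p q f hf g hg
    rw [mul_eq_parityHom_mul ht, parityHom_of_mem hg, smul_mul_assoc, map_smul, smul_eq_mul]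
    have hpq := fun {r} => mul_mem_parityPart (r := r) hg hf
    have h2 : ∀ p : ZMod 2, p = 0 ∨ p = 1 := by decide
    rcases h2 p with rfl | rfl <;> rcases h2 q with rfl | rfl
    · rw [ZMod.val_zero, mul_zero, pow_zero, paritySign_zero]
    · rw [apply_eq_zero_of_odd hR hν hκ ht (hpq rfl), mul_zero, mul_zero]
    · rw [apply_eq_zero_of_odd hR hν hκ ht (hpq rfl), mul_zero, mul_zero]
    · rw [hone, mul_one, pow_one, paritySign_one]

end Parity

end Calogero

theorem theorem3 (N : ℕ) (R : Finset (Calogero.V N)) (hR : Calogero.IsRootSystem R)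
    (ν : R → ℂ) (hν : Calogero.IsInvariantParam ν) :
    (Module.Finite ℂ (Calogero.traces ν) ∧
      Module.finrank ℂ (Calogero.traces ν) =
        Calogero.numClassesWithoutEigenvalue R 1) ∧
    (Module.Finite ℂ (Calogero.supertraces ν) ∧
      Module.finrank ℂ (Calogero.supertraces ν) =
        Calogero.numClassesWithoutEigenvalue R (-1)) := by
  rw [Calogero.traces_eq, Calogero.supertraces_eq hR hν]
  exact ⟨Calogero.finrank_twistedTraces hR hν (one_mul 1),
    Calogero.finrank_twistedTraces hR hν (by norm_num)⟩
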